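/- Let $M$ be a smooth 4-manifold with a para-Kähler–Einstein (pKE) structure $(g,K)$: $g$ is a metric of split signature, $K$ an endomorphism field of $TM$ with $K^2=\mathrm{id}$ and $g(K\cdot,K\cdot)=-g$ whose $\pm1$-eigenspaces $\mathscr H,\bar{\mathscr H}$ have rank 2 and are integrable, the 2-form $\rho=g(K\cdot,\cdot)$ is closed, and the trace-free Ricci tensor of $g$ vanishes. A local coframe $(\theta^1,\theta^2,\theta^3,\theta^4)$ is adapted if $g=2\theta^1\theta^3+2\theta^2\theta^4$ (with $\theta^a\theta^b=\frac12(\theta^a\otimes\theta^b+\theta^b\otimes\theta^a)$), $K^*\theta^a=\theta^a$ for $a=1,2$ and $K^*\theta^a=-\theta^a$ for $a=3,4$; $M$ is oriented by $\theta^1\wedge\theta^2\wedge\theta^3\wedge\theta^4$, $\Gamma^a{}_b$ are the Levi-Civita connection forms in the coframe, and $\Psi_2'=C_{1234}$ is the component of the self-dual Weyl tensor in the dual frame. Let $\mathcal O_+$ be the set of all pairs $(p,N)$ with $N\subset T_pM$ a self-dual null plane. 1. $\mathcal O_+$ is a circle bundle over $M$ and a smooth 5-manifold: over the domain of an adapted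 coframe its fibres are parametrized by $\mu\in\mathbb R\cup\{\infty\}$ through $N=\operatorname{Ker}\{\theta^1+\mu\theta^4,\theta^2-\mu\theta^3\}$; $\mu$ and $1/\mu$ are affine coordinates on the fibres, and all changes of the resulting charts are smooth. 2. Let $\mathscr D_{(p,N)}\subset T_{(p,N)}\mathcal O_+$ be the horizontal lift of $N\subset T_pM$ for the Levi-Civita connection. Then $\mathscr D$ is a well-defined smooth rank 2 distribution on $\mathcal O_+$ (the twistor distribution), and for every adapted coframe $\mathscr D=\operatorname{Ker}\{\theta^1+\mu\theta^4,\ \theta^2-\mu\theta^3,\ d\mu+\mu(\Gamma^1{}_1+\Gamma^2{}_2)\}$. 3. The sections $\mathscr H$ and $\bar{\mathscr H}$ of $\mathcal O_+$ correspond to $\mu\in\{0,\infty\}$, so that $\mathcal N_+^*=\mathcal O_+\setminus\{\mathscr H,\bar{\mathscr H}\}$ corresponds to $\mu\in\mathbb R^*$. 4. Suppose that the scalar curvature of $g$ is nowhere zero. Then $\mathscr D$ is a (2,3,5)-distribution on $\mathcal N_+^*$, that is, $\partial\mathscr D$ and $\partial^2\mathscr D=\partial(\partial\mathscr D)$ have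 ranks 3 and 5. Along each of the two hypersurfaces $\mathscr H,\bar{\mathscr H}\subset\mathcal O_+$ the distribution $\mathscr D$ is tangent to the hypersurface and $\partial\mathscr D=\mathscr D$. On $\mathcal N_+^*$ one has $\Psi_2'\neq0$, and the conformal structure of signature $(3,2)$ associated with $\mathscr D$ (the class of $\eta^1\eta^5-\eta^2\eta^4+\frac23\eta^3\eta^3$, for the components $\eta^i$ of a local section's pull-back of the regular normal Cartan connection of type $(G_2^*,P_1)$ determined by $\mathscr D=\operatorname{Ker}\{\eta^1,\eta^2,\eta^3\}$) is $[h]$ with $$h=\frac{1}{6\mu^2\Psi_2'}\left(\theta^1\theta^3+\theta^2\theta^4\right)+\frac{1}{54\mu^2(\Psi_2')^2}\left(\frac{d\mu}{\mu}+\Gamma^1{}_1+\Gamma^2{}_2\right)^2 .$$ -/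

import Mathlib

open scoped ContDiff Manifold Matrix

noncomputable section

/-! ## Distributions on open subsets of a normed space -/

/-- `X` is a smooth section, on some neighbourhood of `q`, of the field of subspaces `D`. -/
def IsLocalSection {F E : Type*} [NormedAddCommGroup F] [NormedSpace ℝ F]
    [NormedAddCommGroup E] [NormedSpace ℝ E]
    (D : F → Submodule ℝ E) (q : F) (X : F → E) : Prop :=
  ∃ O : Set F, IsOpen O ∧ q ∈ O ∧ ContDiffOn ℝ ∞ X O ∧ ∀ q' ∈ O, X q' ∈ D q'

/-- `D` is a smooth distribution of rank `k` on the set `W`. -/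
def IsSmoothDistribution {F : Type*} [NormedAddCommGroup F] [NormedSpace ℝ F]
    (k : ℕ) (D : F → Submodule ℝ F) (W : Set F) : Prop :=
  ∀ q ∈ W, Module.finrank ℝ (D q) = k ∧ ∀ v ∈ D q, ∃ X, IsLocalSection D q X ∧ X q = v

/-- The value at `q` of the derived system `∂D`, whose sections are `Γ(D) + [Γ(D), Γ(D)]`. -/
def derivedSystem {F : Type*} [NormedAddCommGroup F] [NormedSpace ℝ F]
    (D : F → Submodule ℝ F) (q : F) : Submodule ℝ F :=
  Submodule.span ℝ
    ({v | ∃ X, IsLocalSection D q X ∧ v = X q} ∪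
      {v | ∃ X Y, IsLocalSection D q X ∧ IsLocalSection D q Y ∧
        v = VectorField.lieBracket ℝ X Y q})

/-- `D` is a (2,3,5)-distribution on `W` (the ambient space is five-dimensional). -/
def Is235On {F : Type*} [NormedAddCommGroup F] [NormedSpace ℝ F]
    (D : F → Submodule ℝ F) (W : Set F) : Prop :=
  IsSmoothDistribution 2 D W ∧
    (∀ q ∈ W, Module.finrank ℝ (derivedSystem D q) = 3) ∧
    ∀ q ∈ W, Module.finrank ℝ (derivedSystem (derivedSystem D) q) = 5

/-! ## The conformal structure of a (2,3,5)-distribution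

A (2,3,5)-distribution `D` on `Q` determines a regular normal Cartan connection of type
`(G₂*, P₁)`.  Below, such a connection is described through its pull-backs `ω` by local sections
of the principal bundle. -/

/-- The exterior derivative of a 1-form. -/
def extDerivOne {F : Type*} [NormedAddCommGroup F] [NormedSpace ℝ F]
    (β : F → F →L[ℝ] ℝ) (q u v : F) : ℝ :=
  fderiv ℝ β q u v - fderiv ℝ β q v u

/-- The general element of the split real form of `g₂` inside `so(4,3)`; `p₁` is `η = 0`, and its
nilradical `p₊` is `η = 0`, `ζ 0 = ζ 1 = ζ 2 = ζ 3 = 0`. -/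
def g2Matrix (η : Fin 5 → ℝ) (ζ : Fin 9 → ℝ) : Matrix (Fin 7) (Fin 7) ℝ :=
  let r : ℝ := 1 / √3
  !![-ζ 0 - ζ 3, -ζ 7, -ζ 8, -r * ζ 6, ζ 4 / 3, ζ 5 / 3, 0;
     η 0, ζ 0, ζ 1, r * η 3, -η 2 / 3, 0, ζ 5 / 3;
     η 1, ζ 2, ζ 3, r * η 4, 0, -η 2 / 3, -ζ 4 / 3;
     2 * r * η 2, 2 * r * ζ 4, 2 * r * ζ 5, 0, r * η 4, -r * η 3, -r * ζ 6;
     η 3, ζ 6, 0, 2 * r * ζ 5, -ζ 3, ζ 1, ζ 8;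
     η 4, 0, ζ 6, -2 * r * ζ 4, ζ 2, -ζ 0, -ζ 7;
     0, η 4, -η 3, 2 * r * η 2, -η 1, η 0, ζ 0 + ζ 3]

/-- The `g₂`-valued 1-form with components `η`, `ζ`. -/
def cartanForm {F : Type*} [NormedAddCommGroup F] [NormedSpace ℝ F]
    (η : Fin 5 → F → F →L[ℝ] ℝ) (ζ : Fin 9 → F → F →L[ℝ] ℝ) (q u : F) :
    Matrix (Fin 7) (Fin 7) ℝ :=
  g2Matrix (fun i => η i q u) (fun i => ζ i q u)

/-- The curvature `dω + ω ∧ ω`. -/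
def cartanCurvature {F : Type*} [NormedAddCommGroup F] [NormedSpace ℝ F]
    (η : Fin 5 → F → F →L[ℝ] ℝ) (ζ : Fin 9 → F → F →L[ℝ] ℝ) (q u v : F) :
    Matrix (Fin 7) (Fin 7) ℝ :=
  g2Matrix (fun i => extDerivOne (η i) q u v) (fun i => extDerivOne (ζ i) q u v)
    + (cartanForm η ζ q u * cartanForm η ζ q v - cartanForm η ζ q v * cartanForm η ζ q u)

/-- The basis of `g₂ / p₁` (with representatives in `g₂`) dual to the components `η`. -/
def g2Minus (i : Fin 5) : Matrix (Fin 7) (Fin 7) ℝ := g2Matrix (Pi.single i 1) 0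

/-- The basis of `p₊` dual to `g2Minus` for the trace form:
`trace (g2Plus i * g2Minus j) = δ i j`. -/
def g2Plus : Fin 5 → Matrix (Fin 7) (Fin 7) ℝ :=
  ![g2Matrix 0 (Pi.single 7 (-1 / 2)), g2Matrix 0 (Pi.single 8 (-1 / 2)),
    g2Matrix 0 (Pi.single 6 (-1 / 2)), g2Matrix 0 (Pi.single 4 (1 / 2)),
    g2Matrix 0 (Pi.single 5 (1 / 2))]

/-- The Kostant codifferential of `κ ∈ Λ²(g₂/p₁)* ⊗ g₂ ≅ Λ²p₊ ⊗ g₂` (the boundary operator of the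
Lie algebra homology of `p₊` with coefficients in `g₂`), evaluated on `g2Minus k`;
here `κ i j` is the value on `g2Minus i`, `g2Minus j`. -/
def kostantCodifferential (κ : Fin 5 → Fin 5 → Matrix (Fin 7) (Fin 7) ℝ) (k : Fin 5) :
    Matrix (Fin 7) (Fin 7) ℝ :=
  ∑ j, (g2Plus j * κ k j - κ k j * g2Plus j)
    - (1 / 2 : ℝ) • ∑ i, ∑ j,
        ((g2Plus i * g2Plus j - g2Plus j * g2Plus i) * g2Minus k).trace • κ i j

/-- `ω = (η, ζ)` is, on `O`, a local expression of the regular normal Cartan connection of type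
`(G₂*, P₁)` of the distribution `D`: the `η i` form a coframe with `D = Ker {η 0, η 1, η 2}`, the
curvature takes values in `p₁` (no torsion; this contains the regularity), and the curvature
function is annihilated by the Kostant codifferential. -/
structure IsCartanGauge {F : Type*} [NormedAddCommGroup F] [NormedSpace ℝ F]
    (D : F → Submodule ℝ F) (O : Set F)
    (η : Fin 5 → F → F →L[ℝ] ℝ) (ζ : Fin 9 → F → F →L[ℝ] ℝ) : Prop where
  smooth_eta : ∀ i, ContDiffOn ℝ ∞ (η i) O
  smooth_zeta : ∀ i, ContDiffOn ℝ ∞ (ζ i) O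
  coframe : ∀ q ∈ O, LinearIndependent ℝ (fun i => η i q) ∧
    Submodule.span ℝ (Set.range fun i => η i q) = ⊤
  kernel : ∀ q ∈ O, ∀ v, v ∈ D q ↔ η 0 q v = 0 ∧ η 1 q v = 0 ∧ η 2 q v = 0
  torsion_free : ∀ q ∈ O, ∀ u v, ∀ i : Fin 7, i ≠ 0 → cartanCurvature η ζ q u v i 0 = 0
  normal : ∀ q ∈ O, ∀ b : Fin 5 → F, (∀ i j, η i q (b j) = if i = j then 1 else 0) →
    ∀ k, kostantCodifferential (fun i j => cartanCurvature η ζ q (b i) (b j)) k = 0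

/-- The symmetric product of two linear forms. -/
def symProd {F : Type*} [NormedAddCommGroup F] [NormedSpace ℝ F]
    (a b : F →L[ℝ] ℝ) (u v : F) : ℝ :=
  (a u * b v + b u * a v) / 2

/-- `η¹η⁵ - η²η⁴ + (2/3) η³η³`. -/
def nurowskiForm {F : Type*} [NormedAddCommGroup F] [NormedSpace ℝ F]
    (η : Fin 5 → F → F →L[ℝ] ℝ) (q u v : F) : ℝ :=
  symProd (η 0 q) (η 4 q) u v - symProd (η 1 q) (η 3 q) u v
    + 2 / 3 * symProd (η 2 q) (η 2 q) u v

/-- On `W`, the symmetric bilinear form `h` represents the conformal structure associated with the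
(2,3,5)-distribution `D`: around each point it is a positive multiple of
`η¹η⁵ - η²η⁴ + (2/3) η³η³` for a local expression of the Cartan connection of `D`. -/
def RepresentsConformalStructure {F : Type*} [NormedAddCommGroup F] [NormedSpace ℝ F]
    (D : F → Submodule ℝ F) (W : Set F) (h : F → F → F → ℝ) : Prop :=
  ∀ q ∈ W, ∃ O : Set F, IsOpen O ∧ q ∈ O ∧ O ⊆ W ∧
    ∃ (η : Fin 5 → F → F →L[ℝ] ℝ) (ζ : Fin 9 → F → F →L[ℝ] ℝ), IsCartanGauge D O η ζ ∧
      ∃ f : F → ℝ, ContDiffOn ℝ ∞ f O ∧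
        ∀ q' ∈ O, 0 < f q' ∧ ∀ u v, h q' u v = f q' * nurowskiForm η q' u v

/-- The symmetric bilinear form `b` on a five-dimensional space has signature (3,2). -/
def HasSignatureThreeTwo {F : Type*} [NormedAddCommGroup F] [NormedSpace ℝ F]
    (b : F → F → ℝ) : Prop :=
  ∃ e : Module.Basis (Fin 5) ℝ F, ∀ u v : F,
    b u v = e.repr u 0 * e.repr v 0 + e.repr u 1 * e.repr v 1 + e.repr u 2 * e.repr v 2
      - e.repr u 3 * e.repr v 3 - e.repr u 4 * e.repr v 4

/-! ## Local pseudo-Riemannian geometry in four dimensions -/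

/-- The model space of 4-manifolds. -/
abbrev E4 : Type := Fin 4 → ℝ

/-- `4 × 4` matrices, used for tensors in coordinates or in a frame. -/
abbrev Mat4 : Type := Matrix (Fin 4) (Fin 4) ℝ

/-- The partial derivative `∂ᵢ f`. -/
def partialD (i : Fin 4) (f : E4 → ℝ) (y : E4) : ℝ := fderiv ℝ f y (Pi.single i 1)

/-- The Christoffel symbol `Γᵏᵢⱼ` of the Levi-Civita connection of `g`. -/
def christoffel (g : E4 → Mat4) (y : E4) (k i j : Fin 4) : ℝ :=
  (1 / 2) * ∑ l, (g y)⁻¹ k l *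
    (partialD i (fun z => g z j l) y + partialD j (fun z => g z i l) y
      - partialD l (fun z => g z i j) y)

/-- The Riemann tensor `Rᵃ_{bcd}`, with `R(∂c, ∂d) ∂b = Rᵃ_{bcd} ∂a`. -/
def riemann (g : E4 → Mat4) (y : E4) (a b c d : Fin 4) : ℝ :=
  partialD c (fun z => christoffel g z a d b) y - partialD d (fun z => christoffel g z a c b) y
    + ∑ m, (christoffel g y a c m * christoffel g y m d b
      - christoffel g y a d m * christoffel g y m c b)

/-- The Ricci tensor `R_{ab} = Rᶜ_{acb}`. -/
def ricci (g : E4 → Mat4) (y : E4) (a b : Fin 4) : ℝ := ∑ c, riemann g y c a c b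

/-- The scalar curvature `g^{ab} R_{ab}`. -/
def scalarCurv (g : E4 → Mat4) (y : E4) : ℝ := ∑ a, ∑ b, (g y)⁻¹ a b * ricci g y a b

/-- The Schouten tensor in dimension four. -/
def schouten (g : E4 → Mat4) (y : E4) (a b : Fin 4) : ℝ :=
  (1 / 2) * ricci g y a b - (1 / 12) * scalarCurv g y * g y a b

/-- The Weyl tensor `C_{abcd}`, all indices down. -/
def weyl (g : E4 → Mat4) (y : E4) (a b c d : Fin 4) : ℝ :=
  (∑ e, g y a e * riemann g y e b c d)
    + g y a d * schouten g y c b - g y a c * schouten g y d b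
    + g y b c * schouten g y d a - g y b d * schouten g y c a

/-! ## Para-Kähler-Einstein structures -/

/-- The range of `K + ε`, for `K² = 1` and `ε = ±1` the `ε`-eigenspace of `K`. -/
def eigenPlane (ε : ℝ) (K : E4 → Mat4) (y : E4) : Submodule ℝ E4 :=
  LinearMap.range (Matrix.toLin' (K y + ε • (1 : Mat4)))

/-- The para-Kähler form `ρ(X, Y) = g(KX, Y)`, in coordinates. -/
def kahlerForm (g K : E4 → Mat4) (y : E4) : Mat4 := (K y)ᵀ * g y

/-- `(g, K)` is a para-Kähler structure on the open set `U`: `g` is a metric (its split signature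
is forced by the compatibility with `K`), `K` is a compatible para-complex structure with
eigenspaces of rank two, both eigendistributions are integrable, and the 2-form `ρ` is closed. -/
structure IsParaKahlerOn (U : Set E4) (g K : E4 → Mat4) : Prop where
  smooth_metric : ∀ i j, ContDiffOn ℝ ∞ (fun y => g y i j) U
  smooth_K : ∀ i j, ContDiffOn ℝ ∞ (fun y => K y i j) U
  symm : ∀ y ∈ U, (g y).IsSymm
  nondegenerate : ∀ y ∈ U, (g y).det ≠ 0
  paracomplex : ∀ y ∈ U, K y * K y = 1
  rank_plus : ∀ y ∈ U, Module.finrank ℝ (eigenPlane 1 K y) = 2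
  rank_minus : ∀ y ∈ U, Module.finrank ℝ (eigenPlane (-1) K y) = 2
  compatible : ∀ y ∈ U, (K y)ᵀ * g y * K y = -g y
  integrable_plus : ∀ y ∈ U, ∀ X Y : E4 → E4,
    IsLocalSection (eigenPlane 1 K) y X → IsLocalSection (eigenPlane 1 K) y Y →
      VectorField.lieBracket ℝ X Y y ∈ eigenPlane 1 K y
  integrable_minus : ∀ y ∈ U, ∀ X Y : E4 → E4,
    IsLocalSection (eigenPlane (-1) K) y X → IsLocalSection (eigenPlane (-1) K) y Y →
      VectorField.lieBracket ℝ X Y y ∈ eigenPlane (-1) K y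
  closed : ∀ y ∈ U, ∀ i j k,
    partialD i (fun z => kahlerForm g K z j k) y + partialD j (fun z => kahlerForm g K z k i) y
      + partialD k (fun z => kahlerForm g K z i j) y = 0

/-- The trace-free Ricci tensor of `g` vanishes on `U`. -/
def IsEinsteinOn (U : Set E4) (g : E4 → Mat4) : Prop :=
  ∀ y ∈ U, ∀ i j, ricci g y i j - scalarCurv g y / 4 * g y i j = 0

/-- The matrix of `2 θ¹θ³ + 2 θ²θ⁴`. -/
def nullForm : Mat4 := !![0, 0, 1, 0; 0, 0, 0, 1; 1, 0, 0, 0; 0, 1, 0, 0]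

/-- `θ` is a coframe on `V` adapted to `(g, K)`; the rows of `θ y` are the 1-forms
`(θ¹, θ², θ³, θ⁴) = (α¹, α², ᾱ¹, ᾱ²)`. -/
structure IsAdaptedCoframe (V : Set E4) (g K θ : E4 → Mat4) : Prop where
  smooth : ∀ i j, ContDiffOn ℝ ∞ (fun y => θ y i j) V
  coframe : ∀ y ∈ V, (θ y).det ≠ 0
  metric : ∀ y ∈ V, g y = (θ y)ᵀ * nullForm * θ y
  paracomplex : ∀ y ∈ V, θ y * K y = Matrix.diagonal ![1, 1, -1, -1] * θ y

/-- The `a`-th member of the coframe, as a 1-form. -/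
def coframeForm (θ : E4 → Mat4) (a : Fin 4) (y : E4) : E4 →L[ℝ] ℝ :=
  ∑ i, θ y a i • ContinuousLinearMap.proj i

/-- The Levi-Civita connection form `Γᵃ_b` in the coframe `θ`, that is `θᵃ(∇ e_b)` for the dual
frame `e` (the columns of `θ⁻¹`). -/
def connectionForm (g θ : E4 → Mat4) (a b : Fin 4) (y : E4) : E4 →L[ℝ] ℝ :=
  ∑ i, (∑ k, θ y a k * (partialD i (fun z => (θ z)⁻¹ k b) y
    + ∑ j, christoffel g y k i j * (θ y)⁻¹ j b)) • ContinuousLinearMap.proj i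

/-- The component `Ψ₂' = C₁₂₃₄` of the self-dual Weyl tensor in the coframe `θ`. -/
def psiTwo (g θ : E4 → Mat4) (y : E4) : ℝ :=
  ∑ a, ∑ b, ∑ c, ∑ d, weyl g y a b c d *
    (θ y)⁻¹ a 0 * (θ y)⁻¹ b 1 * (θ y)⁻¹ c 2 * (θ y)⁻¹ d 3

/-! ## Structures on 4-manifolds -/

section Manifold

/-- A field of bilinear forms on the tangent spaces. -/
abbrev BilinField (M : Type*) [TopologicalSpace M] [ChartedSpace E4 M] : Type _ :=
  ∀ p : M, TangentSpace 𝓘(ℝ, E4) p →L[ℝ] TangentSpace 𝓘(ℝ, E4) p →L[ℝ] ℝ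

/-- A field of endomorphisms of the tangent spaces. -/
abbrev EndoField (M : Type*) [TopologicalSpace M] [ChartedSpace E4 M] : Type _ :=
  ∀ p : M, TangentSpace 𝓘(ℝ, E4) p →L[ℝ] TangentSpace 𝓘(ℝ, E4) p

variable {M : Type*} [TopologicalSpace M] [ChartedSpace E4 M]

/-- The differential at `y` of the inverse of the chart `φ`. -/
def chartInvD (φ : OpenPartialHomeomorph M E4) (y : E4) :
    E4 →L[ℝ] TangentSpace 𝓘(ℝ, E4) (φ.symm y) :=
  mfderiv 𝓘(ℝ, E4) 𝓘(ℝ, E4) φ.symm y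

/-- The matrix of `g` in the chart `φ`. -/
def coordMetric (g : BilinField M) (φ : OpenPartialHomeomorph M E4) (y : E4) : Mat4 :=
  Matrix.of fun i j =>
    g (φ.symm y) (chartInvD φ y (Pi.single i 1)) (chartInvD φ y (Pi.single j 1))

/-- The matrix of `K` in the chart `φ`. -/
def coordEndo (K : EndoField M) (φ : OpenPartialHomeomorph M E4) (y : E4) : Mat4 :=
  Matrix.of fun i j =>
    (show E4 from mfderiv 𝓘(ℝ, E4) 𝓘(ℝ, E4) φ (φ.symm y)
      (K (φ.symm y) (chartInvD φ y (Pi.single j 1)))) i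

/-- `(g, K)` is a para-Kähler-Einstein (pKE) structure on `M`. -/
def IsPKE (g : BilinField M) (K : EndoField M) : Prop :=
  ∀ φ ∈ IsManifold.maximalAtlas 𝓘(ℝ, E4) ∞ M,
    IsParaKahlerOn φ.target (coordMetric g φ) (coordEndo K φ) ∧
      IsEinsteinOn φ.target (coordMetric g φ)

/-- The scalar curvature of `g` vanishes at no point. -/
def HasNonzeroScalarCurvature (g : BilinField M) : Prop :=
  ∀ φ ∈ IsManifold.maximalAtlas 𝓘(ℝ, E4) ∞ M, ∀ y ∈ φ.target, scalarCurv (coordMetric g φ) y ≠ 0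

/-- The volume form `α¹ ∧ α² ∧ ᾱ¹ ∧ ᾱ² = - ρ ∧ ρ / 2` at `p`. -/
def volumeForm (g : BilinField M) (K : EndoField M) (p : M)
    (X Y Z W : TangentSpace 𝓘(ℝ, E4) p) : ℝ :=
  -(g p (K p X) Y * g p (K p Z) W - g p (K p X) Z * g p (K p Y) W
    + g p (K p X) W * g p (K p Y) Z)

/-- `N` is a self-dual null plane at `p`: `g` vanishes on `N`, and `X♭ ∧ Y♭`, for `X, Y ∈ N`, is
fixed by the Hodge star `*ω(Z, W) vol = ω ∧ Z♭ ∧ W♭` (one has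
`X♭ ∧ Y♭ ∧ Z♭ ∧ W♭ = vol(X, Y, Z, W) vol`). -/
def IsSelfDualNullPlane (g : BilinField M) (K : EndoField M) (p : M)
    (N : Submodule ℝ (TangentSpace 𝓘(ℝ, E4) p)) : Prop :=
  Module.finrank ℝ N = 2 ∧ (∀ X ∈ N, g p X X = 0) ∧
    ∀ X ∈ N, ∀ Y ∈ N, ∀ Z W,
      g p X Z * g p Y W - g p X W * g p Y Z = volumeForm g K p X Y Z W

/-- A point of `M` with a linear subspace of its tangent space. -/
abbrev TangentSubspace (M : Type*) [TopologicalSpace M] [ChartedSpace E4 M] : Type _ :=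
  Σ p : M, Submodule ℝ (TangentSpace 𝓘(ℝ, E4) p)

/-- The circle bundle `𝒪₊` of self-dual null planes. -/
def selfDualBundle (g : BilinField M) (K : EndoField M) : Set (TangentSubspace M) :=
  {z | IsSelfDualNullPlane g K z.1 z.2}

/-- `ℋ`, the `+1`-eigenspace of `K`. -/
def planeH (K : EndoField M) (p : M) : Submodule ℝ (TangentSpace 𝓘(ℝ, E4) p) :=
  LinearMap.ker (K p - ContinuousLinearMap.id ℝ _ :
    TangentSpace 𝓘(ℝ, E4) p →L[ℝ] TangentSpace 𝓘(ℝ, E4) p).toLinearMap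

/-- `ℋ̄`, the `-1`-eigenspace of `K`. -/
def planeHbar (K : EndoField M) (p : M) : Submodule ℝ (TangentSpace 𝓘(ℝ, E4) p) :=
  LinearMap.ker (K p + ContinuousLinearMap.id ℝ _ :
    TangentSpace 𝓘(ℝ, E4) p →L[ℝ] TangentSpace 𝓘(ℝ, E4) p).toLinearMap

/-- The plane `Ker {s θ¹ + t θ⁴, s θ² - t θ³}`, with `[s : t]` in the projective line. -/
def pencilPlane (θ : E4 → Mat4) (y : E4) (s t : ℝ) : Submodule ℝ E4 :=
  LinearMap.ker (s • coframeForm θ 0 y + t • coframeForm θ 3 y).toLinearMap ⊓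
    LinearMap.ker (s • coframeForm θ 1 y - t • coframeForm θ 2 y).toLinearMap

/-- The horizontal lift, for the connection with Christoffel symbols `Γ`, of a family of planes
`N y r`, at `q = (y, r)`: it consists of the vectors `(v, m)` such that `v` lies in the plane
`N q` and `N` is parallel in the direction `(v, m)`. -/
def horizontalLift (Γ : E4 → Fin 4 → Fin 4 → Fin 4 → ℝ) (N : E4 × ℝ → Submodule ℝ E4)
    (q : E4 × ℝ) : Submodule ℝ (E4 × ℝ) where
  carrier := {w | w.1 ∈ N q ∧ ∀ X : E4 × ℝ → E4, IsLocalSection N q X →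
    (fderiv ℝ X q w + fun k => ∑ i, ∑ j, Γ q.1 k i j * w.1 i * X q j) ∈ N q}
  zero_mem' := by
    refine ⟨by simp, fun X _ => ?_⟩
    have h : (fderiv ℝ X q 0 + fun k => ∑ i, ∑ j, Γ q.1 k i j * (0 : E4 × ℝ).1 i * X q j) = 0 := by
      ext k; simp
    rw [h]; exact (N q).zero_mem
  add_mem' := by
    rintro a b ⟨ha, ha'⟩ ⟨hb, hb'⟩
    refine ⟨(N q).add_mem ha hb, fun X hX => ?_⟩
    have h : (fderiv ℝ X q (a + b) + fun k => ∑ i, ∑ j, Γ q.1 k i j * (a + b).1 i * X q j) =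
        (fderiv ℝ X q a + fun k => ∑ i, ∑ j, Γ q.1 k i j * a.1 i * X q j) +
        (fderiv ℝ X q b + fun k => ∑ i, ∑ j, Γ q.1 k i j * b.1 i * X q j) := by
      ext k
      simp only [map_add, Pi.add_apply, Prod.fst_add, mul_add, add_mul, Finset.sum_add_distrib]
      ring
    rw [h]; exact (N q).add_mem (ha' X hX) (hb' X hX)
  smul_mem' := by
    rintro c a ⟨ha, ha'⟩
    refine ⟨(N q).smul_mem c ha, fun X hX => ?_⟩
    have h : (fderiv ℝ X q (c • a) + fun k => ∑ i, ∑ j, Γ q.1 k i j * (c • a).1 i * X q j) =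
        c • (fderiv ℝ X q a + fun k => ∑ i, ∑ j, Γ q.1 k i j * a.1 i * X q j) := by
      ext k
      simp only [map_smul, Pi.add_apply, Pi.smul_apply, Prod.smul_fst, smul_eq_mul, mul_add,
        Finset.mul_sum]
      congr 1
      refine Finset.sum_congr rfl fun i _ => Finset.sum_congr rfl fun j _ => ?_
      ring
    rw [h]; exact (N q).smul_mem c (ha' X hX)

/-- The data of a chart of `𝒪₊`: a chart `φ` of `M`, an adapted coframe on an open subset `V` of
its target, and the choice of an affine coordinate on the circle of self-dual null planes,
`μ` (if `atInfinity` is false) or `1 / μ` (if `atInfinity` is true). -/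
structure TwistorChart (g : BilinField M) (K : EndoField M) where
  /-- the chart of `M` -/
  φ : OpenPartialHomeomorph M E4
  mem_atlas : φ ∈ IsManifold.maximalAtlas 𝓘(ℝ, E4) ∞ M
  /-- the open subset of `φ.target` on which the coframe is given -/
  V : Set E4
  isOpen_V : IsOpen V
  V_subset : V ⊆ φ.target
  /-- the coframe -/
  θ : E4 → Mat4
  adapted : IsAdaptedCoframe V (coordMetric g φ) (coordEndo K φ) θ
  /-- the choice of the affine coordinate -/
  atInfinity : Bool

namespace TwistorChart

variable {g : BilinField M} {K : EndoField M}

/-- The domain `V × ℝ` of the chart. -/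
def domain (c : TwistorChart g K) : Set (E4 × ℝ) := c.V ×ˢ Set.univ

/-- The part of the domain where the fibre coordinate does not vanish. -/
def punctured (c : TwistorChart g K) : Set (E4 × ℝ) := {q ∈ c.domain | q.2 ≠ 0}

/-- The plane `Ker {θ¹ + μ θ⁴, θ² - μ θ³}`, where `μ = r` or `μ = 1 / r`. -/
def plane (c : TwistorChart g K) (q : E4 × ℝ) : Submodule ℝ E4 :=
  if c.atInfinity then pencilPlane c.θ q.1 q.2 1 else pencilPlane c.θ q.1 1 q.2

/-- The point of `𝒪₊` with coordinates `q`. -/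
def point (c : TwistorChart g K) (q : E4 × ℝ) : TangentSubspace M :=
  ⟨c.φ.symm q.1, (c.plane q).map (chartInvD c.φ q.1).toLinearMap⟩

/-- The twistor distribution `𝒟` in the chart: at the point `(p, N)` of `𝒪₊` it is the
horizontal lift of the plane `N ⊂ T_p M` for the Levi-Civita connection. -/
def twistorDistribution (c : TwistorChart g K) : E4 × ℝ → Submodule ℝ (E4 × ℝ) :=
  horizontalLift (christoffel (coordMetric g c.φ)) c.plane

/-- The pull-back of the 1-form `θᵃ` to `V × ℝ`. -/
def thetaForm (c : TwistorChart g K) (a : Fin 4) (q : E4 × ℝ) : E4 × ℝ →L[ℝ] ℝ :=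
  (coframeForm c.θ a q.1).comp (ContinuousLinearMap.fst ℝ E4 ℝ)

/-- The pull-back of the 1-form `Γ¹₁ + Γ²₂` to `V × ℝ`. -/
def traceForm (c : TwistorChart g K) (q : E4 × ℝ) : E4 × ℝ →L[ℝ] ℝ :=
  (connectionForm (coordMetric g c.φ) c.θ 0 0 q.1
    + connectionForm (coordMetric g c.φ) c.θ 1 1 q.1).comp (ContinuousLinearMap.fst ℝ E4 ℝ)

/-- The 1-form `dμ`, where `μ` is the fibre coordinate. -/
def dFibre : E4 × ℝ →L[ℝ] ℝ := ContinuousLinearMap.snd ℝ E4 ℝ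

/-- The function `Ψ₂'`. -/
def psi (c : TwistorChart g K) (q : E4 × ℝ) : ℝ := psiTwo (coordMetric g c.φ) c.θ q.1

/-- `h = (θ¹θ³ + θ²θ⁴) / (6 μ² Ψ₂') + (dμ / μ + Γ¹₁ + Γ²₂)² / (54 μ² Ψ₂'²)`, where `μ = q.2`. -/
def metricH (c : TwistorChart g K) (q u v : E4 × ℝ) : ℝ :=
  1 / (6 * q.2 ^ 2 * c.psi q) *
      (symProd (c.thetaForm 0 q) (c.thetaForm 2 q) u v
        + symProd (c.thetaForm 1 q) (c.thetaForm 3 q) u v)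
    + 1 / (54 * q.2 ^ 2 * c.psi q ^ 2) *
      symProd ((1 / q.2) • dFibre + c.traceForm q) ((1 / q.2) • dFibre + c.traceForm q) u v

end TwistorChart

end Manifold

end

/-!
Throughout, indices start at `0`, so that `θ 0, …, θ 3` stand for `θ¹, …, θ⁴`.

*The base.*  In an adapted coframe the connection matrix of a para-Kähler metric is skew, and
closedness of `ρ` together with integrability of the two eigenplane fields makes it block diagonal,
`diag (A, -Aᵀ)` (`IsAdaptedCoframe.conn_eq`).  For an Einstein metric the first Bianchi identity
leaves in the curvature of `A` only the five components `w` of the anti-self-dual Weyl tensor and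
`Ψ₂'` (`IsAdaptedCoframe.exists_curvMat_eq`), and `Ψ₂' = -s / 12` (`IsAdaptedCoframe.psiTwo_eq`).
In particular `d (tr A)` is a multiple of `s ρ`; since `ρ` is closed and non-degenerate, `s` is
locally constant (`IsAdaptedCoframe.fderiv_scalarCurv`).  The resulting structure equations are the
content of `IsParaKahlerEinsteinFrame`.

*The bundle.*  Self-duality is a system of linear equations for the Plücker coordinates of a plane;
it cuts the Plücker quadric in a conic, and this gives the pencil
`Ker {s θ¹ + t θ⁴, s θ² - t θ³}` (`exists_pencil_of_selfDual`,
`TwistorChart.isSelfDualNullPlane_iff`).  The connection acts on the pencil through `tr A` alone,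
whence the formula for `𝒟` (`IsAdaptedCoframe.mem_horizontalLift`,
`TwistorChart.mem_twistorDistribution`).  Two adapted coframes differ by a matrix `diag (B, B⁻ᵀ)`;
with `δ = det B` this changes `μ` to `δ μ` and `tr A` by `-dδ / δ`
(`IsAdaptedCoframe.transMat_block`, `IsAdaptedCoframe.traceConn_trans`), so that the charts and `𝒟`
fit together (`TwistorChart.exists_change`).  Along `μ = 0` and `μ = ∞` the exterior derivatives of
the three forms which define `𝒟` vanish on `𝒟` (`TwistorChart.derivedSystem_eq`).

*The (2,3,5)-distribution.*  Where `μ ≠ 0`, the change of gauge by `diag (μ⁻¹, 1, μ, 1)` preserves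
the structure equations and turns `𝒟` into `Ker {θ¹ + θ⁴, θ² - θ³, tr A}`
(`IsParaKahlerEinsteinFrame.rescale`, `TwistorChart.exists_frame`).  A para-Kähler–Einstein metric
with `s ≠ 0` carries a torsion-free Cartan connection modelled on the para-complex projective plane
`SL₃ / GL₂`.  An embedding of `sl₃` in `g₂` sends it to a `g₂`-valued form, `gaugeEta` and
`gaugeZeta`, whose first three components define `𝒟` and whose curvature is the anti-self-dual Weyl
tensor, with values in `sl₂ ⊂ p₁` (`IsParaKahlerEinsteinFrame.cartanCurvature_gauge`).  It is
torsion-free, and normal because that tensor is trace-free (`kostantCodifferential_eq_zero`), so it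
is the regular normal Cartan connection of `𝒟`.  Its structure equations contain those of a
(2,3,5)-distribution (`is235On_of_structure_equations`), and its bilinear form of signature (3,2) is
`16 μ² h` (`IsParaKahlerEinsteinFrame.nurowskiForm_gauge`,
`TwistorChart.representsConformalStructure`).
-/


/-! ### Distributions, derived systems and coframes -/

section Distributions

variable {F : Type*} [NormedAddCommGroup F] [NormedSpace ℝ F]

theorem IsLocalSection.contDiffAt {D : F → Submodule ℝ F} {q : F} {X : F → F}
    (h : IsLocalSection D q X) : ContDiffAt ℝ ∞ X q := by
  obtain ⟨O, hO, hq, hX, -⟩ := h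
  exact hX.contDiffAt (hO.mem_nhds hq)

theorem IsLocalSection.eventually_mem {E : Type*} [NormedAddCommGroup E] [NormedSpace ℝ E]
    {D : F → Submodule ℝ E} {q : F} {X : F → E}
    (h : IsLocalSection D q X) : ∀ᶠ p in nhds q, X p ∈ D p := by
  obtain ⟨O, hO, hq, -, hX⟩ := h
  filter_upwards [hO.mem_nhds hq] with p hp using hX p hp

theorem IsLocalSection.congr {D E : F → Submodule ℝ F} {W : Set F} (hW : IsOpen W)
    (h : ∀ p ∈ W, D p = E p) {q : F} (hq : q ∈ W) {X : F → F}
    (hX : IsLocalSection D q X) : IsLocalSection E q X := by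
  obtain ⟨O, hO, hqO, hs, hm⟩ := hX
  exact ⟨O ∩ W, hO.inter hW, ⟨hqO, hq⟩, hs.mono Set.inter_subset_left,
    fun p hp => h p hp.2 ▸ hm p hp.1⟩

theorem derivedSystem_congr {D E : F → Submodule ℝ F} {W : Set F} (hW : IsOpen W)
    (h : ∀ p ∈ W, D p = E p) {q : F} (hq : q ∈ W) : derivedSystem D q = derivedSystem E q := by
  have key : ∀ X, IsLocalSection D q X ↔ IsLocalSection E q X := fun X =>
    ⟨fun hX => hX.congr hW h hq, fun hX => hX.congr hW (fun p hp => (h p hp).symm) hq⟩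
  simp only [derivedSystem, key]

theorem le_derivedSystem {D : F → Submodule ℝ F} {W : Set F} {k : ℕ}
    (h : IsSmoothDistribution k D W) {q : F} (hq : q ∈ W) : D q ≤ derivedSystem D q := by
  intro v hv
  obtain ⟨X, hX, rfl⟩ := (h q hq).2 v hv
  exact Submodule.subset_span (Or.inl ⟨X, hX, rfl⟩)

/-- A field of subspaces spanned by a smooth frame is a smooth distribution. -/
theorem isSmoothDistribution_of_frame {k : ℕ} {D : F → Submodule ℝ F} {W : Set F}
    (hW : IsOpen W) (X : Fin k → F → F) (hX : ∀ i, ContDiffOn ℝ ∞ (X i) W)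
    (hli : ∀ q ∈ W, LinearIndependent ℝ fun i => X i q)
    (hD : ∀ q ∈ W, D q = Submodule.span ℝ (Set.range fun i => X i q)) :
    IsSmoothDistribution k D W := by
  intro q hq
  refine ⟨by rw [hD q hq, finrank_span_eq_card (hli q hq), Fintype.card_fin], fun v hv => ?_⟩
  rw [hD q hq, Submodule.mem_span_range_iff_exists_fun] at hv
  obtain ⟨c, rfl⟩ := hv
  refine ⟨fun p => ∑ i, c i • X i p, ⟨W, hW, hq, ?_, fun p hp => ?_⟩, rfl⟩
  · exact ContDiffOn.sum fun i _ => contDiffOn_const.smul (hX i)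
  · rw [hD p hp, Submodule.mem_span_range_iff_exists_fun]
    exact ⟨c, rfl⟩

/-- Cartan's formula `β([X, Y]) = -dβ(X, Y)` for vector fields annihilated by `β`. -/
theorem apply_lieBracket_eq_neg_extDerivOne {β : F → F →L[ℝ] ℝ} {X Y : F → F} {q : F}
    (hβ : DifferentiableAt ℝ β q) (hX : DifferentiableAt ℝ X q) (hY : DifferentiableAt ℝ Y q)
    (h0X : ∀ᶠ p in nhds q, β p (X p) = 0) (h0Y : ∀ᶠ p in nhds q, β p (Y p) = 0) :
    β q (VectorField.lieBracket ℝ X Y q) = -extDerivOne β q (X q) (Y q) := by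
  have key : ∀ {Z : F → F}, DifferentiableAt ℝ Z q → (∀ᶠ p in nhds q, β p (Z p) = 0) →
      ∀ v, β q (fderiv ℝ Z q v) = -fderiv ℝ β q v (Z q) := by
    intro Z hZ h0 v
    have h1 : fderiv ℝ (fun p => β p (Z p)) q = 0 := by
      rw [Filter.EventuallyEq.fderiv_eq (f := fun _ => (0 : ℝ)) h0]
      simp
    rw [fderiv_clm_apply hβ hZ] at h1
    have := DFunLike.congr_fun h1 v
    simp at this
    linarith
  simp only [VectorField.lieBracket, map_sub, extDerivOne, key hX h0X, key hY h0Y]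
  ring

/-- If `D` is annihilated by `β`, and `dβ` vanishes on `D` at `q`, then so is `∂D` at `q`. -/
theorem derivedSystem_le_ker {D : F → Submodule ℝ F} {q : F} {β : F → F →L[ℝ] ℝ}
    (hβ : DifferentiableAt ℝ β q) (h0 : ∀ᶠ p in nhds q, ∀ v ∈ D p, β p v = 0)
    (hd : ∀ u ∈ D q, ∀ v ∈ D q, extDerivOne β q u v = 0) :
    ∀ v ∈ derivedSystem D q, β q v = 0 := by
  intro v hv
  have : derivedSystem D q ≤ LinearMap.ker (β q).toLinearMap := by
    refine Submodule.span_le.2 ?_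
    rintro w (⟨X, hX, rfl⟩ | ⟨X, Y, hX, hY, rfl⟩)
    · exact h0.self_of_nhds _ hX.eventually_mem.self_of_nhds
    · have hX' := hX.contDiffAt.differentiableAt (by simp)
      have hY' := hY.contDiffAt.differentiableAt (by simp)
      simp only [SetLike.mem_coe, LinearMap.mem_ker, ContinuousLinearMap.coe_coe]
      rw [apply_lieBracket_eq_neg_extDerivOne hβ hX' hY'
        (by filter_upwards [h0, hX.eventually_mem] with p h hp using h _ hp)
        (by filter_upwards [h0, hY.eventually_mem] with p h hp using h _ hp),
        hd _ hX.eventually_mem.self_of_nhds _ hY.eventually_mem.self_of_nhds, neg_zero]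
  exact this hv

/-- A smooth coframe has a smooth dual frame. -/
theorem exists_dual_frame [FiniteDimensional ℝ F] {n : ℕ} (hn : Module.finrank ℝ F = n)
    {O : Set F} {η : Fin n → F → F →L[ℝ] ℝ}
    (hs : ∀ i, ContDiffOn ℝ ∞ (η i) O)
    (hinj : ∀ q ∈ O, ∀ v, (∀ i, η i q v = 0) → v = 0) :
    ∃ X : Fin n → F → F, (∀ i, ContDiffOn ℝ ∞ (X i) O) ∧
      (∀ q ∈ O, ∀ i j, η i q (X j q) = if i = j then 1 else 0) ∧
      ∀ q ∈ O, ∀ v, v = ∑ i, η i q v • X i q := by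
  have : CompleteSpace F := FiniteDimensional.complete ℝ F
  let Φ : F → F →L[ℝ] (Fin n → ℝ) := fun q => ContinuousLinearMap.pi fun i => η i q
  have hΦs : ContDiffOn ℝ ∞ Φ O := by
    have : Φ = fun q => ∑ i, (ContinuousLinearMap.single ℝ (fun _ : Fin n => ℝ) i).comp (η i q) := by
      funext q
      ext v j
      simp [Φ, Pi.single_apply]
    rw [this]
    exact ContDiffOn.sum fun i _ => contDiffOn_const.clm_comp (hs i)
  have hequiv : ∀ q ∈ O, ∃ e : F ≃L[ℝ] (Fin n → ℝ), (e : F →L[ℝ] (Fin n → ℝ)) = Φ q := by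
    intro q hq
    have hi : Function.Injective (Φ q).toLinearMap := by
      rw [← LinearMap.ker_eq_bot, LinearMap.ker_eq_bot']
      intro v hv
      exact hinj q hq v fun i => congrFun hv i
    refine ⟨(LinearEquiv.ofInjectiveOfFinrankEq (Φ q).toLinearMap hi
      (by simp [hn])).toContinuousLinearEquiv, ?_⟩
    ext v
    rfl
  refine ⟨fun j q => (Φ q).inverse (Pi.single j 1), fun j => ?_, fun q hq i j => ?_,
    fun q hq v => ?_⟩
  · intro q hq
    obtain ⟨e, he⟩ := hequiv q hq
    have h1 : ContDiffAt ℝ ∞ (ContinuousLinearMap.inverse : (F →L[ℝ] (Fin n → ℝ)) → _) (Φ q) := by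
      rw [← he]; exact contDiffAt_map_inverse e
    exact ((h1.comp_contDiffWithinAt q (hΦs q hq)).clm_apply contDiffWithinAt_const)
  · obtain ⟨e, he⟩ := hequiv q hq
    have h2 : Φ q ((Φ q).inverse (Pi.single j 1)) = Pi.single j 1 := by
      rw [← he, ContinuousLinearMap.inverse_equiv]; simp
    have := congrFun h2 i
    simpa [Φ, Pi.single_apply] using this
  · obtain ⟨e, he⟩ := hequiv q hq
    have h3 : (Φ q).inverse (Φ q v) = v := by
      rw [← he, ContinuousLinearMap.inverse_equiv]; simp
    conv_lhs => rw [← h3, pi_eq_sum_univ' (Φ q v)]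
    simp only [map_sum, map_smul]
    refine Finset.sum_congr rfl fun i _ => ?_
    congr 2

/-- A plane field with a coframe satisfying the structure equations
`dη⁰ ≡ η² ∧ η³`, `dη¹ ≡ η² ∧ η⁴` modulo `η⁰, η¹` and `dη² ≡ η³ ∧ η⁴` modulo `η⁰, η¹, η²` is a
(2,3,5)-distribution. -/
theorem is235On_of_structure_equations [FiniteDimensional ℝ F] (hn : Module.finrank ℝ F = 5)
    {D : F → Submodule ℝ F} {O : Set F} (hO : IsOpen O) {η : Fin 5 → F → F →L[ℝ] ℝ}
    (hs : ∀ i, ContDiffOn ℝ ∞ (η i) O)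
    (hinj : ∀ q ∈ O, ∀ v, (∀ i, η i q v = 0) → v = 0)
    (hker : ∀ q ∈ O, ∀ v, v ∈ D q ↔ η 0 q v = 0 ∧ η 1 q v = 0 ∧ η 2 q v = 0)
    (h0 : ∀ q ∈ O, ∀ u v, η 0 q u = 0 → η 1 q u = 0 → η 0 q v = 0 → η 1 q v = 0 →
      extDerivOne (η 0) q u v = η 2 q u * η 3 q v - η 2 q v * η 3 q u)
    (h1 : ∀ q ∈ O, ∀ u v, η 0 q u = 0 → η 1 q u = 0 → η 0 q v = 0 → η 1 q v = 0 →
      extDerivOne (η 1) q u v = η 2 q u * η 4 q v - η 2 q v * η 4 q u)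
    (h2 : ∀ q ∈ O, ∀ u v, u ∈ D q → v ∈ D q →
      extDerivOne (η 2) q u v = η 3 q u * η 4 q v - η 3 q v * η 4 q u) :
    Is235On D O := by
  obtain ⟨X, hXs, hdual, hexp⟩ := exists_dual_frame hn hs hinj
  have hdiff : ∀ q ∈ O, ∀ i, DifferentiableAt ℝ (η i) q := fun q hq i =>
    ((hs i).contDiffAt (hO.mem_nhds hq)).differentiableAt (by simp)
  have hXdiff : ∀ q ∈ O, ∀ i, DifferentiableAt ℝ (X i) q := fun q hq i =>
    ((hXs i).contDiffAt (hO.mem_nhds hq)).differentiableAt (by simp)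
  have hbr : ∀ q ∈ O, ∀ k i j, k ≠ i → k ≠ j →
      η k q (VectorField.lieBracket ℝ (X i) (X j) q) = -extDerivOne (η k) q (X i q) (X j q) := by
    intro q hq k i j hki hkj
    refine apply_lieBracket_eq_neg_extDerivOne (hdiff q hq k) (hXdiff q hq i) (hXdiff q hq j) ?_ ?_
    · filter_upwards [hO.mem_nhds hq] with p hp
      rw [hdual p hp, if_neg hki]
    · filter_upwards [hO.mem_nhds hq] with p hp
      rw [hdual p hp, if_neg hkj]
  have hli : ∀ q ∈ O, LinearIndependent ℝ fun i => X i q := by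
    intro q hq
    rw [Fintype.linearIndependent_iff]
    intro c hc i
    have := congrArg (η i q) hc
    simpa [hdual q hq] using this
  have hD2 : IsSmoothDistribution 2 D O := by
    refine isSmoothDistribution_of_frame hO ![X 3, X 4] ?_ ?_ ?_
    · intro i; fin_cases i
      exacts [hXs 3, hXs 4]
    · intro q hq
      have := (hli q hq).comp ![3, 4] (by decide)
      convert this using 1
      ext i; fin_cases i <;> rfl
    · intro q hq
      ext v
      rw [hker q hq, Submodule.mem_span_range_iff_exists_fun]
      simp only [Fin.sum_univ_two, Matrix.cons_val_zero, Matrix.cons_val_one]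
      constructor
      · rintro ⟨ha, hb, hc⟩
        refine ⟨![η 3 q v, η 4 q v], ?_⟩
        conv_rhs => rw [hexp q hq v]
        simp [Fin.sum_univ_five, ha, hb, hc]
      · rintro ⟨c, rfl⟩
        simp [hdual q hq]
  set E : F → Submodule ℝ F := fun q =>
    LinearMap.ker (η 0 q).toLinearMap ⊓ LinearMap.ker (η 1 q).toLinearMap with hE
  have hEmem : ∀ q v, v ∈ E q ↔ η 0 q v = 0 ∧ η 1 q v = 0 := by
    intro q v; simp [hE]
  have hE3 : IsSmoothDistribution 3 E O := by
    refine isSmoothDistribution_of_frame hO ![X 2, X 3, X 4] ?_ ?_ ?_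
    · intro i; fin_cases i
      exacts [hXs 2, hXs 3, hXs 4]
    · intro q hq
      have := (hli q hq).comp ![2, 3, 4] (by decide)
      convert this using 1
      ext i; fin_cases i <;> rfl
    · intro q hq
      ext v
      rw [hEmem, Submodule.mem_span_range_iff_exists_fun]
      simp only [Fin.sum_univ_three]
      constructor
      · rintro ⟨ha, hb⟩
        refine ⟨![η 2 q v, η 3 q v, η 4 q v], ?_⟩
        conv_rhs => rw [hexp q hq v]
        simp [Fin.sum_univ_five, ha, hb]
      · rintro ⟨c, rfl⟩
        simp [hdual q hq]
  -- the frame fields are local sections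
  have hsecD : ∀ q ∈ O, ∀ i, 3 ≤ i → IsLocalSection D q (X i) := by
    intro q hq i hi
    refine ⟨O, hO, hq, hXs i, fun p hp => (hker p hp _).2 ?_⟩
    simp only [hdual p hp]
    refine ⟨if_neg ?_, if_neg ?_, if_neg ?_⟩ <;> rintro rfl <;> revert hi <;> decide
  have hsecE : ∀ q ∈ O, ∀ i, 2 ≤ i → IsLocalSection E q (X i) := by
    intro q hq i hi
    refine ⟨O, hO, hq, hXs i, fun p hp => (hEmem p _).2 ?_⟩
    simp only [hdual p hp]
    refine ⟨if_neg ?_, if_neg ?_⟩ <;> rintro rfl <;> revert hi <;> decide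
  have hDE : ∀ q ∈ O, derivedSystem D q = E q := by
    intro q hq
    apply le_antisymm
    · intro v hv
      have hu : ∀ u ∈ D q, η 0 q u = 0 ∧ η 1 q u = 0 ∧ η 2 q u = 0 := fun u h => (hker q hq u).1 h
      rw [hEmem]
      constructor
      · refine derivedSystem_le_ker (hdiff q hq 0) ?_ ?_ v hv
        · filter_upwards [hO.mem_nhds hq] with p hp v hv using ((hker p hp v).1 hv).1
        · intro u h u' h'
          rw [h0 q hq u u' (hu u h).1 (hu u h).2.1 (hu u' h').1 (hu u' h').2.1, (hu u h).2.2,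
            (hu u' h').2.2]
          ring
      · refine derivedSystem_le_ker (hdiff q hq 1) ?_ ?_ v hv
        · filter_upwards [hO.mem_nhds hq] with p hp v hv using ((hker p hp v).1 hv).2.1
        · intro u h u' h'
          rw [h1 q hq u u' (hu u h).1 (hu u h).2.1 (hu u' h').1 (hu u' h').2.1, (hu u h).2.2,
            (hu u' h').2.2]
          ring
    · intro v hv
      have hv' := (hEmem q v).1 hv
      have h34 : VectorField.lieBracket ℝ (X 3) (X 4) q ∈ derivedSystem D q :=
        Submodule.subset_span (Or.inr ⟨X 3, X 4, hsecD q hq 3 (by decide),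
          hsecD q hq 4 (by decide), rfl⟩)
      set B := VectorField.lieBracket ℝ (X 3) (X 4) q with hB
      have hX3 := (hsecD q hq 3 (by decide)).eventually_mem.self_of_nhds
      have hX4 := (hsecD q hq 4 (by decide)).eventually_mem.self_of_nhds
      have b2 : η 2 q B = -1 := by
        rw [hB, hbr q hq 2 3 4 (by decide) (by decide), h2 q hq _ _ hX3 hX4]
        simp [hdual q hq]
      have hm3 := le_derivedSystem hD2 hq hX3
      have hm4 := le_derivedSystem hD2 hq hX4
      have b0 : η 0 q B = 0 := by
        rw [hB, hbr q hq 0 3 4 (by decide) (by decide), h0 q hq] <;> simp [hdual q hq]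
      have b1 : η 1 q B = 0 := by
        rw [hB, hbr q hq 1 3 4 (by decide) (by decide), h1 q hq] <;> simp [hdual q hq]
      have : v = (-η 2 q v) • B + (η 3 q v + η 2 q v * η 3 q B) • X 3 q
          + (η 4 q v + η 2 q v * η 4 q B) • X 4 q := by
        have e1 := hexp q hq v
        have e2 := hexp q hq B
        simp only [Fin.sum_univ_five, hv'.1, hv'.2, b0, b1, b2] at e1 e2
        linear_combination (norm := module) e1 + (η 2 q v) • e2
      rw [this]
      exact add_mem (add_mem (Submodule.smul_mem _ _ h34) (Submodule.smul_mem _ _ hm3))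
        (Submodule.smul_mem _ _ hm4)
  refine ⟨hD2, fun q hq => ?_, fun q hq => ?_⟩
  · rw [hDE q hq, (hE3 q hq).1]
  · rw [derivedSystem_congr hO hDE hq]
    suffices h : derivedSystem E q = ⊤ by rw [h, finrank_top, hn]
    rw [eq_top_iff]
    intro v _
    have hm : ∀ i, 2 ≤ i → X i q ∈ derivedSystem E q := fun i hi =>
      le_derivedSystem hE3 hq (hsecE q hq i hi).eventually_mem.self_of_nhds
    have hm2 : ∀ i, 2 ≤ i → VectorField.lieBracket ℝ (X 2) (X i) q ∈ derivedSystem E q :=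
      fun i hi => Submodule.subset_span (Or.inr ⟨X 2, X i, hsecE q hq 2 (by decide),
          hsecE q hq i hi, rfl⟩)
    set B := VectorField.lieBracket ℝ (X 2) (X 3) q with hB
    set C := VectorField.lieBracket ℝ (X 2) (X 4) q with hC
    have b0 : η 0 q B = -1 := by
      rw [hB, hbr q hq 0 2 3 (by decide) (by decide), h0 q hq] <;> simp [hdual q hq]
    have b1 : η 1 q B = 0 := by
      rw [hB, hbr q hq 1 2 3 (by decide) (by decide), h1 q hq] <;> simp [hdual q hq]
    have c0 : η 0 q C = 0 := by
      rw [hC, hbr q hq 0 2 4 (by decide) (by decide), h0 q hq] <;> simp [hdual q hq]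
    have c1 : η 1 q C = -1 := by
      rw [hC, hbr q hq 1 2 4 (by decide) (by decide), h1 q hq] <;> simp [hdual q hq]
    have : v = (-η 0 q v) • B + (-η 1 q v) • C
        + (η 2 q v + η 0 q v * η 2 q B + η 1 q v * η 2 q C) • X 2 q
        + (η 3 q v + η 0 q v * η 3 q B + η 1 q v * η 3 q C) • X 3 q
        + (η 4 q v + η 0 q v * η 4 q B + η 1 q v * η 4 q C) • X 4 q := by
      have e1 := hexp q hq v
      have e2 := hexp q hq B
      have e3 := hexp q hq C
      simp only [Fin.sum_univ_five, b0, b1, c0, c1] at e1 e2 e3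
      linear_combination (norm := module) e1 + (η 0 q v) • e2 + (η 1 q v) • e3
    rw [this]
    exact add_mem (add_mem (add_mem (add_mem
      (Submodule.smul_mem _ _ (hm2 3 (by decide))) (Submodule.smul_mem _ _ (hm2 4 (by decide))))
      (Submodule.smul_mem _ _ (hm 2 le_rfl))) (Submodule.smul_mem _ _ (hm 3 (by decide))))
      (Submodule.smul_mem _ _ (hm 4 (by decide)))

end Distributions

/-! ### The Lie algebra `g₂` in components -/

noncomputable section GTwo

theorem g2Matrix_row_0 (η : Fin 5 → ℝ) (ζ : Fin 9 → ℝ) :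
    g2Matrix η ζ 0 0 = -ζ 0 - ζ 3 ∧
    g2Matrix η ζ 0 1 = -ζ 7 ∧
    g2Matrix η ζ 0 2 = -ζ 8 ∧
    g2Matrix η ζ 0 3 = -(1 / √3) * ζ 6 ∧
    g2Matrix η ζ 0 4 = ζ 4 / 3 ∧
    g2Matrix η ζ 0 5 = ζ 5 / 3 ∧
    g2Matrix η ζ 0 6 = 0 :=
  ⟨rfl, rfl, rfl, rfl, rfl, rfl, rfl⟩

theorem g2Matrix_row_1 (η : Fin 5 → ℝ) (ζ : Fin 9 → ℝ) :
    g2Matrix η ζ 1 0 = η 0 ∧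
    g2Matrix η ζ 1 1 = ζ 0 ∧
    g2Matrix η ζ 1 2 = ζ 1 ∧
    g2Matrix η ζ 1 3 = 1 / √3 * η 3 ∧
    g2Matrix η ζ 1 4 = -η 2 / 3 ∧
    g2Matrix η ζ 1 5 = 0 ∧
    g2Matrix η ζ 1 6 = ζ 5 / 3 :=
  ⟨rfl, rfl, rfl, rfl, rfl, rfl, rfl⟩

theorem g2Matrix_row_2 (η : Fin 5 → ℝ) (ζ : Fin 9 → ℝ) :
    g2Matrix η ζ 2 0 = η 1 ∧
    g2Matrix η ζ 2 1 = ζ 2 ∧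
    g2Matrix η ζ 2 2 = ζ 3 ∧
    g2Matrix η ζ 2 3 = 1 / √3 * η 4 ∧
    g2Matrix η ζ 2 4 = 0 ∧
    g2Matrix η ζ 2 5 = -η 2 / 3 ∧
    g2Matrix η ζ 2 6 = -ζ 4 / 3 :=
  ⟨rfl, rfl, rfl, rfl, rfl, rfl, rfl⟩

theorem g2Matrix_row_3 (η : Fin 5 → ℝ) (ζ : Fin 9 → ℝ) :
    g2Matrix η ζ 3 0 = 2 * (1 / √3) * η 2 ∧
    g2Matrix η ζ 3 1 = 2 * (1 / √3) * ζ 4 ∧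
    g2Matrix η ζ 3 2 = 2 * (1 / √3) * ζ 5 ∧
    g2Matrix η ζ 3 3 = 0 ∧
    g2Matrix η ζ 3 4 = 1 / √3 * η 4 ∧
    g2Matrix η ζ 3 5 = -(1 / √3) * η 3 ∧
    g2Matrix η ζ 3 6 = -(1 / √3) * ζ 6 :=
  ⟨rfl, rfl, rfl, rfl, rfl, rfl, rfl⟩

theorem g2Matrix_row_4 (η : Fin 5 → ℝ) (ζ : Fin 9 → ℝ) :
    g2Matrix η ζ 4 0 = η 3 ∧
    g2Matrix η ζ 4 1 = ζ 6 ∧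
    g2Matrix η ζ 4 2 = 0 ∧
    g2Matrix η ζ 4 3 = 2 * (1 / √3) * ζ 5 ∧
    g2Matrix η ζ 4 4 = -ζ 3 ∧
    g2Matrix η ζ 4 5 = ζ 1 ∧
    g2Matrix η ζ 4 6 = ζ 8 :=
  ⟨rfl, rfl, rfl, rfl, rfl, rfl, rfl⟩

theorem g2Matrix_row_5 (η : Fin 5 → ℝ) (ζ : Fin 9 → ℝ) :
    g2Matrix η ζ 5 0 = η 4 ∧
    g2Matrix η ζ 5 1 = 0 ∧
    g2Matrix η ζ 5 2 = ζ 6 ∧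
    g2Matrix η ζ 5 3 = -2 * (1 / √3) * ζ 4 ∧
    g2Matrix η ζ 5 4 = ζ 2 ∧
    g2Matrix η ζ 5 5 = -ζ 0 ∧
    g2Matrix η ζ 5 6 = -ζ 7 :=
  ⟨rfl, rfl, rfl, rfl, rfl, rfl, rfl⟩

theorem g2Matrix_row_6 (η : Fin 5 → ℝ) (ζ : Fin 9 → ℝ) :
    g2Matrix η ζ 6 0 = 0 ∧
    g2Matrix η ζ 6 1 = η 4 ∧
    g2Matrix η ζ 6 2 = -η 3 ∧
    g2Matrix η ζ 6 3 = 2 * (1 / √3) * η 2 ∧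
    g2Matrix η ζ 6 4 = -η 1 ∧
    g2Matrix η ζ 6 5 = η 0 ∧
    g2Matrix η ζ 6 6 = ζ 0 + ζ 3 :=
  ⟨rfl, rfl, rfl, rfl, rfl, rfl, rfl⟩

theorem g2Matrix_add (η η' : Fin 5 → ℝ) (ζ ζ' : Fin 9 → ℝ) :
    g2Matrix η ζ + g2Matrix η' ζ' = g2Matrix (η + η') (ζ + ζ') := by
  ext i j
  fin_cases i <;> fin_cases j <;>
  · simp only [Fin.zero_eta, Fin.mk_one, Fin.reduceFinMk, Matrix.add_apply, Pi.add_apply,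
      g2Matrix_row_0, g2Matrix_row_1, g2Matrix_row_2, g2Matrix_row_3, g2Matrix_row_4,
      g2Matrix_row_5, g2Matrix_row_6]
    try ring

theorem g2Matrix_zero : g2Matrix 0 0 = 0 := by
  ext i j
  fin_cases i <;> fin_cases j <;> simp [g2Matrix]

/-- The components in `g₋` of the bracket of two elements of `g₂`. -/
def g2BracketEta (η : Fin 5 → ℝ) (ζ : Fin 9 → ℝ) (η' : Fin 5 → ℝ) (ζ' : Fin 9 → ℝ) :
    Fin 5 → ℝ
  | 0 => 2 * (ζ 0 * η' 0 - ζ' 0 * η 0) + (ζ 3 * η' 0 - ζ' 3 * η 0) + (ζ 1 * η' 1 - ζ' 1 * η 1)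
      + (η 3 * η' 2 - η' 3 * η 2)
  | 1 => (ζ 2 * η' 0 - ζ' 2 * η 0) + (ζ 0 * η' 1 - ζ' 0 * η 1) + 2 * (ζ 3 * η' 1 - ζ' 3 * η 1)
      + (η 4 * η' 2 - η' 4 * η 2)
  | 2 => (ζ 4 * η' 0 - ζ' 4 * η 0) + (ζ 5 * η' 1 - ζ' 5 * η 1) + (ζ 0 * η' 2 - ζ' 0 * η 2)
      + (ζ 3 * η' 2 - ζ' 3 * η 2) + (η 4 * η' 3 - η' 4 * η 3)
  | 3 => (ζ 6 * η' 0 - ζ' 6 * η 0) + 4 / 3 * (ζ 5 * η' 2 - ζ' 5 * η 2) + (ζ 0 * η' 3 - ζ' 0 * η 3)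
      + (ζ 1 * η' 4 - ζ' 1 * η 4)
  | 4 => (ζ 6 * η' 1 - ζ' 6 * η 1) - 4 / 3 * (ζ 4 * η' 2 - ζ' 4 * η 2) + (ζ 2 * η' 3 - ζ' 2 * η 3)
      + (ζ 3 * η' 4 - ζ' 3 * η 4)

/-- The components in `p₁` of the bracket of two elements of `g₂`. -/
def g2BracketZeta (η : Fin 5 → ℝ) (ζ : Fin 9 → ℝ) (η' : Fin 5 → ℝ) (ζ' : Fin 9 → ℝ) :
    Fin 9 → ℝ
  | 0 => (ζ 7 * η' 0 - ζ' 7 * η 0) + 1 / 3 * (ζ 6 * η' 2 - ζ' 6 * η 2)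
      - 2 / 3 * (ζ 4 * η' 3 - ζ' 4 * η 3) + 1 / 3 * (ζ 5 * η' 4 - ζ' 5 * η 4)
      + (ζ 1 * ζ' 2 - ζ' 1 * ζ 2)
  | 1 => (ζ 8 * η' 0 - ζ' 8 * η 0) - (ζ 5 * η' 3 - ζ' 5 * η 3) + (ζ 0 * ζ' 1 - ζ' 0 * ζ 1)
      + (ζ 1 * ζ' 3 - ζ' 1 * ζ 3)
  | 2 => (ζ 7 * η' 1 - ζ' 7 * η 1) - (ζ 4 * η' 4 - ζ' 4 * η 4) + (ζ 2 * ζ' 0 - ζ' 2 * ζ 0)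
      + (ζ 3 * ζ' 2 - ζ' 3 * ζ 2)
  | 3 => (ζ 8 * η' 1 - ζ' 8 * η 1) + 1 / 3 * (ζ 6 * η' 2 - ζ' 6 * η 2)
      + 1 / 3 * (ζ 4 * η' 3 - ζ' 4 * η 3) - 2 / 3 * (ζ 5 * η' 4 - ζ' 5 * η 4)
      + (ζ 2 * ζ' 1 - ζ' 2 * ζ 1)
  | 4 => (ζ 7 * η' 2 - ζ' 7 * η 2) - (ζ 6 * η' 4 - ζ' 6 * η 4) + (ζ 4 * ζ' 0 - ζ' 4 * ζ 0)
      + (ζ 5 * ζ' 2 - ζ' 5 * ζ 2)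
  | 5 => (ζ 8 * η' 2 - ζ' 8 * η 2) + (ζ 6 * η' 3 - ζ' 6 * η 3) + (ζ 4 * ζ' 1 - ζ' 4 * ζ 1)
      + (ζ 5 * ζ' 3 - ζ' 5 * ζ 3)
  | 6 => (ζ 7 * η' 3 - ζ' 7 * η 3) + (ζ 8 * η' 4 - ζ' 8 * η 4) + (ζ 6 * ζ' 0 - ζ' 6 * ζ 0)
      + (ζ 6 * ζ' 3 - ζ' 6 * ζ 3) + 4 / 3 * (ζ 5 * ζ' 4 - ζ' 5 * ζ 4)
  | 7 => 2 * (ζ 7 * ζ' 0 - ζ' 7 * ζ 0) + (ζ 8 * ζ' 2 - ζ' 8 * ζ 2) + (ζ 7 * ζ' 3 - ζ' 7 * ζ 3)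
      + (ζ 6 * ζ' 4 - ζ' 6 * ζ 4)
  | 8 => (ζ 8 * ζ' 0 - ζ' 8 * ζ 0) + (ζ 7 * ζ' 1 - ζ' 7 * ζ 1) + 2 * (ζ 8 * ζ' 3 - ζ' 8 * ζ 3)
      + (ζ 6 * ζ' 5 - ζ' 6 * ζ 5)

/-- The components of the bracket of `g₂`, read off from the seven-dimensional representation; in
particular the matrices of this shape form a Lie algebra. -/
theorem g2Matrix_bracket (η : Fin 5 → ℝ) (ζ : Fin 9 → ℝ) (η' : Fin 5 → ℝ) (ζ' : Fin 9 → ℝ) :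
    g2Matrix η ζ * g2Matrix η' ζ' - g2Matrix η' ζ' * g2Matrix η ζ =
      g2Matrix (g2BracketEta η ζ η' ζ') (g2BracketZeta η ζ η' ζ') := by
  have hr : (1 / √3 : ℝ) ^ 2 = 1 / 3 := by
    rw [div_pow, Real.sq_sqrt (by norm_num)]; norm_num
  ext i j
  fin_cases i <;> fin_cases j <;>
  · simp only [Fin.zero_eta, Fin.mk_one, Fin.reduceFinMk, Matrix.sub_apply, Matrix.mul_apply,
      Fin.sum_univ_seven, g2Matrix_row_0, g2Matrix_row_1, g2Matrix_row_2, g2Matrix_row_3,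
      g2Matrix_row_4, g2Matrix_row_5, g2Matrix_row_6, g2BracketEta, g2BracketZeta]
    generalize (1 / √3 : ℝ) = r at hr
    ring_nf
    try simp only [hr]
    try ring

end GTwo

/-! ### The Cartan gauge of a para-Kähler–Einstein frame -/

noncomputable section Gauge

theorem g2Matrix_zero_of_forall {ζ : Fin 9 → ℝ} (h : ∀ l, ζ l = 0) : g2Matrix 0 ζ = 0 := by
  rw [show ζ = 0 from funext h, g2Matrix_zero]

/-- The components in `p₁` of an element of the Levi factor `sl₂` of `p₁`. -/
def sl2Zeta (a b c : ℝ) : Fin 9 → ℝ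
  | 0 => a
  | 1 => b
  | 2 => c
  | 3 => -a
  | _ => 0

theorem g2BracketEta_zero (ζ ζ' : Fin 9 → ℝ) : g2BracketEta 0 ζ 0 ζ' = 0 := by
  funext i
  fin_cases i <;> simp [g2BracketEta]

theorem g2Matrix_zero_bracket (ζ ζ' : Fin 9 → ℝ) :
    g2Matrix 0 ζ * g2Matrix 0 ζ' - g2Matrix 0 ζ' * g2Matrix 0 ζ =
      g2Matrix 0 (g2BracketZeta 0 ζ 0 ζ') := by
  rw [g2Matrix_bracket, g2BracketEta_zero]

/-- The adjoint action of the Levi factor `sl₂` on `p₊`, in the basis `g2Plus`. -/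
theorem g2Plus_comm_sl2 (a b c : ℝ) :
    (∀ j, g2Plus j * g2Matrix 0 (sl2Zeta a b c) - g2Matrix 0 (sl2Zeta a b c) * g2Plus j =
      g2Matrix 0 (match j with
        | 0 => Pi.single 7 (-a / 2) + Pi.single 8 (-b / 2)
        | 1 => Pi.single 7 (-c / 2) + Pi.single 8 (a / 2)
        | 2 => 0
        | 3 => Pi.single 4 (a / 2) + Pi.single 5 (b / 2)
        | 4 => Pi.single 4 (c / 2) + Pi.single 5 (-a / 2))) := by
  intro j
  fin_cases j <;>
  · simp only [Fin.zero_eta, Fin.mk_one, Fin.reduceFinMk, g2Plus, Matrix.cons_val]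
    rw [g2Matrix_zero_bracket]
    congr 1
    funext i
    fin_cases i <;> simp [g2BracketZeta, sl2Zeta] <;> ring

/-- The values of the four forms `θ` on the frame dual to the forms `η` of the gauge, where
`Y = 3 Ψ / 8`: row `i` lists the values on the `i`-th vector. -/
def dualFrameTheta (Y : ℝ) : Fin 5 → Fin 4 → ℝ
  | 0 => ![Y, 0, 0, Y]
  | 1 => ![0, Y, -Y, 0]
  | 2 => 0
  | 3 => ![1 / 2, 0, 0, -1 / 2]
  | 4 => ![0, 1 / 2, 1 / 2, 0]

/-- The wedge product of two linear forms. -/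
def wedgeOne {F : Type*} [NormedAddCommGroup F] [NormedSpace ℝ F] (a b : F →L[ℝ] ℝ) (u v : F) : ℝ :=
  a u * b v - a v * b u

/-- Two of the five basis vectors of `p₊` lie in its centre. -/
theorem g2Plus_comm_eq_zero (i j : Fin 5) (hi : i = 0 ∨ i = 1) :
    g2Plus i * g2Plus j - g2Plus j * g2Plus i = 0 := by
  rw [← g2Matrix_zero]
  rcases hi with rfl | rfl <;> fin_cases j <;>
  · simp only [Fin.zero_eta, Fin.mk_one, Fin.reduceFinMk, g2Plus, Matrix.cons_val]
    rw [g2Matrix_zero_bracket]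
    congr 1
    funext l
    fin_cases l <;> simp [g2BracketZeta]

set_option maxHeartbeats 1000000 in
/-- An `sl₂`-valued curvature function built from an anti-self-dual Weyl tensor is normal: the
second term of the codifferential vanishes since `[p₊, p₊]` pairs only with components on which the
curvature is zero, and the first one since a Weyl tensor is trace-free. -/
theorem kostantCodifferential_eq_zero (Y : ℝ) (w : Fin 5 → ℝ)
    (κ : Fin 5 → Fin 5 → Matrix (Fin 7) (Fin 7) ℝ)
    (hκ : ∀ i j, κ i j =
      let P := fun a b : Fin 4 => dualFrameTheta Y i a * dualFrameTheta Y j b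
        - dualFrameTheta Y j a * dualFrameTheta Y i b
      g2Matrix 0 (sl2Zeta (w 0 * (P 0 2 - P 1 3) + w 1 * P 1 2 + w 2 * P 0 3)
        (w 1 * (P 0 2 - P 1 3) + w 3 * P 1 2 - w 0 * P 0 3)
        (w 2 * (P 0 2 - P 1 3) - w 0 * P 1 2 + w 4 * P 0 3))) (k : Fin 5) :
    kostantCodifferential κ k = 0 := by
  have hz : g2Matrix 0 (sl2Zeta 0 0 0) = 0 :=
    g2Matrix_zero_of_forall fun l => by fin_cases l <;> simp [sl2Zeta]
  have h2 : ∀ j, κ 2 j = 0 := fun j => by rw [hκ]; simp [dualFrameTheta, hz]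
  have h2' : ∀ j, κ j 2 = 0 := fun j => by rw [hκ]; simp [dualFrameTheta, hz]
  have hd : ∀ j, κ j j = 0 := fun j => by rw [hκ]; simp [mul_comm, hz]
  have h01 : κ 0 1 = 0 := by rw [hκ]; simp [dualFrameTheta, hz]
  have h10 : κ 1 0 = 0 := by rw [hκ]; simp [dualFrameTheta, hz]
  have h34 : κ 3 4 = 0 := by rw [hκ]; simp [dualFrameTheta]; convert hz using 3 <;> ring
  have h43 : κ 4 3 = 0 := by rw [hκ]; simp [dualFrameTheta]; convert hz using 3 <;> ring
  have h03 : κ 0 3 = g2Matrix 0 (sl2Zeta (-Y * w 2) (Y * w 0) (-Y * w 4)) := by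
    rw [hκ]; simp [dualFrameTheta]; congr 2 <;> ring
  have h30 : κ 3 0 = g2Matrix 0 (sl2Zeta (Y * w 2) (-Y * w 0) (Y * w 4)) := by
    rw [hκ]; simp [dualFrameTheta]; congr 2 <;> ring
  have h04 : κ 0 4 = g2Matrix 0 (sl2Zeta (Y * w 0) (Y * w 1) (Y * w 2)) := by
    rw [hκ]; simp [dualFrameTheta]; congr 2 <;> ring
  have h40 : κ 4 0 = g2Matrix 0 (sl2Zeta (-Y * w 0) (-Y * w 1) (-Y * w 2)) := by
    rw [hκ]; simp [dualFrameTheta]; congr 2 <;> ring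
  have h13 : κ 1 3 = g2Matrix 0 (sl2Zeta (Y * w 0) (Y * w 1) (Y * w 2)) := by
    rw [hκ]; simp [dualFrameTheta]; congr 2 <;> ring
  have h31 : κ 3 1 = g2Matrix 0 (sl2Zeta (-Y * w 0) (-Y * w 1) (-Y * w 2)) := by
    rw [hκ]; simp [dualFrameTheta]; congr 2 <;> ring
  have h14 : κ 1 4 = g2Matrix 0 (sl2Zeta (Y * w 1) (Y * w 3) (-Y * w 0)) := by
    rw [hκ]; simp [dualFrameTheta]; congr 2 <;> ring
  have h41 : κ 4 1 = g2Matrix 0 (sl2Zeta (-Y * w 1) (-Y * w 3) (Y * w 0)) := by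
    rw [hκ]; simp [dualFrameTheta]; congr 2 <;> ring
  have hsecond : ∀ i j, ((g2Plus i * g2Plus j - g2Plus j * g2Plus i) * g2Minus k).trace • κ i j
      = 0 := by
    intro i j
    by_cases hi : i = 0 ∨ i = 1
    · simp [g2Plus_comm_eq_zero i j hi]
    by_cases hj : j = 0 ∨ j = 1
    · rw [← neg_sub, g2Plus_comm_eq_zero j i hj]; simp
    suffices κ i j = 0 by rw [this, smul_zero]
    fin_cases i <;> fin_cases j <;> simp_all
  have hfirst : ∑ j, (g2Plus j * κ k j - κ k j * g2Plus j) = 0 := by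
    rw [Fin.sum_univ_five]
    fin_cases k <;>
    · simp only [Fin.zero_eta, Fin.mk_one, Fin.reduceFinMk, hd, h2, h2', h01, h10, h34, h43, h03,
        h30, h04, h40, h13, h31, h14, h41, mul_zero, zero_mul, sub_zero, add_zero, zero_add,
        g2Plus_comm_sl2, g2Matrix_add]
      try exact g2Matrix_zero_of_forall fun l => by fin_cases l <;> simp <;> ring
  simp only [kostantCodifferential, hfirst, hsecond, Finset.sum_const_zero, smul_zero, sub_zero]

end Gauge

noncomputable section Gauge

variable {F : Type*} [NormedAddCommGroup F] [NormedSpace ℝ F]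

theorem extDerivOne_add {β γ : F → F →L[ℝ] ℝ} {q : F} (hβ : DifferentiableAt ℝ β q)
    (hγ : DifferentiableAt ℝ γ q) (u v : F) :
    extDerivOne (fun p => β p + γ p) q u v = extDerivOne β q u v + extDerivOne γ q u v := by
  simp only [extDerivOne, fderiv_fun_add hβ hγ, add_apply]
  ring

theorem extDerivOne_sub {β γ : F → F →L[ℝ] ℝ} {q : F} (hβ : DifferentiableAt ℝ β q)
    (hγ : DifferentiableAt ℝ γ q) (u v : F) :
    extDerivOne (fun p => β p - γ p) q u v = extDerivOne β q u v - extDerivOne γ q u v := by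
  simp only [extDerivOne, fderiv_fun_sub hβ hγ, sub_apply]
  ring

theorem extDerivOne_smul {β : F → F →L[ℝ] ℝ} {f : F → ℝ} {q : F} (hf : DifferentiableAt ℝ f q)
    (hβ : DifferentiableAt ℝ β q) (u v : F) :
    extDerivOne (fun p => f p • β p) q u v =
      f q * extDerivOne β q u v + wedgeOne (fderiv ℝ f q) (β q) u v := by
  simp only [extDerivOne, wedgeOne, fderiv_fun_smul hf hβ, add_apply,
    smul_apply, ContinuousLinearMap.smulRight_apply, smul_eq_mul]
  ring

theorem extDerivOne_const_smul {β : F → F →L[ℝ] ℝ} {q : F} (c : ℝ)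
    (hβ : DifferentiableAt ℝ β q) (u v : F) :
    extDerivOne (fun p => c • β p) q u v = c * extDerivOne β q u v := by
  rw [extDerivOne_smul (differentiableAt_const c) hβ]
  simp [wedgeOne]

theorem extDerivOne_neg (β : F → F →L[ℝ] ℝ) (q u v : F) :
    extDerivOne (fun p => -β p) q u v = -extDerivOne β q u v := by
  simp only [extDerivOne, fderiv_fun_neg, neg_apply]
  ring

/-- Solutions of the structure equations of a para-Kähler–Einstein metric in dimension four, for
forms on a space of any dimension: `θ` is an adapted coframe, `A` is the block of the connection
matrix acting on `θ⁰, θ¹` (the other diagonal block is `-Aᵀ`), and the curvature is the sum of an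
anti-self-dual Weyl tensor, with five components `w`, and of a constant multiple of the curvature of
the para-complex projective plane. -/
structure IsParaKahlerEinsteinFrame (O : Set F) (θ : Fin 4 → F → F →L[ℝ] ℝ)
    (A : Fin 2 → Fin 2 → F → F →L[ℝ] ℝ) (Ψ : ℝ) : Prop where
  smooth_theta : ∀ a, ContDiffOn ℝ ∞ (θ a) O
  smooth_conn : ∀ a b, ContDiffOn ℝ ∞ (A a b) O
  d_theta_0 : ∀ q ∈ O, ∀ u v, extDerivOne (θ 0) q u v =
    -wedgeOne (A 0 0 q) (θ 0 q) u v - wedgeOne (A 0 1 q) (θ 1 q) u v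
  d_theta_1 : ∀ q ∈ O, ∀ u v, extDerivOne (θ 1) q u v =
    -wedgeOne (A 1 0 q) (θ 0 q) u v - wedgeOne (A 1 1 q) (θ 1 q) u v
  d_theta_2 : ∀ q ∈ O, ∀ u v, extDerivOne (θ 2) q u v =
    wedgeOne (A 0 0 q) (θ 2 q) u v + wedgeOne (A 1 0 q) (θ 3 q) u v
  d_theta_3 : ∀ q ∈ O, ∀ u v, extDerivOne (θ 3) q u v =
    wedgeOne (A 0 1 q) (θ 2 q) u v + wedgeOne (A 1 1 q) (θ 3 q) u v
  d_conn : ∀ q ∈ O, ∃ w : Fin 5 → ℝ, ∀ u v,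
    extDerivOne (A 0 0) q u v = -wedgeOne (A 0 1 q) (A 1 0 q) u v
      + (w 0 - 2 * Ψ) * wedgeOne (θ 0 q) (θ 2 q) u v + w 1 * wedgeOne (θ 1 q) (θ 2 q) u v
      + w 2 * wedgeOne (θ 0 q) (θ 3 q) u v - (w 0 + Ψ) * wedgeOne (θ 1 q) (θ 3 q) u v ∧
    extDerivOne (A 0 1) q u v = -wedgeOne (A 0 0 q) (A 0 1 q) u v
        - wedgeOne (A 0 1 q) (A 1 1 q) u v
      + w 1 * wedgeOne (θ 0 q) (θ 2 q) u v + w 3 * wedgeOne (θ 1 q) (θ 2 q) u v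
      - (w 0 + Ψ) * wedgeOne (θ 0 q) (θ 3 q) u v - w 1 * wedgeOne (θ 1 q) (θ 3 q) u v ∧
    extDerivOne (A 1 0) q u v = -wedgeOne (A 1 0 q) (A 0 0 q) u v
        - wedgeOne (A 1 1 q) (A 1 0 q) u v
      + w 2 * wedgeOne (θ 0 q) (θ 2 q) u v - (w 0 + Ψ) * wedgeOne (θ 1 q) (θ 2 q) u v
      + w 4 * wedgeOne (θ 0 q) (θ 3 q) u v - w 2 * wedgeOne (θ 1 q) (θ 3 q) u v ∧
    extDerivOne (A 1 1) q u v = -wedgeOne (A 1 0 q) (A 0 1 q) u v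
      - (w 0 + Ψ) * wedgeOne (θ 0 q) (θ 2 q) u v - w 1 * wedgeOne (θ 1 q) (θ 2 q) u v
      - w 2 * wedgeOne (θ 0 q) (θ 3 q) u v + (w 0 - 2 * Ψ) * wedgeOne (θ 1 q) (θ 3 q) u v

/-- The components in `g₋` of the Cartan gauge of a para-Kähler–Einstein frame.  The first three
are multiples of the forms defining the twistor distribution; the constants are forced by the
embedding of `sl₃` in `g₂`, and are the reason why `Ψ` has to be non-zero. -/
def gaugeEta (θ : Fin 4 → F → F →L[ℝ] ℝ) (A : Fin 2 → Fin 2 → F → F →L[ℝ] ℝ) (Ψ : ℝ) :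
    Fin 5 → F → F →L[ℝ] ℝ
  | 0 => fun q => (4 / (3 * Ψ)) • (θ 0 q + θ 3 q)
  | 1 => fun q => (4 / (3 * Ψ)) • (θ 1 q - θ 2 q)
  | 2 => fun q => (-2 / (3 * Ψ)) • (A 0 0 q + A 1 1 q)
  | 3 => fun q => θ 0 q - θ 3 q
  | 4 => fun q => θ 1 q + θ 2 q

/-- The components in `p₁` of the Cartan gauge of a para-Kähler–Einstein frame.  The pair
`(gaugeEta, gaugeZeta)` is the composition of the Cartan connection of type `(SL₃, GL₂)` of the
para-Kähler–Einstein metric with an embedding of `sl₃` in `g₂`. -/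
def gaugeZeta (θ : Fin 4 → F → F →L[ℝ] ℝ) (A : Fin 2 → Fin 2 → F → F →L[ℝ] ℝ) (Ψ : ℝ) :
    Fin 9 → F → F →L[ℝ] ℝ
  | 0 => fun q => (1 / 2 : ℝ) • (A 0 0 q - A 1 1 q)
  | 1 => A 0 1
  | 2 => A 1 0
  | 3 => fun q => (-1 / 2 : ℝ) • (A 0 0 q - A 1 1 q)
  | 4 => fun q => (-(3 * Ψ / 8)) • (θ 1 q - θ 2 q)
  | 5 => fun q => (3 * Ψ / 8) • (θ 0 q + θ 3 q)
  | 6 => fun q => (Ψ / 8) • (A 0 0 q + A 1 1 q)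
  | 7 => fun q => (-(3 * Ψ ^ 2 / 32)) • (θ 1 q + θ 2 q)
  | 8 => fun q => (3 * Ψ ^ 2 / 32) • (θ 0 q - θ 3 q)

variable {O : Set F} {θ : Fin 4 → F → F →L[ℝ] ℝ} {A : Fin 2 → Fin 2 → F → F →L[ℝ] ℝ} {Ψ : ℝ}

theorem extDerivOne_gaugeEta {q : F} (hθ : ∀ a, DifferentiableAt ℝ (θ a) q)
    (hA : ∀ a b, DifferentiableAt ℝ (A a b) q) (u v : F) :
    extDerivOne (gaugeEta θ A Ψ 0) q u v =
      4 / (3 * Ψ) * (extDerivOne (θ 0) q u v + extDerivOne (θ 3) q u v) ∧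
    extDerivOne (gaugeEta θ A Ψ 1) q u v =
      4 / (3 * Ψ) * (extDerivOne (θ 1) q u v - extDerivOne (θ 2) q u v) ∧
    extDerivOne (gaugeEta θ A Ψ 2) q u v =
      -2 / (3 * Ψ) * (extDerivOne (A 0 0) q u v + extDerivOne (A 1 1) q u v) ∧
    extDerivOne (gaugeEta θ A Ψ 3) q u v =
      extDerivOne (θ 0) q u v - extDerivOne (θ 3) q u v ∧
    extDerivOne (gaugeEta θ A Ψ 4) q u v =
      extDerivOne (θ 1) q u v + extDerivOne (θ 2) q u v := by
  refine ⟨?_, ?_, ?_, ?_, ?_⟩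
  · rw [gaugeEta, extDerivOne_const_smul _ ((hθ 0).fun_add (hθ 3)), extDerivOne_add (hθ 0) (hθ 3)]
  · rw [gaugeEta, extDerivOne_const_smul _ ((hθ 1).fun_sub (hθ 2)), extDerivOne_sub (hθ 1) (hθ 2)]
  · rw [gaugeEta, extDerivOne_const_smul _ ((hA 0 0).fun_add (hA 1 1)),
      extDerivOne_add (hA 0 0) (hA 1 1)]
  · rw [gaugeEta, extDerivOne_sub (hθ 0) (hθ 3)]
  · rw [gaugeEta, extDerivOne_add (hθ 1) (hθ 2)]

theorem extDerivOne_gaugeZeta {q : F} (hθ : ∀ a, DifferentiableAt ℝ (θ a) q)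
    (hA : ∀ a b, DifferentiableAt ℝ (A a b) q) (u v : F) :
    extDerivOne (gaugeZeta θ A Ψ 0) q u v =
      1 / 2 * (extDerivOne (A 0 0) q u v - extDerivOne (A 1 1) q u v) ∧
    extDerivOne (gaugeZeta θ A Ψ 1) q u v = extDerivOne (A 0 1) q u v ∧
    extDerivOne (gaugeZeta θ A Ψ 2) q u v = extDerivOne (A 1 0) q u v ∧
    extDerivOne (gaugeZeta θ A Ψ 3) q u v =
      -1 / 2 * (extDerivOne (A 0 0) q u v - extDerivOne (A 1 1) q u v) ∧
    extDerivOne (gaugeZeta θ A Ψ 4) q u v =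
      -(3 * Ψ / 8) * (extDerivOne (θ 1) q u v - extDerivOne (θ 2) q u v) ∧
    extDerivOne (gaugeZeta θ A Ψ 5) q u v =
      3 * Ψ / 8 * (extDerivOne (θ 0) q u v + extDerivOne (θ 3) q u v) ∧
    extDerivOne (gaugeZeta θ A Ψ 6) q u v =
      Ψ / 8 * (extDerivOne (A 0 0) q u v + extDerivOne (A 1 1) q u v) ∧
    extDerivOne (gaugeZeta θ A Ψ 7) q u v =
      -(3 * Ψ ^ 2 / 32) * (extDerivOne (θ 1) q u v + extDerivOne (θ 2) q u v) ∧
    extDerivOne (gaugeZeta θ A Ψ 8) q u v =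
      3 * Ψ ^ 2 / 32 * (extDerivOne (θ 0) q u v - extDerivOne (θ 3) q u v) := by
  refine ⟨?_, rfl, rfl, ?_, ?_, ?_, ?_, ?_, ?_⟩
  · rw [gaugeZeta, extDerivOne_const_smul _ ((hA 0 0).fun_sub (hA 1 1)),
      extDerivOne_sub (hA 0 0) (hA 1 1)]
  · rw [gaugeZeta, extDerivOne_const_smul _ ((hA 0 0).fun_sub (hA 1 1)),
      extDerivOne_sub (hA 0 0) (hA 1 1)]
  · rw [gaugeZeta, extDerivOne_const_smul _ ((hθ 1).fun_sub (hθ 2)), extDerivOne_sub (hθ 1) (hθ 2)]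
  · rw [gaugeZeta, extDerivOne_const_smul _ ((hθ 0).fun_add (hθ 3)), extDerivOne_add (hθ 0) (hθ 3)]
  · rw [gaugeZeta, extDerivOne_const_smul _ ((hA 0 0).fun_add (hA 1 1)),
      extDerivOne_add (hA 0 0) (hA 1 1)]
  · rw [gaugeZeta, extDerivOne_const_smul _ ((hθ 1).fun_add (hθ 2)), extDerivOne_add (hθ 1) (hθ 2)]
  · rw [gaugeZeta, extDerivOne_const_smul _ ((hθ 0).fun_sub (hθ 3)), extDerivOne_sub (hθ 0) (hθ 3)]

namespace IsParaKahlerEinsteinFrame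

theorem differentiableAt_theta (h : IsParaKahlerEinsteinFrame O θ A Ψ) (hO : IsOpen O) {q : F}
    (hq : q ∈ O) (a : Fin 4) : DifferentiableAt ℝ (θ a) q :=
  ((h.smooth_theta a).contDiffAt (hO.mem_nhds hq)).differentiableAt (by simp)

theorem differentiableAt_conn (h : IsParaKahlerEinsteinFrame O θ A Ψ) (hO : IsOpen O) {q : F}
    (hq : q ∈ O) (a b : Fin 2) : DifferentiableAt ℝ (A a b) q :=
  ((h.smooth_conn a b).contDiffAt (hO.mem_nhds hq)).differentiableAt (by simp)

set_option maxHeartbeats 1000000 in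
/-- The curvature of the gauge is the anti-self-dual Weyl tensor, with values in `sl₂ ⊂ p₁`. -/
theorem cartanCurvature_gauge (h : IsParaKahlerEinsteinFrame O θ A Ψ) (hO : IsOpen O)
    (hΨ : Ψ ≠ 0) {q : F} (hq : q ∈ O) : ∃ w : Fin 5 → ℝ, ∀ u v,
      cartanCurvature (gaugeEta θ A Ψ) (gaugeZeta θ A Ψ) q u v =
        let P := fun a b : Fin 4 => wedgeOne (θ a q) (θ b q) u v
        g2Matrix 0 (sl2Zeta (w 0 * (P 0 2 - P 1 3) + w 1 * P 1 2 + w 2 * P 0 3)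
          (w 1 * (P 0 2 - P 1 3) + w 3 * P 1 2 - w 0 * P 0 3)
          (w 2 * (P 0 2 - P 1 3) - w 0 * P 1 2 + w 4 * P 0 3)) := by
  obtain ⟨w, hw⟩ := h.d_conn q hq
  refine ⟨w, fun u v => ?_⟩
  obtain ⟨a00, a01, a10, a11⟩ := hw u v
  obtain ⟨e0, e1, e2, e3, e4⟩ := extDerivOne_gaugeEta (Ψ := Ψ) (h.differentiableAt_theta hO hq)
    (h.differentiableAt_conn hO hq) u v
  obtain ⟨z0, z1, z2, z3, z4, z5, z6, z7, z8⟩ := extDerivOne_gaugeZeta (Ψ := Ψ)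
    (h.differentiableAt_theta hO hq) (h.differentiableAt_conn hO hq) u v
  have t0 := h.d_theta_0 q hq u v
  have t1 := h.d_theta_1 q hq u v
  have t2 := h.d_theta_2 q hq u v
  have t3 := h.d_theta_3 q hq u v
  rw [t0, t3] at e0 e3 z5 z8
  rw [t1, t2] at e1 e4 z4 z7
  rw [a00, a11] at e2 z0 z3 z6
  rw [a01] at z1
  rw [a10] at z2
  simp only [wedgeOne] at *
  simp only [cartanCurvature, cartanForm, g2Matrix_bracket, g2Matrix_add]
  congr 1
  · funext i
    fin_cases i <;>
    · simp only [Fin.zero_eta, Fin.mk_one, Fin.reduceFinMk, Pi.add_apply, Pi.zero_apply,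
        g2BracketEta, e0, e1, e2, e3, e4]
      simp only [gaugeEta, gaugeZeta, add_apply, sub_apply,
        smul_apply, smul_eq_mul]
      field_simp
      ring
  · funext i
    fin_cases i <;>
    · simp only [Fin.zero_eta, Fin.mk_one, Fin.reduceFinMk, Pi.add_apply, sl2Zeta,
        g2BracketZeta, z0, z1, z2, z3, z4, z5, z6, z7, z8]
      simp only [gaugeEta, gaugeZeta, add_apply, sub_apply,
        smul_apply, smul_eq_mul]
      field_simp
      ring

end IsParaKahlerEinsteinFrame

end Gauge

noncomputable section Gauge

variable {F : Type*} [NormedAddCommGroup F] [NormedSpace ℝ F]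
variable {O : Set F} {θ : Fin 4 → F → F →L[ℝ] ℝ} {A : Fin 2 → Fin 2 → F → F →L[ℝ] ℝ} {Ψ : ℝ}

namespace IsParaKahlerEinsteinFrame

theorem smooth_gaugeEta (h : IsParaKahlerEinsteinFrame O θ A Ψ) (i : Fin 5) :
    ContDiffOn ℝ ∞ (gaugeEta θ A Ψ i) O := by
  have ht := h.smooth_theta
  have hA := h.smooth_conn
  fin_cases i
  · exact ContDiffOn.const_smul _ ((ht 0).add (ht 3))
  · exact ContDiffOn.const_smul _ ((ht 1).sub (ht 2))
  · exact ContDiffOn.const_smul _ ((hA 0 0).add (hA 1 1))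
  · exact (ht 0).sub (ht 3)
  · exact (ht 1).add (ht 2)

theorem smooth_gaugeZeta (h : IsParaKahlerEinsteinFrame O θ A Ψ) (i : Fin 9) :
    ContDiffOn ℝ ∞ (gaugeZeta θ A Ψ i) O := by
  have ht := h.smooth_theta
  have hA := h.smooth_conn
  fin_cases i
  · exact ContDiffOn.const_smul _ ((hA 0 0).sub (hA 1 1))
  · exact hA 0 1
  · exact hA 1 0
  · exact ContDiffOn.const_smul _ ((hA 0 0).sub (hA 1 1))
  · exact ContDiffOn.const_smul _ ((ht 1).sub (ht 2))
  · exact ContDiffOn.const_smul _ ((ht 0).add (ht 3))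
  · exact ContDiffOn.const_smul _ ((hA 0 0).add (hA 1 1))
  · exact ContDiffOn.const_smul _ ((ht 1).add (ht 2))
  · exact ContDiffOn.const_smul _ ((ht 0).sub (ht 3))

theorem gaugeEta_injective (hΨ : Ψ ≠ 0) {q : F}
    (hinj : ∀ v, (∀ a, θ a q v = 0) → (A 0 0 q + A 1 1 q) v = 0 → v = 0) (v : F)
    (hv : ∀ i, gaugeEta θ A Ψ i q v = 0) : v = 0 := by
  have c0 : (4 / (3 * Ψ)) ≠ 0 := by positivity
  have c2 : (-2 / (3 * Ψ)) ≠ 0 := by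
    rw [neg_div]; exact neg_ne_zero.2 (by positivity)
  have h0 := hv 0
  have h1 := hv 1
  have h2 := hv 2
  have h3 := hv 3
  have h4 := hv 4
  simp only [gaugeEta, add_apply, sub_apply,
    smul_apply, smul_eq_mul, mul_eq_zero, c0, c2, false_or] at h0 h1 h2 h3 h4
  refine hinj v (fun a => ?_) h2
  fin_cases a <;> simp <;> linarith

theorem gaugeEta_kernel (hΨ : Ψ ≠ 0) (q v : F) :
    (gaugeEta θ A Ψ 0 q v = 0 ∧ gaugeEta θ A Ψ 1 q v = 0 ∧ gaugeEta θ A Ψ 2 q v = 0) ↔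
      ((θ 0 q + θ 3 q) v = 0 ∧ (θ 1 q - θ 2 q) v = 0 ∧ (A 0 0 q + A 1 1 q) v = 0) := by
  have c0 : (4 / (3 * Ψ)) ≠ 0 := by positivity
  have c2 : (-2 / (3 * Ψ)) ≠ 0 := by
    rw [neg_div]; exact neg_ne_zero.2 (by positivity)
  simp only [gaugeEta, smul_apply, smul_eq_mul, mul_eq_zero, c0, c2, false_or]

/-- The gauge of a para-Kähler–Einstein frame is a local expression of the regular normal Cartan
connection of its plane field `Ker {θ⁰ + θ³, θ¹ - θ², A₀₀ + A₁₁}`: the curvature takes values in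
`sl₂ ⊂ p₁` by `cartanCurvature_gauge`, so it is torsion-free, and it is normal by
`kostantCodifferential_eq_zero`. -/
theorem isCartanGauge [FiniteDimensional ℝ F] (hn : Module.finrank ℝ F = 5)
    (h : IsParaKahlerEinsteinFrame O θ A Ψ) (hO : IsOpen O) (hΨ : Ψ ≠ 0)
    (hinj : ∀ q ∈ O, ∀ v, (∀ a, θ a q v = 0) → (A 0 0 q + A 1 1 q) v = 0 → v = 0)
    {D : F → Submodule ℝ F}
    (hD : ∀ q ∈ O, ∀ v, v ∈ D q ↔
      ((θ 0 q + θ 3 q) v = 0 ∧ (θ 1 q - θ 2 q) v = 0 ∧ (A 0 0 q + A 1 1 q) v = 0)) :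
    IsCartanGauge D O (gaugeEta θ A Ψ) (gaugeZeta θ A Ψ) where
  smooth_eta := h.smooth_gaugeEta
  smooth_zeta := h.smooth_gaugeZeta
  coframe := by
    obtain ⟨X, -, hdual, hexp⟩ := exists_dual_frame hn h.smooth_gaugeEta
      fun q hq => gaugeEta_injective hΨ (hinj q hq)
    intro q hq
    constructor
    · rw [Fintype.linearIndependent_iff]
      intro c hc i
      have := DFunLike.congr_fun hc (X i q)
      simpa [sum_apply, hdual q hq] using this
    · rw [eq_top_iff]
      intro β _
      rw [Submodule.mem_span_range_iff_exists_fun]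
      refine ⟨fun i => β (X i q), ?_⟩
      ext v
      conv_rhs => rw [hexp q hq v]
      simp [mul_comm]
  kernel := fun q hq v => (hD q hq v).trans (gaugeEta_kernel hΨ q v).symm
  torsion_free := by
    intro q hq u v i hi
    obtain ⟨w, hw⟩ := h.cartanCurvature_gauge hO hΨ hq
    rw [hw]
    simp only
    fin_cases i
    · exact absurd rfl hi
    all_goals
      simp only [Fin.mk_one, Fin.reduceFinMk, g2Matrix_row_1, g2Matrix_row_2, g2Matrix_row_3,
        g2Matrix_row_4, g2Matrix_row_5, g2Matrix_row_6, Pi.zero_apply, mul_zero]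
  normal := by
    intro q hq b hb k
    obtain ⟨w, hw⟩ := h.cartanCurvature_gauge hO hΨ hq
    refine kostantCodifferential_eq_zero (3 * Ψ / 8) w _ (fun i j => ?_) k
    have hθ : ∀ i a, θ a q (b i) = dualFrameTheta (3 * Ψ / 8) i a := by
      intro i a
      have h0 := hb 0 i
      have h1 := hb 1 i
      have h3 := hb 3 i
      have h4 := hb 4 i
      simp only [gaugeEta, add_apply, sub_apply,
        smul_apply, smul_eq_mul] at h0 h1 h3 h4
      have hc : (3 * Ψ / 4) * (4 / (3 * Ψ)) = 1 := by field_simp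
      have h0' : θ 0 q (b i) + θ 3 q (b i) = 3 * Ψ / 4 * (if (0 : Fin 5) = i then 1 else 0) := by
        rw [← h0, ← mul_assoc, hc, one_mul]
      have h1' : θ 1 q (b i) - θ 2 q (b i) = 3 * Ψ / 4 * (if (1 : Fin 5) = i then 1 else 0) := by
        rw [← h1, ← mul_assoc, hc, one_mul]
      clear h0 h1
      fin_cases i <;> simp at h0' h1' h3 h4 <;> fin_cases a <;> simp [dualFrameTheta] <;> linarith
    simp only [hw, wedgeOne, hθ]

/-- The torsion-free Cartan structure equations contain those of a (2,3,5)-distribution. -/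
theorem is235On [FiniteDimensional ℝ F] (hn : Module.finrank ℝ F = 5)
    (h : IsParaKahlerEinsteinFrame O θ A Ψ) (hO : IsOpen O) (hΨ : Ψ ≠ 0)
    (hinj : ∀ q ∈ O, ∀ v, (∀ a, θ a q v = 0) → (A 0 0 q + A 1 1 q) v = 0 → v = 0)
    {D : F → Submodule ℝ F}
    (hD : ∀ q ∈ O, ∀ v, v ∈ D q ↔
      ((θ 0 q + θ 3 q) v = 0 ∧ (θ 1 q - θ 2 q) v = 0 ∧ (A 0 0 q + A 1 1 q) v = 0)) :
    Is235On D O := by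
  have hg := h.isCartanGauge hn hO hΨ hinj hD
  have hcurv : ∀ q ∈ O, ∀ u v, extDerivOne (gaugeEta θ A Ψ 0) q u v +
        g2BracketEta (fun i => gaugeEta θ A Ψ i q u) (fun i => gaugeZeta θ A Ψ i q u)
          (fun i => gaugeEta θ A Ψ i q v) (fun i => gaugeZeta θ A Ψ i q v) 0 = 0 ∧
      extDerivOne (gaugeEta θ A Ψ 1) q u v +
        g2BracketEta (fun i => gaugeEta θ A Ψ i q u) (fun i => gaugeZeta θ A Ψ i q u)
          (fun i => gaugeEta θ A Ψ i q v) (fun i => gaugeZeta θ A Ψ i q v) 1 = 0 ∧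
      extDerivOne (gaugeEta θ A Ψ 2) q u v +
        g2BracketEta (fun i => gaugeEta θ A Ψ i q u) (fun i => gaugeZeta θ A Ψ i q u)
          (fun i => gaugeEta θ A Ψ i q v) (fun i => gaugeZeta θ A Ψ i q v) 2 = 0 := by
    intro q hq u v
    have t1 := hg.torsion_free q hq u v 1 (by decide)
    have t2 := hg.torsion_free q hq u v 2 (by decide)
    have t3 := hg.torsion_free q hq u v 3 (by decide)
    simp only [cartanCurvature, cartanForm, g2Matrix_bracket, g2Matrix_add, g2Matrix_row_1,
      g2Matrix_row_2, g2Matrix_row_3, Pi.add_apply] at t1 t2 t3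
    refine ⟨t1, t2, ?_⟩
    have hr : (2 * (1 / √3) : ℝ) ≠ 0 := by positivity
    exact (mul_eq_zero.1 t3).resolve_left hr
  refine is235On_of_structure_equations hn hO hg.smooth_eta
    (fun q hq => gaugeEta_injective hΨ (hinj q hq)) hg.kernel ?_ ?_ ?_
  · intro q hq u v hu0 hu1 hv0 hv1
    have := (hcurv q hq u v).1
    simp only [g2BracketEta, hu0, hu1, hv0, hv1] at this
    linear_combination this
  · intro q hq u v hu0 hu1 hv0 hv1
    have := (hcurv q hq u v).2.1
    simp only [g2BracketEta, hu0, hu1, hv0, hv1] at this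
    linear_combination this
  · intro q hq u v hu hv
    obtain ⟨hu0, hu1, hu2⟩ := (hg.kernel q hq u).1 hu
    obtain ⟨hv0, hv1, hv2⟩ := (hg.kernel q hq v).1 hv
    have := (hcurv q hq u v).2.2
    simp only [g2BracketEta, hu0, hu1, hv0, hv1, hu2, hv2] at this
    linear_combination this

/-- The conformal structure of the gauge in terms of the para-Kähler–Einstein frame. -/
theorem nurowskiForm_gauge (hΨ : Ψ ≠ 0) (q u v : F) :
    nurowskiForm (gaugeEta θ A Ψ) q u v =
      8 / (3 * Ψ) * (symProd (θ 0 q) (θ 2 q) u v + symProd (θ 1 q) (θ 3 q) u v)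
        + 8 / (27 * Ψ ^ 2) * symProd (A 0 0 q + A 1 1 q) (A 0 0 q + A 1 1 q) u v := by
  simp only [nurowskiForm, symProd, gaugeEta, add_apply,
    sub_apply, smul_apply, smul_eq_mul]
  field_simp
  ring

/-- The change of gauge by the diagonal matrix with entries `μ⁻¹, 1, μ, 1`.  It preserves the
structure equations, the components of the anti-self-dual Weyl tensor being rescaled, and it carries
`Ker {θ⁰ + μ θ³, θ¹ - μ θ²}` to `Ker {θ⁰ + θ³, θ¹ - θ²}`. -/
theorem rescale (h : IsParaKahlerEinsteinFrame O θ A Ψ) (hO : IsOpen O) {μ : F → ℝ}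
    (hμ : ContDiffOn ℝ ∞ μ O) (hμ0 : ∀ q ∈ O, μ q ≠ 0) :
    IsParaKahlerEinsteinFrame O
      (fun a => match a with
        | 0 => fun q => (μ q)⁻¹ • θ 0 q
        | 1 => θ 1
        | 2 => fun q => μ q • θ 2 q
        | 3 => θ 3)
      (fun a b => match a, b with
        | 0, 0 => fun q => A 0 0 q + (μ q)⁻¹ • fderiv ℝ μ q
        | 0, 1 => fun q => (μ q)⁻¹ • A 0 1 q
        | 1, 0 => fun q => μ q • A 1 0 q
        | 1, 1 => A 1 1) Ψ := by
  have hμi : ContDiffOn ℝ ∞ (fun q => (μ q)⁻¹) O := hμ.inv hμ0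
  have hdμ : ContDiffOn ℝ ∞ (fderiv ℝ μ) O := hμ.fderiv_of_isOpen hO (by simp)
  have dμ : ∀ q ∈ O, DifferentiableAt ℝ μ q := fun q hq =>
    (hμ.contDiffAt (hO.mem_nhds hq)).differentiableAt (by simp)
  have dμi : ∀ q ∈ O, DifferentiableAt ℝ (fun q => (μ q)⁻¹) q := fun q hq =>
    (hμi.contDiffAt (hO.mem_nhds hq)).differentiableAt (by simp)
  have ddμ : ∀ q ∈ O, DifferentiableAt ℝ (fderiv ℝ μ) q := fun q hq =>
    (hdμ.contDiffAt (hO.mem_nhds hq)).differentiableAt (by simp)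
  have ei : ∀ q ∈ O, fderiv ℝ (fun q => (μ q)⁻¹) q = -((μ q) ^ 2)⁻¹ • fderiv ℝ μ q := by
    intro q hq
    exact (((hasDerivAt_inv (hμ0 q hq)).comp_hasFDerivAt q (dμ q hq).hasFDerivAt)).fderiv
  have edd : ∀ q ∈ O, ∀ u v, extDerivOne (fderiv ℝ μ) q u v = 0 := by
    intro q hq u v
    have := ((hμ.contDiffAt (hO.mem_nhds hq)).isSymmSndFDerivAt (by
      rw [minSmoothness_of_isRCLikeNormedField]; exact WithTop.coe_le_coe.2 le_top)).eq u v
    rw [extDerivOne, this, sub_self]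
  have dθ := fun q hq a => h.differentiableAt_theta hO (q := q) hq a
  have dA := fun q hq a b => h.differentiableAt_conn hO (q := q) hq a b
  refine ⟨?_, ?_, ?_, ?_, ?_, ?_, ?_⟩
  · intro a
    fin_cases a
    exacts [hμi.smul (h.smooth_theta 0), h.smooth_theta 1, hμ.smul (h.smooth_theta 2),
      h.smooth_theta 3]
  · intro a b
    fin_cases a <;> fin_cases b
    exacts [(h.smooth_conn 0 0).add (hμi.smul hdμ), hμi.smul (h.smooth_conn 0 1),
      hμ.smul (h.smooth_conn 1 0), h.smooth_conn 1 1]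
  · intro q hq u v
    have hm := hμ0 q hq
    simp only
    rw [extDerivOne_smul (dμi q hq) (dθ q hq 0), ei q hq, h.d_theta_0 q hq]
    simp only [wedgeOne, add_apply, smul_apply, smul_eq_mul]
    field_simp
    ring
  · intro q hq u v
    have hm := hμ0 q hq
    simp only
    rw [h.d_theta_1 q hq]
    simp only [wedgeOne, smul_apply, smul_eq_mul]
    field_simp
  · intro q hq u v
    have hm := hμ0 q hq
    simp only
    rw [extDerivOne_smul (dμ q hq) (dθ q hq 2), h.d_theta_2 q hq]
    simp only [wedgeOne, add_apply, smul_apply, smul_eq_mul]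
    field_simp
    ring
  · intro q hq u v
    have hm := hμ0 q hq
    simp only
    rw [h.d_theta_3 q hq]
    simp only [wedgeOne, smul_apply, smul_eq_mul]
    field_simp
  · intro q hq
    have hm := hμ0 q hq
    obtain ⟨w, hw⟩ := h.d_conn q hq
    -- the weights with which the diagonal matrix acts on binary quartics
    refine ⟨![w 0, (μ q)⁻¹ * w 1, μ q * w 2, ((μ q) ^ 2)⁻¹ * w 3, (μ q) ^ 2 * w 4],
      fun u v => ?_⟩
    obtain ⟨a00, a01, a10, a11⟩ := hw u v
    simp only [Matrix.cons_val]
    rw [extDerivOne_add (dA q hq 0 0) ((dμi q hq).fun_smul (ddμ q hq)),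
      extDerivOne_smul (dμi q hq) (ddμ q hq), extDerivOne_smul (dμi q hq) (dA q hq 0 1),
      extDerivOne_smul (dμ q hq) (dA q hq 1 0), ei q hq, edd q hq, a00, a01, a10, a11]
    simp only [wedgeOne, add_apply, smul_apply, smul_eq_mul]
    refine ⟨?_, ?_, ?_, ?_⟩ <;>
    · field_simp
      try ring

end IsParaKahlerEinsteinFrame

theorem extDerivOne_comp_fst {G : Type*} [NormedAddCommGroup G] [NormedSpace ℝ G]
    {β : F → F →L[ℝ] ℝ} {q : F × G} (hβ : DifferentiableAt ℝ β q.1) (u v : F × G) :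
    extDerivOne (fun p : F × G => (β p.1).comp (ContinuousLinearMap.fst ℝ F G)) q u v =
      extDerivOne β q.1 u.1 v.1 := by
  have hd : HasFDerivAt (fun p : F × G => (β p.1).comp (ContinuousLinearMap.fst ℝ F G))
      (((ContinuousLinearMap.compL ℝ (F × G) F ℝ).flip (ContinuousLinearMap.fst ℝ F G)).comp
        ((fderiv ℝ β q.1).comp (ContinuousLinearMap.fst ℝ F G))) q :=
    (((ContinuousLinearMap.compL ℝ (F × G) F ℝ).flip
      (ContinuousLinearMap.fst ℝ F G)).hasFDerivAt).comp q (hβ.hasFDerivAt.comp q hasFDerivAt_fst)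
  simp only [extDerivOne, hd.fderiv]
  simp

/-- The structure equations are preserved by the pull-back to a product. -/
theorem IsParaKahlerEinsteinFrame.comp_fst {G : Type*} [NormedAddCommGroup G] [NormedSpace ℝ G]
    (h : IsParaKahlerEinsteinFrame O θ A Ψ) (hO : IsOpen O) {W : Set (F × G)}
    (hW : ∀ q ∈ W, q.1 ∈ O) :
    IsParaKahlerEinsteinFrame W
      (fun a q => (θ a q.1).comp (ContinuousLinearMap.fst ℝ F G))
      (fun a b q => (A a b q.1).comp (ContinuousLinearMap.fst ℝ F G)) Ψ := by
  have hs : ∀ {β : F → F →L[ℝ] ℝ}, ContDiffOn ℝ ∞ β O → ContDiffOn ℝ ∞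
      (fun p : F × G => (β p.1).comp (ContinuousLinearMap.fst ℝ F G)) W := fun hβ =>
    (hβ.comp contDiffOn_fst hW).clm_comp contDiffOn_const
  have dθ := fun q hq a => h.differentiableAt_theta hO (q := q) hq a
  have dA := fun q hq a b => h.differentiableAt_conn hO (q := q) hq a b
  refine ⟨fun a => hs (h.smooth_theta a), fun a b => hs (h.smooth_conn a b), ?_, ?_, ?_, ?_, ?_⟩
  · intro q hq u v
    rw [extDerivOne_comp_fst (dθ _ (hW q hq) 0)]
    exact h.d_theta_0 _ (hW q hq) _ _
  · intro q hq u v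
    rw [extDerivOne_comp_fst (dθ _ (hW q hq) 1)]
    exact h.d_theta_1 _ (hW q hq) _ _
  · intro q hq u v
    rw [extDerivOne_comp_fst (dθ _ (hW q hq) 2)]
    exact h.d_theta_2 _ (hW q hq) _ _
  · intro q hq u v
    rw [extDerivOne_comp_fst (dθ _ (hW q hq) 3)]
    exact h.d_theta_3 _ (hW q hq) _ _
  · intro q hq
    obtain ⟨w, hw⟩ := h.d_conn _ (hW q hq)
    refine ⟨w, fun u v => ?_⟩
    simp only [extDerivOne_comp_fst (dA _ (hW q hq) _ _)]
    exact hw u.1 v.1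

end Gauge

/-! ### Calculus of matrix-valued functions -/

noncomputable section MatrixCalculus

/-- The entrywise derivative at `y`, in the direction `u`, of a matrix-valued function. -/
def dirD (A : E4 → Mat4) (y u : E4) : Mat4 :=
  Matrix.of fun a b => fderiv ℝ (fun z => A z a b) y u

theorem dirD_apply (A : E4 → Mat4) (y u : E4) (a b : Fin 4) :
    dirD A y u a b = fderiv ℝ (fun z => A z a b) y u := rfl

theorem dirD_mul {A B : E4 → Mat4} {y : E4}
    (hA : ∀ i j, DifferentiableAt ℝ (fun z => A z i j) y)
    (hB : ∀ i j, DifferentiableAt ℝ (fun z => B z i j) y) (u : E4) :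
    dirD (fun z => A z * B z) y u = dirD A y u * B y + A y * dirD B y u := by
  ext a b
  simp only [dirD_apply, Matrix.mul_apply, Matrix.add_apply]
  rw [fderiv_fun_sum fun k _ => (hA a k).fun_mul (hB k b)]
  simp only [sum_apply, fderiv_fun_mul (hA _ _) (hB _ _),
    add_apply, smul_apply, smul_eq_mul,
    Finset.sum_add_distrib]
  rw [add_comm]
  congr 1
  exact Finset.sum_congr rfl fun _ _ => mul_comm _ _

theorem dirD_transpose (A : E4 → Mat4) (y u : E4) :
    dirD (fun z => (A z)ᵀ) y u = (dirD A y u)ᵀ := rfl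

theorem dirD_sub {A B : E4 → Mat4} {y : E4}
    (hA : ∀ i j, DifferentiableAt ℝ (fun z => A z i j) y)
    (hB : ∀ i j, DifferentiableAt ℝ (fun z => B z i j) y) (u : E4) :
    dirD (fun z => A z - B z) y u = dirD A y u - dirD B y u := by
  ext a b
  simp only [dirD_apply, Matrix.sub_apply]
  rw [fderiv_fun_sub (hA a b) (hB a b)]
  rfl

theorem dirD_const (A : Mat4) (y u : E4) : dirD (fun _ => A) y u = 0 := by
  ext a b
  simp [dirD_apply]

theorem dirD_congr {A B : E4 → Mat4} {V : Set E4} (hV : IsOpen V) (h : ∀ z ∈ V, A z = B z)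
    {y : E4} (hy : y ∈ V) (u : E4) : dirD A y u = dirD B y u := by
  ext a b
  simp only [dirD_apply]
  rw [Filter.EventuallyEq.fderiv_eq]
  filter_upwards [hV.mem_nhds hy] with z hz
  rw [h z hz]

theorem fderiv_eq_sum_partialD (f : E4 → ℝ) (y u : E4) :
    fderiv ℝ f y u = ∑ i, u i * partialD i f y := by
  conv_lhs => rw [pi_eq_sum_univ' u]
  simp only [map_sum, map_smul, smul_eq_mul, partialD]

section Smooth

variable {E : Type*} [NormedAddCommGroup E] [NormedSpace ℝ E] {V : Set E} {A B : E → Mat4}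

theorem contDiffOn_matrix_mul (hA : ∀ i j, ContDiffOn ℝ ∞ (fun z => A z i j) V)
    (hB : ∀ i j, ContDiffOn ℝ ∞ (fun z => B z i j) V) (i j : Fin 4) :
    ContDiffOn ℝ ∞ (fun z => (A z * B z) i j) V := by
  simp only [Matrix.mul_apply]
  exact ContDiffOn.sum fun k _ => (hA i k).mul (hB k j)

theorem contDiffOn_matrix_det (hA : ∀ i j, ContDiffOn ℝ ∞ (fun z => A z i j) V) :
    ContDiffOn ℝ ∞ (fun z => (A z).det) V := by
  simp only [Matrix.det_apply]
  exact ContDiffOn.sum fun σ _ => (contDiffOn_prod fun i _ => hA _ _).const_smul _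

theorem contDiffOn_matrix_inv (hA : ∀ i j, ContDiffOn ℝ ∞ (fun z => A z i j) V)
    (hdet : ∀ z ∈ V, (A z).det ≠ 0) (i j : Fin 4) :
    ContDiffOn ℝ ∞ (fun z => (A z)⁻¹ i j) V := by
  simp only [Matrix.inv_def, Ring.inverse_eq_inv', Matrix.smul_apply, smul_eq_mul,
    Matrix.adjugate_apply]
  refine ((contDiffOn_matrix_det hA).inv hdet).mul (contDiffOn_matrix_det fun k l => ?_)
  by_cases hk : k = j
  · subst hk
    simp only [Matrix.updateRow_self]
    exact contDiffOn_const
  · simp only [Matrix.updateRow_ne hk]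
    exact hA k l

theorem contDiffOn_partialD {V : Set E4} (hV : IsOpen V) {f : E4 → ℝ} (hf : ContDiffOn ℝ ∞ f V)
    (i : Fin 4) : ContDiffOn ℝ ∞ (partialD i f) V :=
  (hf.fderiv_of_isOpen hV (by simp)).clm_apply contDiffOn_const

end Smooth

end MatrixCalculus

/-! ### The Levi-Civita connection in coordinates -/

noncomputable section LeviCivita

/-- The matrix `(Γᵏ_{ij} uⁱ)_{kj}` of the Levi-Civita connection in the direction `u`. -/
def chrMat (g : E4 → Mat4) (y u : E4) : Mat4 :=
  Matrix.of fun k j => ∑ i, u i * christoffel g y k i j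

/-- The connection matrix in the coframe `θ`, in the direction `u`. -/
def connMat (g θ : E4 → Mat4) (y u : E4) : Mat4 :=
  Matrix.of fun a b => connectionForm g θ a b y u

/-- The curvature operator `R(u, v)`, as a matrix in coordinates. -/
def riemMat (g : E4 → Mat4) (y u v : E4) : Mat4 :=
  Matrix.of fun a b => ∑ c, ∑ d, u c * v d * riemann g y a b c d

theorem connMat_eq (g θ : E4 → Mat4) (y u : E4) :
    connMat g θ y u =
      θ y * (dirD (fun z => (θ z)⁻¹) y u + chrMat g y u * (θ y)⁻¹) := by
  ext a b
  simp only [connMat, connectionForm, Matrix.of_apply, sum_apply,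
    smul_apply, ContinuousLinearMap.proj_apply, smul_eq_mul, Matrix.mul_apply,
    Matrix.add_apply, dirD_apply, chrMat, fderiv_eq_sum_partialD _ y u]
  simp only [Finset.sum_mul, Finset.mul_sum, mul_add, add_mul, Finset.sum_add_distrib]
  congr 1
  · rw [Finset.sum_comm]
    exact Finset.sum_congr rfl fun _ _ => Finset.sum_congr rfl fun _ _ => by ring
  · rw [Finset.sum_comm]
    refine Finset.sum_congr rfl fun _ _ => ?_
    rw [Finset.sum_comm]
    exact Finset.sum_congr rfl fun _ _ => Finset.sum_congr rfl fun _ _ => by ring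

/-- `g` is a smooth pseudo-Riemannian metric on the open set `U`. -/
structure IsMetricOn (U : Set E4) (g : E4 → Mat4) : Prop where
  isOpen : IsOpen U
  smooth : ∀ i j, ContDiffOn ℝ ∞ (fun y => g y i j) U
  symm : ∀ y ∈ U, (g y).IsSymm
  nondegenerate : ∀ y ∈ U, (g y).det ≠ 0

variable {U : Set E4} {g : E4 → Mat4} {y : E4}

namespace IsMetricOn

theorem partialD_symm (h : IsMetricOn U g) (hy : y ∈ U) (l i j : Fin 4) :
    partialD l (fun z => g z i j) y = partialD l (fun z => g z j i) y := by
  rw [partialD, partialD, Filter.EventuallyEq.fderiv_eq]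
  filter_upwards [h.isOpen.mem_nhds hy] with z hz
  exact ((h.symm z hz).apply i j).symm

theorem christoffel_symm (h : IsMetricOn U g) (hy : y ∈ U) (k i j : Fin 4) :
    christoffel g y k i j = christoffel g y k j i := by
  simp only [christoffel]
  congr 1
  refine Finset.sum_congr rfl fun l _ => ?_
  rw [h.partialD_symm hy l i j]
  ring

theorem chrMat_mulVec_comm (h : IsMetricOn U g) (hy : y ∈ U) (u v : E4) :
    chrMat g y u *ᵥ v = chrMat g y v *ᵥ u := by
  ext k
  simp only [Matrix.mulVec, dotProduct, chrMat, Matrix.of_apply, Finset.sum_mul]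
  rw [Finset.sum_comm]
  refine Finset.sum_congr rfl fun i _ => Finset.sum_congr rfl fun j _ => ?_
  rw [h.christoffel_symm hy]
  ring

theorem smooth_christoffel (h : IsMetricOn U g) (k i j : Fin 4) :
    ContDiffOn ℝ ∞ (fun y => christoffel g y k i j) U := by
  simp only [christoffel]
  refine contDiffOn_const.mul (ContDiffOn.sum fun l _ => ?_)
  exact (contDiffOn_matrix_inv h.smooth h.nondegenerate k l).mul
    (((contDiffOn_partialD h.isOpen (h.smooth _ _) _).add
      (contDiffOn_partialD h.isOpen (h.smooth _ _) _)).sub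
      (contDiffOn_partialD h.isOpen (h.smooth _ _) _))

theorem smooth_chrMat (h : IsMetricOn U g) (u : E4) (k j : Fin 4) :
    ContDiffOn ℝ ∞ (fun y => chrMat g y u k j) U := by
  simp only [chrMat, Matrix.of_apply]
  exact ContDiffOn.sum fun i _ => contDiffOn_const.mul (h.smooth_christoffel _ _ _)

theorem smooth_riemann (h : IsMetricOn U g) (a b c d : Fin 4) :
    ContDiffOn ℝ ∞ (fun y => riemann g y a b c d) U := by
  simp only [riemann]
  refine ((contDiffOn_partialD h.isOpen (h.smooth_christoffel _ _ _) _).sub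
    (contDiffOn_partialD h.isOpen (h.smooth_christoffel _ _ _) _)).add
    (ContDiffOn.sum fun m _ => ?_)
  exact ((h.smooth_christoffel _ _ _).mul (h.smooth_christoffel _ _ _)).sub
    ((h.smooth_christoffel _ _ _).mul (h.smooth_christoffel _ _ _))

theorem smooth_scalarCurv (h : IsMetricOn U g) : ContDiffOn ℝ ∞ (scalarCurv g) U := by
  have : scalarCurv g = fun y => ∑ a, ∑ b, (g y)⁻¹ a b * ricci g y a b := rfl
  rw [this]
  refine ContDiffOn.sum fun a _ => ContDiffOn.sum fun b _ => ?_
  refine (contDiffOn_matrix_inv h.smooth h.nondegenerate a b).mul ?_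
  exact ContDiffOn.sum fun c _ => h.smooth_riemann _ _ _ _

/-- The Levi-Civita connection preserves the metric. -/
theorem dirD_metric (h : IsMetricOn U g) (hy : y ∈ U) (u : E4) :
    dirD g y u = (chrMat g y u)ᵀ * g y + g y * chrMat g y u := by
  have hgi : g y * (g y)⁻¹ = 1 := Matrix.mul_nonsing_inv _ (Ne.isUnit (h.nondegenerate y hy))
  -- lowering the upper index of the Christoffel symbols
  have low : ∀ a i j, ∑ m, g y a m * christoffel g y m i j = (1 / 2) *
      (partialD i (fun z => g z j a) y + partialD j (fun z => g z i a) y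
        - partialD a (fun z => g z i j) y) := by
    intro a i j
    simp only [christoffel, Finset.mul_sum]
    rw [Finset.sum_comm]
    have : ∀ l, ∑ m, g y a m * (1 / 2 * ((g y)⁻¹ m l *
        (partialD i (fun z => g z j l) y + partialD j (fun z => g z i l) y
          - partialD l (fun z => g z i j) y))) = (1 : Mat4) a l * (1 / 2 *
        (partialD i (fun z => g z j l) y + partialD j (fun z => g z i l) y
          - partialD l (fun z => g z i j) y)) := by
      intro l
      rw [← hgi, Matrix.mul_apply, Finset.sum_mul]
      exact Finset.sum_congr rfl fun _ _ => by ring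
    simp only [this, Matrix.one_apply, ite_mul, one_mul, zero_mul, Finset.sum_ite_eq,
      Finset.mem_univ, if_true]
  have low' : ∀ a j, (g y * chrMat g y u) a j = ∑ i, u i * ((1 / 2) *
      (partialD i (fun z => g z j a) y + partialD j (fun z => g z i a) y
        - partialD a (fun z => g z i j) y)) := by
    intro a j
    simp only [Matrix.mul_apply, chrMat, Matrix.of_apply, Finset.mul_sum, ← low]
    rw [Finset.sum_comm]
    exact Finset.sum_congr rfl fun _ _ => Finset.sum_congr rfl fun _ _ => by ring
  have htr : (chrMat g y u)ᵀ * g y = (g y * chrMat g y u)ᵀ := by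
    rw [Matrix.transpose_mul, (h.symm y hy).eq]
  ext a b
  rw [htr, Matrix.add_apply, Matrix.transpose_apply, low', low', dirD_apply,
    fderiv_eq_sum_partialD, ← Finset.sum_add_distrib]
  refine Finset.sum_congr rfl fun i _ => ?_
  rw [h.partialD_symm hy b i a, h.partialD_symm hy a i b, h.partialD_symm hy i b a]
  ring

/-- The curvature is `dΓ + Γ ∧ Γ`, evaluated on constant vector fields. -/
theorem riemMat_eq (h : IsMetricOn U g) (hy : y ∈ U) (u v : E4) :
    riemMat g y u v = dirD (fun z => chrMat g z v) y u - dirD (fun z => chrMat g z u) y v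
      + (chrMat g y u * chrMat g y v - chrMat g y v * chrMat g y u) := by
  have hd : ∀ k i j, DifferentiableAt ℝ (fun z => christoffel g z k i j) y := fun k i j =>
    ((h.smooth_christoffel k i j).contDiffAt (h.isOpen.mem_nhds hy)).differentiableAt (by simp)
  have e : ∀ (v w : E4) (a b : Fin 4), dirD (fun z => chrMat g z v) y w a b =
      ∑ c, ∑ d, w c * v d * partialD c (fun z => christoffel g z a d b) y := by
    intro v w a b
    simp only [dirD_apply, chrMat, Matrix.of_apply]
    rw [fderiv_fun_sum fun i _ => (hd a i b).const_mul (v i)]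
    simp only [sum_apply, fderiv_const_mul (hd _ _ _),
      smul_apply, smul_eq_mul, fderiv_eq_sum_partialD _ y w, Finset.mul_sum]
    rw [Finset.sum_comm]
    exact Finset.sum_congr rfl fun _ _ => Finset.sum_congr rfl fun _ _ => by ring
  have e2 : ∀ (v w : E4) (a b : Fin 4), (chrMat g y v * chrMat g y w) a b =
      ∑ c, ∑ d, v c * w d * ∑ m, christoffel g y a c m * christoffel g y m d b := by
    intro v w a b
    simp only [Matrix.mul_apply, chrMat, Matrix.of_apply, Finset.mul_sum, Finset.sum_mul]
    rw [Finset.sum_comm]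
    conv_rhs => rw [Finset.sum_comm]
    refine Finset.sum_congr rfl fun c _ => ?_
    rw [Finset.sum_comm]
    refine Finset.sum_congr rfl fun d _ => Finset.sum_congr rfl fun m _ => by ring
  ext a b
  simp only [Matrix.add_apply, Matrix.sub_apply, e, e2, riemMat, Matrix.of_apply, riemann]
  rw [Finset.sum_comm (f := fun c d => v c * u d * partialD c (fun z => christoffel g z a d b) y),
    Finset.sum_comm (f := fun c d => v c * u d *
      ∑ m, christoffel g y a c m * christoffel g y m d b)]
  simp only [← Finset.sum_sub_distrib, ← Finset.sum_add_distrib]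
  refine Finset.sum_congr rfl fun c _ => Finset.sum_congr rfl fun d _ => ?_
  simp only [Finset.sum_sub_distrib]
  ring

/-- The algebraic Bianchi identity. -/
theorem bianchi (h : IsMetricOn U g) (hy : y ∈ U) (u v w : E4) :
    riemMat g y u v *ᵥ w + riemMat g y v w *ᵥ u + riemMat g y w u *ᵥ v = 0 := by
  have hs : ∀ u v w, dirD (fun z => chrMat g z v) y u *ᵥ w =
      dirD (fun z => chrMat g z w) y u *ᵥ v := by
    intro u v w
    have hd : ∀ (v : E4) (i j), DifferentiableAt ℝ (fun z => chrMat g z v i j) y := fun v i j =>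
      ((h.smooth_chrMat v i j).contDiffAt (h.isOpen.mem_nhds hy)).differentiableAt (by simp)
    ext k
    have e : ∀ v w, (dirD (fun z => chrMat g z v) y u *ᵥ w) k =
        fderiv ℝ (fun z => (chrMat g z v *ᵥ w) k) y u := by
      intro v w
      simp only [Matrix.mulVec, dotProduct, dirD_apply]
      rw [fderiv_fun_sum fun i _ => (hd v k i).mul_const (w i)]
      simp only [sum_apply, fderiv_mul_const (hd _ _ _),
        smul_apply, smul_eq_mul]
      exact Finset.sum_congr rfl fun _ _ => mul_comm _ _
    rw [e, e, Filter.EventuallyEq.fderiv_eq]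
    filter_upwards [h.isOpen.mem_nhds hy] with z hz
    rw [h.chrMat_mulVec_comm hz]
  have hq : ∀ u v w, (chrMat g y u * chrMat g y v) *ᵥ w = (chrMat g y u * chrMat g y w) *ᵥ v := by
    intro u v w
    rw [← Matrix.mulVec_mulVec, ← Matrix.mulVec_mulVec, h.chrMat_mulVec_comm hy v w]
  simp only [h.riemMat_eq hy, Matrix.add_mulVec, Matrix.sub_mulVec]
  rw [hs u w v, hs v u w, hs w v u, hq u w v, hq v u w, hq w v u]
  abel

end IsMetricOn

end LeviCivita

/-! ### The connection of a para-Kähler metric in an adapted coframe -/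

noncomputable section AdaptedCoframe

theorem IsParaKahlerOn.isMetricOn {U : Set E4} {g K : E4 → Mat4} (h : IsParaKahlerOn U g K)
    (hU : IsOpen U) : IsMetricOn U g :=
  ⟨hU, h.smooth_metric, h.symm, h.nondegenerate⟩

theorem IsParaKahlerOn.mono {U V : Set E4} {g K : E4 → Mat4} (h : IsParaKahlerOn U g K)
    (hVU : V ⊆ U) : IsParaKahlerOn V g K where
  smooth_metric := fun i j => (h.smooth_metric i j).mono hVU
  smooth_K := fun i j => (h.smooth_K i j).mono hVU
  symm := fun y hy => h.symm y (hVU hy)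
  nondegenerate := fun y hy => h.nondegenerate y (hVU hy)
  paracomplex := fun y hy => h.paracomplex y (hVU hy)
  rank_plus := fun y hy => h.rank_plus y (hVU hy)
  rank_minus := fun y hy => h.rank_minus y (hVU hy)
  compatible := fun y hy => h.compatible y (hVU hy)
  integrable_plus := fun y hy => h.integrable_plus y (hVU hy)
  integrable_minus := fun y hy => h.integrable_minus y (hVU hy)
  closed := fun y hy => h.closed y (hVU hy)

/-- The closedness of `ρ`, contracted with three vectors. -/
theorem IsParaKahlerOn.dirD_kahlerForm_cyclic {V : Set E4} {g K : E4 → Mat4}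
    (hK : IsParaKahlerOn V g K) {y : E4} (hy : y ∈ V) (u v w : E4) :
    v ⬝ᵥ dirD (kahlerForm g K) y u *ᵥ w + w ⬝ᵥ dirD (kahlerForm g K) y v *ᵥ u
      + u ⬝ᵥ dirD (kahlerForm g K) y w *ᵥ v = 0 := by
  have e : ∀ u v w : E4, v ⬝ᵥ dirD (kahlerForm g K) y u *ᵥ w =
      ∑ i, ∑ j, ∑ k, u i * v j * w k * partialD i (fun z => kahlerForm g K z j k) y := by
    intro u v w
    simp only [Matrix.mulVec, dotProduct, dirD_apply, fderiv_eq_sum_partialD _ y u]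
    conv_rhs => rw [Finset.sum_comm]
    refine Finset.sum_congr rfl fun j _ => ?_
    conv_rhs => rw [Finset.sum_comm]
    rw [Finset.mul_sum]
    refine Finset.sum_congr rfl fun k _ => ?_
    rw [Finset.sum_mul, Finset.mul_sum]
    exact Finset.sum_congr rfl fun _ _ => by ring
  rw [e u v w, e v w u, e w u v]
  have r1 : ∑ i, ∑ j, ∑ k, v i * w j * u k * partialD i (fun z => kahlerForm g K z j k) y =
      ∑ i, ∑ j, ∑ k, u i * v j * w k * partialD j (fun z => kahlerForm g K z k i) y := by
    calc _ = ∑ i, ∑ k, ∑ j, v i * w j * u k * partialD i (fun z => kahlerForm g K z j k) y :=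
          Finset.sum_congr rfl fun _ _ => Finset.sum_comm
      _ = ∑ k, ∑ i, ∑ j, v i * w j * u k * partialD i (fun z => kahlerForm g K z j k) y :=
          Finset.sum_comm
      _ = _ := Finset.sum_congr rfl fun _ _ => Finset.sum_congr rfl fun _ _ =>
          Finset.sum_congr rfl fun _ _ => by ring
  have r2 : ∑ i, ∑ j, ∑ k, w i * u j * v k * partialD i (fun z => kahlerForm g K z j k) y =
      ∑ i, ∑ j, ∑ k, u i * v j * w k * partialD k (fun z => kahlerForm g K z i j) y := by
    calc _ = ∑ j, ∑ i, ∑ k, w i * u j * v k * partialD i (fun z => kahlerForm g K z j k) y :=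
          Finset.sum_comm
      _ = ∑ j, ∑ k, ∑ i, w i * u j * v k * partialD i (fun z => kahlerForm g K z j k) y :=
          Finset.sum_congr rfl fun _ _ => Finset.sum_comm
      _ = _ := Finset.sum_congr rfl fun _ _ => Finset.sum_congr rfl fun _ _ =>
          Finset.sum_congr rfl fun _ _ => by ring
  rw [r1, r2]
  simp only [← Finset.sum_add_distrib]
  refine Finset.sum_eq_zero fun i _ => Finset.sum_eq_zero fun j _ => Finset.sum_eq_zero
    fun k _ => ?_
  have := hK.closed y hy i j k
  linear_combination (u i * v j * w k) * this

/-- The matrix of `K` in an adapted frame. -/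
def signMat : Mat4 := Matrix.diagonal ![1, 1, -1, -1]

/-- The `c`-th vector of the frame dual to `θ`. -/
def frameVec (θ : E4 → Mat4) (c : Fin 4) (y : E4) : E4 := fun i => (θ y)⁻¹ i c

theorem coframeForm_apply (θ : E4 → Mat4) (a : Fin 4) (y u : E4) :
    coframeForm θ a y u = (θ y *ᵥ u) a := by
  simp [coframeForm, Matrix.mulVec, dotProduct]

variable {V : Set E4} {g K θ : E4 → Mat4} {y : E4}

namespace IsAdaptedCoframe

theorem mul_inv (h : IsAdaptedCoframe V g K θ) (hy : y ∈ V) : θ y * (θ y)⁻¹ = 1 :=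
  Matrix.mul_nonsing_inv _ (Ne.isUnit (h.coframe y hy))

theorem inv_mul (h : IsAdaptedCoframe V g K θ) (hy : y ∈ V) : (θ y)⁻¹ * θ y = 1 :=
  Matrix.nonsing_inv_mul _ (Ne.isUnit (h.coframe y hy))

theorem coframeForm_frameVec (h : IsAdaptedCoframe V g K θ) (hy : y ∈ V) (a c : Fin 4) :
    coframeForm θ a y (frameVec θ c y) = if a = c then 1 else 0 := by
  have := congrFun (congrFun (h.mul_inv hy) a) c
  rw [coframeForm_apply]
  rw [Matrix.mul_apply, Matrix.one_apply] at this
  exact this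

theorem mulVec_frameVec (h : IsAdaptedCoframe V g K θ) (hy : y ∈ V) (c : Fin 4) :
    θ y *ᵥ frameVec θ c y = Pi.single c 1 := by
  ext a
  rw [← coframeForm_apply, h.coframeForm_frameVec hy, Pi.single_apply]

theorem eq_sum_frameVec (h : IsAdaptedCoframe V g K θ) (hy : y ∈ V) (u : E4) :
    u = ∑ c, coframeForm θ c y u • frameVec θ c y := by
  have h1 : (θ y)⁻¹ *ᵥ (θ y *ᵥ u) = u := by
    rw [Matrix.mulVec_mulVec, h.inv_mul hy, Matrix.one_mulVec]
  conv_lhs => rw [← h1]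
  ext i
  simp only [Matrix.mulVec, dotProduct, Finset.sum_apply, Pi.smul_apply, smul_eq_mul, frameVec,
    coframeForm_apply]
  exact Finset.sum_congr rfl fun _ _ => mul_comm _ _

theorem smooth_inv (h : IsAdaptedCoframe V g K θ) (i j : Fin 4) :
    ContDiffOn ℝ ∞ (fun z => (θ z)⁻¹ i j) V := contDiffOn_matrix_inv h.smooth h.coframe i j

theorem smooth_frameVec (h : IsAdaptedCoframe V g K θ) (c : Fin 4) :
    ContDiffOn ℝ ∞ (frameVec θ c) V := contDiffOn_pi.2 fun i => h.smooth_inv i c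

theorem smooth_coframeForm (h : IsAdaptedCoframe V g K θ) (a : Fin 4) :
    ContDiffOn ℝ ∞ (coframeForm θ a) V :=
  ContDiffOn.sum fun i _ => (h.smooth a i).smul contDiffOn_const

theorem smooth_connectionForm (h : IsAdaptedCoframe V g K θ) (hg : IsMetricOn V g) (a b : Fin 4) :
    ContDiffOn ℝ ∞ (connectionForm g θ a b) V :=
  ContDiffOn.sum fun i _ => ContDiffOn.smul (ContDiffOn.sum fun k _ => (h.smooth a k).mul
    ((contDiffOn_partialD hg.isOpen (h.smooth_inv k b) i).add
      (ContDiffOn.sum fun j _ => (hg.smooth_christoffel k i j).mul (h.smooth_inv j b))))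
    contDiffOn_const

theorem differentiableAt (h : IsAdaptedCoframe V g K θ) (hV : IsOpen V) (hy : y ∈ V) (i j : Fin 4) :
    DifferentiableAt ℝ (fun z => θ z i j) y :=
  ((h.smooth i j).contDiffAt (hV.mem_nhds hy)).differentiableAt (by simp)

theorem differentiableAt_inv (h : IsAdaptedCoframe V g K θ) (hV : IsOpen V) (hy : y ∈ V)
    (i j : Fin 4) : DifferentiableAt ℝ (fun z => (θ z)⁻¹ i j) y :=
  ((h.smooth_inv i j).contDiffAt (hV.mem_nhds hy)).differentiableAt (by simp)

theorem differentiableAt_coframeForm (h : IsAdaptedCoframe V g K θ) (hV : IsOpen V) (hy : y ∈ V)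
    (a : Fin 4) : DifferentiableAt ℝ (coframeForm θ a) y :=
  ((h.smooth_coframeForm a).contDiffAt (hV.mem_nhds hy)).differentiableAt (by simp)

theorem differentiableAt_connectionForm (h : IsAdaptedCoframe V g K θ) (hg : IsMetricOn V g)
    (hy : y ∈ V) (a b : Fin 4) : DifferentiableAt ℝ (connectionForm g θ a b) y :=
  ((h.smooth_connectionForm hg a b).contDiffAt (hg.isOpen.mem_nhds hy)).differentiableAt (by simp)

/-- The covariant derivative of the coframe. -/
theorem dirD_coframe (h : IsAdaptedCoframe V g K θ) (hV : IsOpen V) (hy : y ∈ V) (u : E4) :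
    dirD θ y u = θ y * chrMat g y u - connMat g θ y u * θ y := by
  have h0 : dirD θ y u * (θ y)⁻¹ + θ y * dirD (fun z => (θ z)⁻¹) y u = 0 := by
    rw [← dirD_mul (h.differentiableAt hV hy) (h.differentiableAt_inv hV hy),
      dirD_congr hV (fun z hz => h.mul_inv hz) hy, dirD_const]
  have h1 : dirD θ y u * (θ y)⁻¹ * θ y = dirD θ y u := by
    rw [Matrix.mul_assoc, h.inv_mul hy, Matrix.mul_one]
  rw [← h1, eq_neg_of_add_eq_zero_left h0, connMat_eq, Matrix.mul_add, Matrix.add_mul,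
    ← Matrix.mul_assoc (θ y) (chrMat g y u), Matrix.mul_assoc (θ y * chrMat g y u), h.inv_mul hy,
    Matrix.mul_one, Matrix.neg_mul]
  abel

theorem fderiv_coframeForm (h : IsAdaptedCoframe V g K θ) (hV : IsOpen V) (hy : y ∈ V)
    (a : Fin 4) (u v : E4) :
    fderiv ℝ (coframeForm θ a) y u v = (dirD θ y u *ᵥ v) a := by
  have hd : HasFDerivAt (coframeForm θ a)
      (∑ i, (fderiv ℝ (fun z => θ z a i) y).smulRight (ContinuousLinearMap.proj i : E4 →L[ℝ] ℝ)) y :=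
    HasFDerivAt.fun_sum fun i _ => (h.differentiableAt hV hy a i).hasFDerivAt.smul_const
      (ContinuousLinearMap.proj i : E4 →L[ℝ] ℝ)
  rw [hd.fderiv]
  simp only [sum_apply, ContinuousLinearMap.smulRight_apply,
    smul_apply,
    ContinuousLinearMap.proj_apply, smul_eq_mul, Matrix.mulVec, dotProduct, dirD_apply]

/-- The first structure equation. -/
theorem extDerivOne_coframeForm (h : IsAdaptedCoframe V g K θ) (hg : IsMetricOn V g) (hy : y ∈ V)
    (a : Fin 4) (u v : E4) :
    extDerivOne (coframeForm θ a) y u v =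
      -∑ b, wedgeOne (connectionForm g θ a b y) (coframeForm θ b y) u v := by
  have e : ∀ u v, ((connMat g θ y u * θ y) *ᵥ v) a =
      ∑ b, connectionForm g θ a b y u * coframeForm θ b y v := by
    intro u v
    rw [← Matrix.mulVec_mulVec]
    simp only [Matrix.mulVec, dotProduct, connMat, Matrix.of_apply, coframeForm_apply]
  have e2 : (θ y * chrMat g y u) *ᵥ v = (θ y * chrMat g y v) *ᵥ u := by
    rw [← Matrix.mulVec_mulVec, ← Matrix.mulVec_mulVec, hg.chrMat_mulVec_comm hy]
  rw [extDerivOne, h.fderiv_coframeForm hg.isOpen hy, h.fderiv_coframeForm hg.isOpen hy,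
    h.dirD_coframe hg.isOpen hy, h.dirD_coframe hg.isOpen hy, Matrix.sub_mulVec, Matrix.sub_mulVec,
    e2, Pi.sub_apply, Pi.sub_apply, e, e]
  simp only [wedgeOne, Finset.sum_sub_distrib]
  ring

theorem skew (h : IsAdaptedCoframe V g K θ) (hg : IsMetricOn V g) (hy : y ∈ V) (u : E4) :
    (connMat g θ y u)ᵀ * nullForm + nullForm * connMat g θ y u = 0 := by
  have hV := hg.isOpen
  have hd := h.differentiableAt hV hy
  have hn : ∀ i j, DifferentiableAt ℝ (fun _ : E4 => nullForm i j) y := fun i j =>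
    differentiableAt_const _
  have hdt : ∀ i j, DifferentiableAt ℝ (fun z => (θ z)ᵀ i j) y := fun i j => hd j i
  have hdm : ∀ i j, DifferentiableAt ℝ (fun z => ((θ z)ᵀ * nullForm) i j) y := fun i j => by
    simp only [Matrix.mul_apply]
    exact DifferentiableAt.fun_sum fun k _ => (hdt i k).mul_const _
  have h1 := hg.dirD_metric hy u
  rw [dirD_congr hV h.metric hy, dirD_mul hdm hd, dirD_mul (B := fun _ => nullForm) hdt hn,
    dirD_transpose, dirD_const, h.dirD_coframe hV hy, h.metric y hy] at h1
  set C := chrMat g y u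
  set G := connMat g θ y u
  have h2 : (θ y)ᵀ * (Gᵀ * nullForm + nullForm * G) * θ y = 0 := by
    rw [← sub_eq_zero] at h1
    rw [← neg_eq_zero, ← h1, Matrix.transpose_sub, Matrix.transpose_mul, Matrix.transpose_mul]
    noncomm_ring
  have h3 : ((θ y)⁻¹)ᵀ * ((θ y)ᵀ * (Gᵀ * nullForm + nullForm * G) * θ y) * (θ y)⁻¹ = 0 := by
    rw [h2]; simp
  have ht : ((θ y)⁻¹)ᵀ * (θ y)ᵀ = 1 := by
    rw [← Matrix.transpose_mul, h.mul_inv hy, Matrix.transpose_one]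
  calc _ = (((θ y)⁻¹)ᵀ * (θ y)ᵀ) * (Gᵀ * nullForm + nullForm * G) * (θ y * (θ y)⁻¹) := by
          rw [ht, h.mul_inv hy, Matrix.one_mul, Matrix.mul_one]
    _ = 0 := by rw [← h3]; simp only [Matrix.mul_assoc]

theorem kahlerForm_eq (h : IsAdaptedCoframe V g K θ) (hy : y ∈ V) :
    kahlerForm g K y = (θ y)ᵀ * (signMat * nullForm) * θ y := by
  rw [kahlerForm, h.metric y hy]
  have : (K y)ᵀ * (θ y)ᵀ = (θ y)ᵀ * signMat := by
    rw [← Matrix.transpose_mul, h.paracomplex y hy, Matrix.transpose_mul, signMat,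
      Matrix.diagonal_transpose]
  simp only [← Matrix.mul_assoc, this]

/-- The identity `dρ = 0` in terms of the connection matrix. -/
theorem closed_frame (h : IsAdaptedCoframe V g K θ) (hK : IsParaKahlerOn V g K)
    (hV : IsOpen V) (hy : y ∈ V) (u v w : E4) :
    let N := fun u => (connMat g θ y u)ᵀ * (signMat * nullForm)
      + signMat * nullForm * connMat g θ y u
    (θ y *ᵥ v) ⬝ᵥ N u *ᵥ (θ y *ᵥ w) + (θ y *ᵥ w) ⬝ᵥ N v *ᵥ (θ y *ᵥ u)
      + (θ y *ᵥ u) ⬝ᵥ N w *ᵥ (θ y *ᵥ v) = 0 := by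
  intro N
  have hg := hK.isMetricOn hV
  have hd := h.differentiableAt hV hy
  have hdt : ∀ i j, DifferentiableAt ℝ (fun z => (θ z)ᵀ i j) y := fun i j => hd j i
  have hn : ∀ i j, DifferentiableAt ℝ (fun _ : E4 => (signMat * nullForm) i j) y := fun i j =>
    differentiableAt_const _
  have hdm : ∀ i j, DifferentiableAt ℝ (fun z => ((θ z)ᵀ * (signMat * nullForm)) i j) y :=
    fun i j => by
      simp only [Matrix.mul_apply (M := (θ _)ᵀ)]
      exact DifferentiableAt.fun_sum fun k _ => (hdt i k).mul_const _
  set S := signMat * nullForm with hS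
  have hSt : Sᵀ = -S := by
    rw [hS, signMat, nullForm]
    ext i j
    fin_cases i <;> fin_cases j <;> simp [Matrix.mul_apply, Fin.sum_univ_four]
  set C := chrMat g y
  set G := connMat g θ y
  -- the derivative of `ρ`
  have hρ : ∀ u, dirD (kahlerForm g K) y u =
      (C u)ᵀ * kahlerForm g K y + kahlerForm g K y * C u - (θ y)ᵀ * N u * θ y := by
    intro u
    rw [dirD_congr hV (fun z hz => h.kahlerForm_eq hz) hy, dirD_mul hdm hd,
      dirD_mul (B := fun _ => S) hdt hn, dirD_transpose, dirD_const, h.dirD_coframe hV hy,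
      h.kahlerForm_eq hy, Matrix.transpose_sub, Matrix.transpose_mul, Matrix.transpose_mul]
    simp only [N, C, hS]
    noncomm_ring
  have hskew : ∀ a b : E4, a ⬝ᵥ kahlerForm g K y *ᵥ b = -(b ⬝ᵥ kahlerForm g K y *ᵥ a) := by
    intro a b
    have ht : (kahlerForm g K y)ᵀ = -kahlerForm g K y := by
      rw [h.kahlerForm_eq hy, Matrix.transpose_mul, Matrix.transpose_mul, Matrix.transpose_transpose,
        ← hS, hSt]
      simp [Matrix.mul_assoc]
    rw [Matrix.dotProduct_mulVec, ← Matrix.mulVec_transpose, ht, Matrix.neg_mulVec,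
      neg_dotProduct, dotProduct_comm]
  have hcl := hK.dirD_kahlerForm_cyclic hy u v w
  have hN : ∀ u v w, v ⬝ᵥ ((θ y)ᵀ * N u * θ y) *ᵥ w = (θ y *ᵥ v) ⬝ᵥ N u *ᵥ (θ y *ᵥ w) := by
    intro u v w
    rw [Matrix.mul_assoc, ← Matrix.mulVec_mulVec, ← Matrix.mulVec_mulVec,
      Matrix.dotProduct_mulVec v, Matrix.vecMul_transpose]
  have hCt : ∀ (M : Mat4) (a b : E4), a ⬝ᵥ (Mᵀ * kahlerForm g K y) *ᵥ b =
      (M *ᵥ a) ⬝ᵥ kahlerForm g K y *ᵥ b := by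
    intro M a b
    rw [← Matrix.mulVec_mulVec, Matrix.dotProduct_mulVec a, Matrix.vecMul_transpose]
  simp only [hρ, Matrix.sub_mulVec, Matrix.add_mulVec, dotProduct_sub, dotProduct_add, hN, hCt,
    ← Matrix.mulVec_mulVec (M := kahlerForm g K y)] at hcl
  have c1 : C u *ᵥ v = C v *ᵥ u := hg.chrMat_mulVec_comm hy u v
  have c2 : C v *ᵥ w = C w *ᵥ v := hg.chrMat_mulVec_comm hy v w
  have c3 : C w *ᵥ u = C u *ᵥ w := hg.chrMat_mulVec_comm hy w u
  rw [c1, c2, c3, hskew v, hskew w, hskew u] at hcl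
  linarith

end IsAdaptedCoframe

end AdaptedCoframe

noncomputable section AdaptedCoframe

variable {V : Set E4} {g K θ : E4 → Mat4} {y : E4}

namespace IsAdaptedCoframe

/-- The connection matrix is skew with respect to `nullForm`, entry by entry. -/
theorem conn_skew (h : IsAdaptedCoframe V g K θ) (hg : IsMetricOn V g) (hy : y ∈ V) (u : E4) :
    connectionForm g θ 0 2 y u = 0 ∧ connectionForm g θ 1 3 y u = 0 ∧
    connectionForm g θ 2 0 y u = 0 ∧ connectionForm g θ 3 1 y u = 0 ∧
    connectionForm g θ 1 2 y u = -connectionForm g θ 0 3 y u ∧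
    connectionForm g θ 3 0 y u = -connectionForm g θ 2 1 y u ∧
    connectionForm g θ 2 2 y u = -connectionForm g θ 0 0 y u ∧
    connectionForm g θ 2 3 y u = -connectionForm g θ 1 0 y u ∧
    connectionForm g θ 3 2 y u = -connectionForm g θ 0 1 y u ∧
    connectionForm g θ 3 3 y u = -connectionForm g θ 1 1 y u := by
  have hs : ∀ i j, ((connMat g θ y u)ᵀ * nullForm + nullForm * connMat g θ y u) i j = 0 := by
    intro i j; rw [h.skew hg hy]; rfl
  have hG : ∀ G : Mat4, (∀ i j, (Gᵀ * nullForm + nullForm * G) i j = 0) →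
      G 0 2 = 0 ∧ G 1 3 = 0 ∧ G 2 0 = 0 ∧ G 3 1 = 0 ∧ G 1 2 = -G 0 3 ∧ G 3 0 = -G 2 1 ∧
      G 2 2 = -G 0 0 ∧ G 2 3 = -G 1 0 ∧ G 3 2 = -G 0 1 ∧ G 3 3 = -G 1 1 := by
    intro G hs
    simp only [Matrix.add_apply, Matrix.mul_apply, Matrix.transpose_apply, Fin.sum_univ_four] at hs
    have h22 := hs 2 2
    have h33 := hs 3 3
    have h00 := hs 0 0
    have h11 := hs 1 1
    have h32 := hs 2 3
    have h01 := hs 0 1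
    have h02 := hs 0 2
    have h03 := hs 0 3
    have h12 := hs 1 2
    have h13 := hs 1 3
    simp [nullForm] at h22 h33 h00 h11 h32 h01 h02 h03 h12 h13
    refine ⟨?_, ?_, ?_, ?_, ?_, ?_, ?_, ?_, ?_, ?_⟩ <;> linarith
  exact hG _ hs

theorem mulVec_frameVec_K (h : IsAdaptedCoframe V g K θ) (hy : y ∈ V) (c : Fin 4) :
    K y *ᵥ frameVec θ c y = (![1, 1, -1, -1] : Fin 4 → ℝ) c • frameVec θ c y := by
  have h1 : K y * (θ y)⁻¹ = (θ y)⁻¹ * signMat := by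
    calc K y * (θ y)⁻¹ = (θ y)⁻¹ * (θ y * K y) * (θ y)⁻¹ := by
          rw [← Matrix.mul_assoc, h.inv_mul hy, Matrix.one_mul]
      _ = _ := by
          rw [h.paracomplex y hy, ← signMat, Matrix.mul_assoc, Matrix.mul_assoc, h.mul_inv hy,
            Matrix.mul_one]
  ext i
  have := congrFun (congrFun h1 i) c
  rw [signMat, Matrix.mul_diagonal] at this
  simp only [Matrix.mul_apply] at this
  simp only [Matrix.mulVec, dotProduct, frameVec, Pi.smul_apply, smul_eq_mul]
  rw [this, mul_comm]

theorem frameVec_mem_eigenPlane (h : IsAdaptedCoframe V g K θ) (hy : y ∈ V) (c : Fin 4) {ε : ℝ}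
    (hε : ε * ε = 1) (hc : (![1, 1, -1, -1] : Fin 4 → ℝ) c = ε) :
    frameVec θ c y ∈ eigenPlane ε K y := by
  refine ⟨(ε / 2) • frameVec θ c y, ?_⟩
  rw [Matrix.toLin'_apply, Matrix.add_mulVec, Matrix.mulVec_smul, h.mulVec_frameVec_K hy, hc,
    Matrix.smul_mulVec, Matrix.one_mulVec, smul_smul, smul_smul, ← add_smul]
  rw [show ε / 2 * ε + ε * (ε / 2) = ε * ε by ring, hε, one_smul]

theorem coframeForm_eq_zero_of_mem_eigenPlane (h : IsAdaptedCoframe V g K θ) (hy : y ∈ V)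
    (c : Fin 4) {ε : ℝ} (hc : (![1, 1, -1, -1] : Fin 4 → ℝ) c = -ε) {w : E4}
    (hw : w ∈ eigenPlane ε K y) : coframeForm θ c y w = 0 := by
  obtain ⟨v, rfl⟩ := hw
  rw [coframeForm_apply, Matrix.toLin'_apply, Matrix.mulVec_mulVec, Matrix.mul_add,
    h.paracomplex y hy, Matrix.mul_smul, Matrix.mul_one, Matrix.add_mulVec, Matrix.smul_mulVec,
    ← Matrix.mulVec_mulVec, Pi.add_apply, Matrix.mulVec_diagonal, hc, Pi.smul_apply, smul_eq_mul]
  ring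

theorem frameVec_isLocalSection (h : IsAdaptedCoframe V g K θ) (hV : IsOpen V) (hy : y ∈ V)
    (c : Fin 4) {ε : ℝ} (hε : ε * ε = 1) (hc : (![1, 1, -1, -1] : Fin 4 → ℝ) c = ε) :
    IsLocalSection (eigenPlane ε K) y (frameVec θ c) :=
  ⟨V, hV, hy, h.smooth_frameVec c, fun _ hz => h.frameVec_mem_eigenPlane hz c hε hc⟩

/-- The forms `θᵃ` annihilating an integrable eigenplane are closed on it. -/
theorem extDerivOne_frameVec_eq_zero (h : IsAdaptedCoframe V g K θ) (hV : IsOpen V) (hy : y ∈ V)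
    (a c d : Fin 4) {ε : ℝ} (hε : ε * ε = 1) (hc : (![1, 1, -1, -1] : Fin 4 → ℝ) c = ε)
    (hd : (![1, 1, -1, -1] : Fin 4 → ℝ) d = ε) (ha : (![1, 1, -1, -1] : Fin 4 → ℝ) a = -ε)
    (hint : ∀ X Y : E4 → E4, IsLocalSection (eigenPlane ε K) y X →
      IsLocalSection (eigenPlane ε K) y Y → VectorField.lieBracket ℝ X Y y ∈ eigenPlane ε K y) :
    extDerivOne (coframeForm θ a) y (frameVec θ c y) (frameVec θ d y) = 0 := by
  have hsc := h.frameVec_isLocalSection hV hy c hε hc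
  have hsd := h.frameVec_isLocalSection hV hy d hε hd
  have hz : ∀ e, (![1, 1, -1, -1] : Fin 4 → ℝ) e = ε →
      ∀ᶠ z in nhds y, coframeForm θ a z (frameVec θ e z) = 0 := by
    intro e he
    filter_upwards [hV.mem_nhds hy] with z hz
    exact h.coframeForm_eq_zero_of_mem_eigenPlane hz a ha (h.frameVec_mem_eigenPlane hz e hε he)
  have h1 := apply_lieBracket_eq_neg_extDerivOne (h.differentiableAt_coframeForm hV hy a)
    (hsc.contDiffAt.differentiableAt (by simp)) (hsd.contDiffAt.differentiableAt (by simp))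
    (hz c hc) (hz d hd)
  rw [h.coframeForm_eq_zero_of_mem_eigenPlane hy a ha (hint _ _ hsc hsd)] at h1
  linarith

theorem ext_frameVec (h : IsAdaptedCoframe V g K θ) (hy : y ∈ V) {β : E4 →L[ℝ] ℝ}
    (h0 : ∀ c, β (frameVec θ c y) = 0) (u : E4) : β u = 0 := by
  rw [h.eq_sum_frameVec hy u]
  simp [h0]

/-- The two entries of the connection matrix, apart from those that skewness determines, which are
off the diagonal blocks vanish; that is, the para-complex structure is parallel.  On two of the
four frame vectors this is the closedness of `ρ`, on the other two the integrability of an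
eigenplane. -/
theorem conn_block (h : IsAdaptedCoframe V g K θ) (hK : IsParaKahlerOn V g K) (hV : IsOpen V)
    (hy : y ∈ V) (u : E4) :
    connectionForm g θ 0 3 y u = 0 ∧ connectionForm g θ 2 1 y u = 0 := by
  have hg := hK.isMetricOn hV
  have hsk := h.conn_skew hg hy
  have hM : ∀ (M : Mat4) a b, (Pi.single a 1 : Fin 4 → ℝ) ⬝ᵥ M *ᵥ Pi.single b 1 = M a b := by
    intro M a b; simp
  have hcl : ∀ a b c, _ := fun a b c =>
    h.closed_frame hK hV hy (frameVec θ a y) (frameVec θ b y) (frameVec θ c y)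
  simp only [h.mulVec_frameVec hy, hM] at hcl
  have hd := fun a c d => h.extDerivOne_coframeForm hg hy a (frameVec θ c y) (frameVec θ d y)
  have m1 : (-1 : ℝ) * -1 = 1 := by norm_num
  constructor
  · refine h.ext_frameVec hy (fun c => ?_) u
    fin_cases c
    · have := hcl 0 2 3
      simp [signMat, nullForm, connMat, Matrix.mul_apply, Fin.sum_univ_four] at this
      have s0 := hsk (frameVec θ 0 y)
      have s2 := hsk (frameVec θ 2 y)
      have s3 := hsk (frameVec θ 3 y)
      simp only [Fin.zero_eta]
      linarith
    · have := hcl 1 2 3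
      simp [signMat, nullForm, connMat, Matrix.mul_apply, Fin.sum_univ_four] at this
      have s0 := hsk (frameVec θ 1 y)
      have s2 := hsk (frameVec θ 2 y)
      have s3 := hsk (frameVec θ 3 y)
      simp only [Fin.mk_one]
      linarith
    · have := h.extDerivOne_frameVec_eq_zero hV hy 0 2 3 m1 (by simp) (by simp) (by simp)
        (hK.integrable_minus y hy)
      rw [hd] at this
      simp [wedgeOne, h.coframeForm_frameVec hy] at this
      have s3 := hsk (frameVec θ 3 y)
      simp only [Fin.reduceFinMk]
      linarith
    · have := h.extDerivOne_frameVec_eq_zero hV hy 1 2 3 m1 (by simp) (by simp) (by simp)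
        (hK.integrable_minus y hy)
      rw [hd] at this
      simp [wedgeOne, h.coframeForm_frameVec hy] at this
      have s2 := hsk (frameVec θ 2 y)
      have s3 := hsk (frameVec θ 3 y)
      simp only [Fin.reduceFinMk]
      linarith
  · refine h.ext_frameVec hy (fun c => ?_) u
    fin_cases c
    · have := h.extDerivOne_frameVec_eq_zero hV hy 2 0 1 (one_mul 1) (by simp) (by simp) (by simp)
        (hK.integrable_plus y hy)
      rw [hd] at this
      simp [wedgeOne, h.coframeForm_frameVec hy] at this
      have s1 := hsk (frameVec θ 1 y)
      simp only [Fin.zero_eta]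
      linarith
    · have := h.extDerivOne_frameVec_eq_zero hV hy 3 0 1 (one_mul 1) (by simp) (by simp) (by simp)
        (hK.integrable_plus y hy)
      rw [hd] at this
      simp [wedgeOne, h.coframeForm_frameVec hy] at this
      have s0 := hsk (frameVec θ 0 y)
      have s1 := hsk (frameVec θ 1 y)
      simp only [Fin.mk_one]
      linarith
    · have := hcl 2 0 1
      simp [signMat, nullForm, connMat, Matrix.mul_apply, Fin.sum_univ_four] at this
      have s0 := hsk (frameVec θ 0 y)
      have s1 := hsk (frameVec θ 1 y)
      have s2 := hsk (frameVec θ 2 y)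
      simp only [Fin.reduceFinMk]
      linarith
    · have := hcl 3 0 1
      simp [signMat, nullForm, connMat, Matrix.mul_apply, Fin.sum_univ_four] at this
      have s0 := hsk (frameVec θ 0 y)
      have s1 := hsk (frameVec θ 1 y)
      have s2 := hsk (frameVec θ 3 y)
      simp only [Fin.reduceFinMk]
      linarith

/-- All components of the connection matrix in terms of the block on `θ⁰, θ¹`. -/
theorem conn_eq (h : IsAdaptedCoframe V g K θ) (hK : IsParaKahlerOn V g K) (hV : IsOpen V)
    (hy : y ∈ V) :
    connectionForm g θ 0 2 y = 0 ∧ connectionForm g θ 0 3 y = 0 ∧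
    connectionForm g θ 1 2 y = 0 ∧ connectionForm g θ 1 3 y = 0 ∧
    connectionForm g θ 2 0 y = 0 ∧ connectionForm g θ 2 1 y = 0 ∧
    connectionForm g θ 3 0 y = 0 ∧ connectionForm g θ 3 1 y = 0 ∧
    connectionForm g θ 2 2 y = -connectionForm g θ 0 0 y ∧
    connectionForm g θ 2 3 y = -connectionForm g θ 1 0 y ∧
    connectionForm g θ 3 2 y = -connectionForm g θ 0 1 y ∧
    connectionForm g θ 3 3 y = -connectionForm g θ 1 1 y := by
  have hg := hK.isMetricOn hV
  refine ⟨?_, ?_, ?_, ?_, ?_, ?_, ?_, ?_, ?_, ?_, ?_, ?_⟩ <;>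
  · ext1 u
    obtain ⟨a1, a2, a3, a4, a5, a6, a7, a8, a9, a10⟩ := h.conn_skew hg hy u
    obtain ⟨b1, b2⟩ := h.conn_block hK hV hy u
    simp only [zero_apply, neg_apply]
    linarith

theorem extDerivOne_coframe (h : IsAdaptedCoframe V g K θ) (hK : IsParaKahlerOn V g K)
    (hV : IsOpen V) (hy : y ∈ V) (u v : E4) :
    let A := fun a b => connectionForm g θ a b y
    let t := fun a => coframeForm θ a y
    extDerivOne (coframeForm θ 0) y u v =
      -wedgeOne (A 0 0) (t 0) u v - wedgeOne (A 0 1) (t 1) u v ∧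
    extDerivOne (coframeForm θ 1) y u v =
      -wedgeOne (A 1 0) (t 0) u v - wedgeOne (A 1 1) (t 1) u v ∧
    extDerivOne (coframeForm θ 2) y u v =
      wedgeOne (A 0 0) (t 2) u v + wedgeOne (A 1 0) (t 3) u v ∧
    extDerivOne (coframeForm θ 3) y u v =
      wedgeOne (A 0 1) (t 2) u v + wedgeOne (A 1 1) (t 3) u v := by
  intro A t
  have hg := hK.isMetricOn hV
  obtain ⟨a1, a2, a3, a4, a5, a6, a7, a8, a9, a10, a11, a12⟩ := h.conn_eq hK hV hy
  refine ⟨?_, ?_, ?_, ?_⟩ <;>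
  · rw [h.extDerivOne_coframeForm hg hy]
    simp only [Fin.sum_univ_four, a1, a2, a3, a4, a5, a6, a7, a8, a9, a10, a11, a12, wedgeOne,
      zero_apply, neg_apply, A, t]
    ring

end IsAdaptedCoframe

end AdaptedCoframe

/-! ### The curvature of a para-Kähler–Einstein metric in an adapted coframe -/

noncomputable section Curvature

variable {V : Set E4} {g K θ : E4 → Mat4} {y : E4}

/-- The curvature matrix `dΓ + Γ ∧ Γ` in the coframe `θ`. -/
def curvMat (g θ : E4 → Mat4) (y u v : E4) : Mat4 :=
  (Matrix.of fun a b => extDerivOne (connectionForm g θ a b) y u v)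
    + (connMat g θ y u * connMat g θ y v - connMat g θ y v * connMat g θ y u)

theorem extDerivOne_swap {F : Type*} [NormedAddCommGroup F] [NormedSpace ℝ F]
    (β : F → F →L[ℝ] ℝ) (q u v : F) : extDerivOne β q v u = -extDerivOne β q u v := by
  simp only [extDerivOne]; ring

theorem extDerivOne_congr {F : Type*} [NormedAddCommGroup F] [NormedSpace ℝ F]
    {β γ : F → F →L[ℝ] ℝ} {O : Set F} (hO : IsOpen O) (h : ∀ p ∈ O, β p = γ p) {q : F}
    (hq : q ∈ O) (u v : F) : extDerivOne β q u v = extDerivOne γ q u v := by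
  have : β =ᶠ[nhds q] γ := by
    filter_upwards [hO.mem_nhds hq] with p hp using h p hp
  simp only [extDerivOne, this.fderiv_eq]

theorem curvMat_swap (g θ : E4 → Mat4) (y u v : E4) : curvMat g θ y v u = -curvMat g θ y u v := by
  ext a b
  simp only [curvMat, Matrix.add_apply, Matrix.of_apply, Matrix.sub_apply, Matrix.neg_apply,
    extDerivOne_swap _ y u v]
  ring

namespace IsAdaptedCoframe

/-- The second structure equation: the curvature matrix represents the Riemann tensor. -/
theorem curvMat_mul_coframe (h : IsAdaptedCoframe V g K θ) (hg : IsMetricOn V g) (hy : y ∈ V)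
    (u v : E4) : curvMat g θ y u v * θ y = θ y * riemMat g y u v := by
  have hV := hg.isOpen
  have hd := h.differentiableAt hV hy
  have hC : ∀ (v : E4) i j, DifferentiableAt ℝ (fun z => chrMat g z v i j) y := fun v i j =>
    ((hg.smooth_chrMat v i j).contDiffAt (hV.mem_nhds hy)).differentiableAt (by simp)
  have hG : ∀ (v : E4) i j, DifferentiableAt ℝ (fun z => connMat g θ z v i j) y := fun v i j =>
    (h.differentiableAt_connectionForm hg hy i j).clm_apply (differentiableAt_const v)
  have hmul : ∀ {A B : E4 → Mat4}, (∀ i j, DifferentiableAt ℝ (fun z => A z i j) y) →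
      (∀ i j, DifferentiableAt ℝ (fun z => B z i j) y) →
      ∀ i j, DifferentiableAt ℝ (fun z => (A z * B z) i j) y := fun hA hB i j => by
    simp only [Matrix.mul_apply]
    exact DifferentiableAt.fun_sum fun k _ => (hA i k).mul (hB k j)
  have hGd : ∀ u v, dirD (fun z => connMat g θ z v) y u =
      Matrix.of fun a b => fderiv ℝ (connectionForm g θ a b) y u v := by
    intro u v
    ext a b
    simp only [dirD_apply, connMat, Matrix.of_apply]
    rw [fderiv_clm_apply (h.differentiableAt_connectionForm hg hy a b) (differentiableAt_const v)]
    simp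
  have hsnd : ∀ u v, dirD (fun z => dirD θ z v) y u =
      (θ y * chrMat g y u - connMat g θ y u * θ y) * chrMat g y v
        + θ y * dirD (fun z => chrMat g z v) y u
        - (dirD (fun z => connMat g θ z v) y u * θ y
          + connMat g θ y v * (θ y * chrMat g y u - connMat g θ y u * θ y)) := by
    intro u v
    rw [dirD_congr hV (fun z hz => h.dirD_coframe hV hz v) hy,
      dirD_sub (hmul hd (hC v)) (hmul (hG v) hd), dirD_mul hd (hC v), dirD_mul (hG v) hd,
      h.dirD_coframe hV hy]
  have hsymm : dirD (fun z => dirD θ z v) y u = dirD (fun z => dirD θ z u) y v := by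
    ext a b
    have hs : ContDiffAt ℝ ∞ (fun z => θ z a b) y := (h.smooth a b).contDiffAt (hV.mem_nhds hy)
    have hdd : DifferentiableAt ℝ (fderiv ℝ fun z => θ z a b) y :=
      (hs.fderiv_right (m := ∞) (by simp)).differentiableAt (by simp)
    have e : ∀ u v, dirD (fun z => dirD θ z v) y u a b =
        fderiv ℝ (fderiv ℝ fun z => θ z a b) y u v := by
      intro u v
      simp only [dirD_apply]
      rw [fderiv_clm_apply hdd (differentiableAt_const v)]
      simp
    rw [e, e]
    exact (hs.isSymmSndFDerivAt (by
      rw [minSmoothness_of_isRCLikeNormedField]; exact WithTop.coe_le_coe.2 le_top)).eq u v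
  rw [hsnd, hsnd] at hsymm
  have hF : curvMat g θ y u v = dirD (fun z => connMat g θ z v) y u
      - dirD (fun z => connMat g θ z u) y v
      + (connMat g θ y u * connMat g θ y v - connMat g θ y v * connMat g θ y u) := by
    rw [hGd, hGd]
    rfl
  rw [hF, hg.riemMat_eq hy, ← sub_eq_zero, ← neg_eq_zero]
  rw [← sub_eq_zero] at hsymm
  rw [← hsymm]
  noncomm_ring

theorem curvMat_mulVec (h : IsAdaptedCoframe V g K θ) (hg : IsMetricOn V g) (hy : y ∈ V)
    (u v w : E4) : curvMat g θ y u v *ᵥ (θ y *ᵥ w) = θ y *ᵥ (riemMat g y u v *ᵥ w) := by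
  rw [Matrix.mulVec_mulVec, h.curvMat_mul_coframe hg hy, Matrix.mulVec_mulVec]

theorem bianchi (h : IsAdaptedCoframe V g K θ) (hg : IsMetricOn V g) (hy : y ∈ V)
    (a b c d : Fin 4) :
    curvMat g θ y (frameVec θ c y) (frameVec θ d y) a b
      + curvMat g θ y (frameVec θ d y) (frameVec θ b y) a c
      + curvMat g θ y (frameVec θ b y) (frameVec θ c y) a d = 0 := by
  have h1 := hg.bianchi hy (frameVec θ c y) (frameVec θ d y) (frameVec θ b y)
  have h2 := congrFun (congrArg (fun x => θ y *ᵥ x) h1) a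
  simp only [Matrix.mulVec_add, ← h.curvMat_mulVec hg hy, h.mulVec_frameVec hy,
    Matrix.mulVec_zero] at h2
  simpa using h2

theorem ricci_frame (h : IsAdaptedCoframe V g K θ) (hg : IsMetricOn V g) (hy : y ∈ V)
    (b d : Fin 4) :
    ∑ c, curvMat g θ y (frameVec θ c y) (frameVec θ d y) c b =
      ∑ i, ∑ j, frameVec θ b y i * frameVec θ d y j * ricci g y i j := by
  set u := frameVec θ b y
  set v := frameVec θ d y
  let L : Mat4 := Matrix.of fun k i => ∑ p, ∑ q, riemann g y k p i q * u p * v q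
  have hL : ∀ w, riemMat g y w v *ᵥ u = L *ᵥ w := by
    intro w
    ext k
    simp only [Matrix.mulVec, dotProduct, riemMat, L, Matrix.of_apply, Finset.sum_mul]
    rw [Finset.sum_comm]
    refine Finset.sum_congr rfl fun i _ => Finset.sum_congr rfl fun p _ =>
      Finset.sum_congr rfl fun q _ => by ring
  have h1 : ∀ c, curvMat g θ y (frameVec θ c y) v c b = (θ y * L * (θ y)⁻¹) c c := by
    intro c
    have h2 : curvMat g θ y (frameVec θ c y) v c b =
        (curvMat g θ y (frameVec θ c y) v *ᵥ (θ y *ᵥ u)) c := by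
      rw [h.mulVec_frameVec hy]; simp
    rw [h2, h.curvMat_mulVec hg hy, hL, Matrix.mulVec_mulVec]
    rfl
  have h3 : ∑ c, (θ y * L * (θ y)⁻¹) c c = L.trace := by
    change (θ y * L * (θ y)⁻¹).trace = _
    rw [Matrix.trace_mul_comm, ← Matrix.mul_assoc, h.inv_mul hy, Matrix.one_mul]
  rw [Finset.sum_congr rfl fun c _ => h1 c, h3]
  simp only [Matrix.trace, Matrix.diag, L, Matrix.of_apply, ricci, Finset.mul_sum]
  rw [Finset.sum_comm]
  refine Finset.sum_congr rfl fun p _ => ?_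
  rw [Finset.sum_comm]
  exact Finset.sum_congr rfl fun q _ => Finset.sum_congr rfl fun i _ => by ring

theorem metric_frame (h : IsAdaptedCoframe V g K θ) (hy : y ∈ V) (b d : Fin 4) :
    ∑ i, ∑ j, frameVec θ b y i * frameVec θ d y j * g y i j = nullForm b d := by
  have h1 : frameVec θ b y ⬝ᵥ g y *ᵥ frameVec θ d y = nullForm b d := by
    rw [h.metric y hy, Matrix.mul_assoc, ← Matrix.mulVec_mulVec, ← Matrix.mulVec_mulVec,
      Matrix.dotProduct_mulVec, Matrix.vecMul_transpose, h.mulVec_frameVec hy,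
      h.mulVec_frameVec hy]
    simp
  rw [← h1]
  simp only [dotProduct, Matrix.mulVec, Finset.mul_sum]
  exact Finset.sum_congr rfl fun _ _ => Finset.sum_congr rfl fun _ _ => by ring

/-- The curvature matrix is block diagonal, with diagonal blocks `F` and `-Fᵀ`. -/
theorem curvMat_block (h : IsAdaptedCoframe V g K θ) (hK : IsParaKahlerOn V g K) (hV : IsOpen V)
    (hy : y ∈ V) (u v : E4) :
    let F := curvMat g θ y u v
    F 0 2 = 0 ∧ F 0 3 = 0 ∧ F 1 2 = 0 ∧ F 1 3 = 0 ∧ F 2 0 = 0 ∧ F 2 1 = 0 ∧ F 3 0 = 0 ∧ F 3 1 = 0 ∧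
    F 2 2 = -F 0 0 ∧ F 2 3 = -F 1 0 ∧ F 3 2 = -F 0 1 ∧ F 3 3 = -F 1 1 := by
  intro F
  have hd : ∀ a b, (∀ z ∈ V, connectionForm g θ a b z = 0) →
      extDerivOne (connectionForm g θ a b) y u v = 0 := by
    intro a b hz
    rw [extDerivOne_congr hV hz hy]
    simp [extDerivOne]
  have hn : ∀ a b c d, (∀ z ∈ V, connectionForm g θ a b z = -connectionForm g θ c d z) →
      extDerivOne (connectionForm g θ a b) y u v = -extDerivOne (connectionForm g θ c d) y u v := by
    intro a b c d hz
    rw [extDerivOne_congr hV hz hy, extDerivOne_neg]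
  have e := fun z hz => h.conn_eq hK hV (y := z) hz
  have d1 := hd 0 2 fun z hz => (e z hz).1
  have d2 := hd 0 3 fun z hz => (e z hz).2.1
  have d3 := hd 1 2 fun z hz => (e z hz).2.2.1
  have d4 := hd 1 3 fun z hz => (e z hz).2.2.2.1
  have d5 := hd 2 0 fun z hz => (e z hz).2.2.2.2.1
  have d6 := hd 2 1 fun z hz => (e z hz).2.2.2.2.2.1
  have d7 := hd 3 0 fun z hz => (e z hz).2.2.2.2.2.2.1
  have d8 := hd 3 1 fun z hz => (e z hz).2.2.2.2.2.2.2.1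
  have d9 := hn 2 2 0 0 fun z hz => (e z hz).2.2.2.2.2.2.2.2.1
  have d10 := hn 2 3 1 0 fun z hz => (e z hz).2.2.2.2.2.2.2.2.2.1
  have d11 := hn 3 2 0 1 fun z hz => (e z hz).2.2.2.2.2.2.2.2.2.2.1
  have d12 := hn 3 3 1 1 fun z hz => (e z hz).2.2.2.2.2.2.2.2.2.2.2
  obtain ⟨a1, a2, a3, a4, a5, a6, a7, a8, a9, a10, a11, a12⟩ := h.conn_eq hK hV hy
  refine ⟨?_, ?_, ?_, ?_, ?_, ?_, ?_, ?_, ?_, ?_, ?_, ?_⟩ <;>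
  · simp only [F, curvMat, Matrix.add_apply, Matrix.sub_apply, Matrix.mul_apply, Matrix.of_apply,
      connMat, Fin.sum_univ_four, a1, a2, a3, a4, a5, a6, a7, a8, a9, a10, a11, a12, d1, d2, d3, d4,
      d5, d6, d7, d8, d9, d10, d11, d12, zero_apply,
      neg_apply]
    ring

/-- The curvature matrix is a 2-form, expanded here in the coframe. -/
theorem curvMat_expand (h : IsAdaptedCoframe V g K θ) (hy : y ∈ V) (u v : E4) (a b : Fin 4) :
    curvMat g θ y u v a b = ∑ c, ∑ d, coframeForm θ c y u * coframeForm θ d y v *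
      curvMat g θ y (frameVec θ c y) (frameVec θ d y) a b := by
  have hadd : ∀ (ι : Type) (s : Finset ι) (c : ι → ℝ) (e : ι → E4) (w : E4),
      curvMat g θ y (∑ i ∈ s, c i • e i) w a b = ∑ i ∈ s, c i * curvMat g θ y (e i) w a b := by
    intro ι s c e w
    simp only [curvMat, Matrix.add_apply, Matrix.sub_apply, Matrix.mul_apply, Matrix.of_apply,
      connMat, extDerivOne, map_sum, map_smul, sum_apply,
      smul_apply, smul_eq_mul, Finset.sum_mul, Finset.mul_sum, mul_add, mul_sub,
      Finset.sum_add_distrib, Finset.sum_sub_distrib]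
    congr 1
    congr 1
    · rw [Finset.sum_comm]
      exact Finset.sum_congr rfl fun _ _ => Finset.sum_congr rfl fun _ _ => by ring
    · rw [Finset.sum_comm]
      exact Finset.sum_congr rfl fun _ _ => Finset.sum_congr rfl fun _ _ => by ring
  have hadd' : ∀ (ι : Type) (s : Finset ι) (c : ι → ℝ) (e : ι → E4) (w : E4),
      curvMat g θ y w (∑ i ∈ s, c i • e i) a b = ∑ i ∈ s, c i * curvMat g θ y w (e i) a b := by
    intro ι s c e w
    rw [curvMat_swap, Matrix.neg_apply, hadd, ← Finset.sum_neg_distrib]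
    refine Finset.sum_congr rfl fun i _ => ?_
    rw [curvMat_swap, Matrix.neg_apply]
    ring
  conv_lhs => rw [h.eq_sum_frameVec hy u, hadd, h.eq_sum_frameVec hy v]
  refine Finset.sum_congr rfl fun c _ => ?_
  rw [hadd', Finset.mul_sum]
  exact Finset.sum_congr rfl fun d _ => by ring

end IsAdaptedCoframe

end Curvature

/-! ### The second structure equations of a para-Kähler–Einstein metric -/

noncomputable section SecondStructure

variable {V : Set E4} {g K θ : E4 → Mat4} {y : E4}

theorem quadSum_mul (X Y : Mat4) (a b c d : E4) :
    (∑ i, ∑ j, ∑ k, ∑ l, X i l * Y k j * (a i * b j * c k * d l)) =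
      (a ⬝ᵥ X *ᵥ d) * (c ⬝ᵥ Y *ᵥ b) := by
  have h1 : a ⬝ᵥ X *ᵥ d = ∑ i, ∑ l, a i * (X i l * d l) := by
    simp only [dotProduct, Matrix.mulVec, Finset.mul_sum]
  have h2 : c ⬝ᵥ Y *ᵥ b = ∑ j, ∑ k, c k * (Y k j * b j) := by
    simp only [dotProduct, Matrix.mulVec, Finset.mul_sum]
    exact Finset.sum_comm
  rw [h1, h2, Finset.sum_mul]
  refine Finset.sum_congr rfl fun i _ => ?_
  rw [mul_comm, Finset.sum_mul]
  refine Finset.sum_congr rfl fun j _ => ?_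
  rw [Finset.sum_mul]
  refine Finset.sum_congr rfl fun k _ => ?_
  rw [Finset.mul_sum]
  exact Finset.sum_congr rfl fun l _ => by ring

namespace IsAdaptedCoframe

theorem dotProduct_metric (h : IsAdaptedCoframe V g K θ) (hy : y ∈ V) (u v : E4) :
    u ⬝ᵥ g y *ᵥ v = (θ y *ᵥ u) ⬝ᵥ nullForm *ᵥ (θ y *ᵥ v) := by
  rw [h.metric y hy, Matrix.mul_assoc, ← Matrix.mulVec_mulVec, ← Matrix.mulVec_mulVec,
      Matrix.dotProduct_mulVec, Matrix.vecMul_transpose]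

/-- For an Einstein metric, `Ψ₂' = -s / 12`: the curvature component `R₁₂₃₄` vanishes. -/
theorem psiTwo_eq (h : IsAdaptedCoframe V g K θ) (hK : IsParaKahlerOn V g K) (hV : IsOpen V)
    (hE : IsEinsteinOn V g) (hy : y ∈ V) : psiTwo g θ y = -scalarCurv g y / 12 := by
  have hg := hK.isMetricOn hV
  set s := scalarCurv g y with hs
  have hsch : ∀ a b, schouten g y a b = s / 24 * g y a b := by
    intro a b
    have := hE y hy a b
    simp only [schouten, ← hs] at this ⊢
    linarith
  have hsymm : ∀ a b, g y a b = g y b a := fun a b => (hg.symm y hy).apply b a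
  have hw : ∀ a b c d, weyl g y a b c d * (θ y)⁻¹ a 0 * (θ y)⁻¹ b 1 * (θ y)⁻¹ c 2 * (θ y)⁻¹ d 3 =
      (∑ e, g y a e * riemann g y e b c d) * (θ y)⁻¹ a 0 * (θ y)⁻¹ b 1 * (θ y)⁻¹ c 2 * (θ y)⁻¹ d 3
      + s / 12 * (g y a d * g y c b * (frameVec θ 0 y a * frameVec θ 1 y b * frameVec θ 2 y c
          * frameVec θ 3 y d))
      - s / 12 * (g y a c * g y d b * (frameVec θ 0 y a * frameVec θ 1 y b * frameVec θ 3 y d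
          * frameVec θ 2 y c)) := by
    intro a b c d
    simp only [weyl, hsch, frameVec]
    rw [hsymm b c, hsymm b d, hsymm d a, hsymm c a]
    ring
  have hR : ∑ a, ∑ b, ∑ c, ∑ d, (∑ e, g y a e * riemann g y e b c d) * (θ y)⁻¹ a 0 *
      (θ y)⁻¹ b 1 * (θ y)⁻¹ c 2 * (θ y)⁻¹ d 3 = 0 := by
    have h1 : frameVec θ 0 y ⬝ᵥ g y *ᵥ (riemMat g y (frameVec θ 2 y) (frameVec θ 3 y) *ᵥ
        frameVec θ 1 y) = 0 := by
      rw [h.dotProduct_metric hy, ← h.curvMat_mulVec hg hy, h.mulVec_frameVec hy,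
        h.mulVec_frameVec hy]
      have := (h.curvMat_block hK hV hy (frameVec θ 2 y) (frameVec θ 3 y)).2.2.2.2.2.1
      simpa [nullForm, Matrix.mulVec, dotProduct, Fin.sum_univ_four] using this
    rw [← h1]
    simp only [dotProduct, Matrix.mulVec, riemMat, Matrix.of_apply, Finset.mul_sum, Finset.sum_mul]
    refine Finset.sum_congr rfl fun a _ => ?_
    conv_rhs => rw [Finset.sum_comm]
    refine Finset.sum_congr rfl fun b _ => ?_
    conv_rhs => rw [Finset.sum_comm]
    refine Finset.sum_congr rfl fun c _ => ?_
    conv_rhs => rw [Finset.sum_comm]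
    refine Finset.sum_congr rfl fun d _ => Finset.sum_congr rfl fun e _ => ?_
    simp only [frameVec]
    ring
  have hm : ∀ a b, frameVec θ a y ⬝ᵥ g y *ᵥ frameVec θ b y = nullForm a b := by
    intro a b
    rw [h.dotProduct_metric hy, h.mulVec_frameVec hy, h.mulVec_frameVec hy]
    simp
  have hS : ∀ (f f' : Fin 4 → Fin 4 → Fin 4 → Fin 4 → ℝ) (k : ℝ),
      (∑ a, ∑ b, ∑ c, ∑ d, (f a b c d + k * f' a b c d)) =
        (∑ a, ∑ b, ∑ c, ∑ d, f a b c d) + k * ∑ a, ∑ b, ∑ c, ∑ d, f' a b c d := by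
    intro f f' k
    simp only [Finset.sum_add_distrib, Finset.mul_sum]
  have h2 : ∑ a, ∑ b, ∑ c, ∑ d, (g y a c * g y d b * (frameVec θ 0 y a * frameVec θ 1 y b *
      frameVec θ 3 y d * frameVec θ 2 y c)) = nullForm 0 2 * nullForm 3 1 := by
    rw [← hm, ← hm, ← quadSum_mul]
    exact Finset.sum_congr rfl fun _ _ => Finset.sum_congr rfl fun _ _ => Finset.sum_comm
  rw [psiTwo]
  simp only [hw, sub_eq_add_neg, ← neg_mul]
  rw [hS, hS, hR, quadSum_mul, h2, hm, hm]
  simp [nullForm]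
  ring

/-- The curvature forms of the upper diagonal block of the connection matrix. -/
theorem exists_curvMat_eq (h : IsAdaptedCoframe V g K θ) (hK : IsParaKahlerOn V g K)
    (hV : IsOpen V) (hE : IsEinsteinOn V g) (hy : y ∈ V) : ∃ w : Fin 5 → ℝ, ∀ u v : E4,
    let Ψ := psiTwo g θ y
    let t := fun a b => wedgeOne (coframeForm θ a y) (coframeForm θ b y) u v
    let F := curvMat g θ y u v
    F 0 0 = (w 0 - 2 * Ψ) * t 0 2 + w 1 * t 1 2 + w 2 * t 0 3 - (w 0 + Ψ) * t 1 3 ∧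
    F 0 1 = w 1 * t 0 2 + w 3 * t 1 2 - (w 0 + Ψ) * t 0 3 - w 1 * t 1 3 ∧
    F 1 0 = w 2 * t 0 2 - (w 0 + Ψ) * t 1 2 + w 4 * t 0 3 - w 2 * t 1 3 ∧
    F 1 1 = -(w 0 + Ψ) * t 0 2 - w 1 * t 1 2 - w 2 * t 0 3 + (w 0 - 2 * Ψ) * t 1 3 := by
  have hg := hK.isMetricOn hV
  have hΨ := h.psiTwo_eq hK hV hE hy
  set Ψ := psiTwo g θ y
  -- the components of the curvature in the adapted frame
  obtain ⟨R, hR⟩ : ∃ R : Fin 4 → Fin 4 → Fin 4 → Fin 4 → ℝ, ∀ a b c d,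
      curvMat g θ y (frameVec θ c y) (frameVec θ d y) a b = R a b c d := ⟨_, fun _ _ _ _ => rfl⟩
  have hB : ∀ a b c d, R a b c d + R a c d b + R a d b c = 0 := fun a b c d => by
    simpa only [hR] using h.bianchi hg hy a b c d
  have hS : ∀ a b c d, R a b d c = -R a b c d := fun a b c d => by
    rw [← hR, ← hR, curvMat_swap, Matrix.neg_apply]
  have hric : ∀ b d, ∑ c, R c b c d = -3 * Ψ * nullForm b d := by
    intro b d
    have := h.ricci_frame hg hy b d
    simp only [hR] at this
    rw [this, ← h.metric_frame hy, Finset.mul_sum]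
    refine Finset.sum_congr rfl fun i _ => ?_
    rw [Finset.mul_sum]
    refine Finset.sum_congr rfl fun j _ => ?_
    have := hE y hy i j
    rw [hΨ]
    linear_combination (frameVec θ b y i * frameVec θ d y j) * this
  have hblk : ∀ c d, _ := fun c d => h.curvMat_block hK hV hy (frameVec θ c y) (frameVec θ d y)
  simp only [hR] at hblk
  choose k1 k2 k3 k4 k5 k6 k7 k8 k9 k10 k11 k12 using hblk
  have s0 : ∀ a b c, R a b c c = 0 := fun a b c => by have := hS a b c c; linarith
  -- the (2,0)- and (0,2)-parts vanish
  have z0 : R 0 0 0 1 = 0 := by linarith [hB 2 2 0 1, k5 1 2, k6 2 0, k9 0 1]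
  have z1 : R 1 0 0 1 = 0 := by linarith [hB 2 3 0 1, k5 1 3, k6 3 0, k10 0 1]
  have z2 : R 0 1 0 1 = 0 := by linarith [hB 3 2 0 1, k7 1 2, k8 2 0, k11 0 1]
  have z3 : R 1 1 0 1 = 0 := by linarith [hB 3 3 0 1, k7 1 3, k8 3 0, k12 0 1]
  have z4 : R 0 0 2 3 = 0 := by linarith [hB 0 0 2 3, k1 3 0, k2 0 2]
  have z5 : R 0 1 2 3 = 0 := by linarith [hB 0 1 2 3, k1 3 1, k2 1 2]
  have z6 : R 1 0 2 3 = 0 := by linarith [hB 1 0 2 3, k3 3 0, k4 0 2]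
  have z7 : R 1 1 2 3 = 0 := by linarith [hB 1 1 2 3, k3 3 1, k4 1 2]
  -- the symmetries of the (1,1)-part
  have b1 : R 0 0 1 2 = R 0 1 0 2 := by linarith [hB 0 0 1 2, hS 0 1 0 2, k1 0 1]
  have b2 : R 0 0 1 3 = R 0 1 0 3 := by linarith [hB 0 0 1 3, hS 0 1 0 3, k2 0 1]
  have b3 : R 1 0 1 2 = R 1 1 0 2 := by linarith [hB 1 0 1 2, hS 1 1 0 2, k3 0 1]
  have b4 : R 1 0 1 3 = R 1 1 0 3 := by linarith [hB 1 0 1 3, hS 1 1 0 3, k4 0 1]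
  have b5 : R 0 0 0 3 = R 1 0 0 2 := by
    linarith [hB 2 2 3 0, hS 0 0 0 3, k9 3 0, k10 0 2, k5 2 3]
  have b6 : R 0 0 1 3 = R 1 0 1 2 := by
    linarith [hB 2 2 3 1, hS 0 0 1 3, k9 3 1, k10 1 2, k6 2 3]
  have b7 : R 0 1 0 3 = R 1 1 0 2 := by
    linarith [hB 3 2 3 0, hS 0 1 0 3, k11 3 0, k12 0 2, k7 2 3]
  have b8 : R 0 1 1 3 = R 1 1 1 2 := by
    linarith [hB 3 2 3 1, hS 0 1 1 3, k11 3 1, k12 1 2, k8 2 3]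
  have r1 := hric 0 2
  have r2 := hric 0 3
  have r3 := hric 1 2
  have r4 := hric 1 3
  simp [Fin.sum_univ_four, k5, k6, k7, k8, nullForm] at r1 r2 r3 r4
  refine ⟨![R 0 0 0 2 + 2 * Ψ, R 0 0 1 2, R 0 0 0 3, R 0 1 1 2, R 1 0 0 3], fun u v => ?_⟩
  have ex : ∀ a b, R a b 0 1 = 0 → R a b 2 3 = 0 → curvMat g θ y u v a b =
      R a b 0 2 * wedgeOne (coframeForm θ 0 y) (coframeForm θ 2 y) u v
      + R a b 1 2 * wedgeOne (coframeForm θ 1 y) (coframeForm θ 2 y) u v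
      + R a b 0 3 * wedgeOne (coframeForm θ 0 y) (coframeForm θ 3 y) u v
      + R a b 1 3 * wedgeOne (coframeForm θ 1 y) (coframeForm θ 3 y) u v := by
    intro a b h1 h2
    rw [h.curvMat_expand hy]
    simp only [hR, Fin.sum_univ_four, s0, h1, h2, hS a b 0 1, hS a b 0 2, hS a b 0 3, hS a b 1 2,
      hS a b 1 3, hS a b 2 3, wedgeOne]
    ring
  have g1 : R 1 0 1 2 = -(R 0 0 0 2 + 2 * Ψ + Ψ) := by linarith
  have g2 : R 1 1 1 3 = R 0 0 0 2 + 2 * Ψ - 2 * Ψ := by linarith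
  have g3 : R 0 0 0 2 = R 0 0 0 2 + 2 * Ψ - 2 * Ψ := by linarith
  simp only [Matrix.cons_val]
  refine ⟨?_, ?_, ?_, ?_⟩
  · rw [ex 0 0 z0 z4, b6, g1]; ring
  · rw [ex 0 1 z2 z5, ← b1, ← b2, b6, g1, b8, show R 1 1 1 2 = -R 0 0 1 2 by linarith]; ring
  · rw [ex 1 0 z1 z6, ← b5, g1, show R 1 0 1 3 = -R 0 0 0 3 by linarith]; ring
  · rw [ex 1 1 z3 z7, ← b3, g1, ← b4, g2, show R 1 0 1 3 = -R 0 0 0 3 by linarith,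
      show R 1 1 1 2 = -R 0 0 1 2 by linarith]
    ring

/-- The sum `Γ¹₁ + Γ²₂`, as a 1-form. -/
def _root_.traceConn (g θ : E4 → Mat4) (y : E4) : E4 →L[ℝ] ℝ :=
  connectionForm g θ 0 0 y + connectionForm g θ 1 1 y

/-- The exterior derivative of the connection forms. -/
theorem exists_extDerivOne_connectionForm (h : IsAdaptedCoframe V g K θ)
    (hK : IsParaKahlerOn V g K) (hV : IsOpen V) (hE : IsEinsteinOn V g) (hy : y ∈ V) :
    ∃ w : Fin 5 → ℝ, ∀ u v : E4,
    let Ψ := psiTwo g θ y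
    let t := fun a => coframeForm θ a y
    let A := fun a b => connectionForm g θ a b y
    extDerivOne (connectionForm g θ 0 0) y u v = -wedgeOne (A 0 1) (A 1 0) u v
      + (w 0 - 2 * Ψ) * wedgeOne (t 0) (t 2) u v + w 1 * wedgeOne (t 1) (t 2) u v
      + w 2 * wedgeOne (t 0) (t 3) u v - (w 0 + Ψ) * wedgeOne (t 1) (t 3) u v ∧
    extDerivOne (connectionForm g θ 0 1) y u v = -wedgeOne (A 0 0) (A 0 1) u v
        - wedgeOne (A 0 1) (A 1 1) u v
      + w 1 * wedgeOne (t 0) (t 2) u v + w 3 * wedgeOne (t 1) (t 2) u v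
      - (w 0 + Ψ) * wedgeOne (t 0) (t 3) u v - w 1 * wedgeOne (t 1) (t 3) u v ∧
    extDerivOne (connectionForm g θ 1 0) y u v = -wedgeOne (A 1 0) (A 0 0) u v
        - wedgeOne (A 1 1) (A 1 0) u v
      + w 2 * wedgeOne (t 0) (t 2) u v - (w 0 + Ψ) * wedgeOne (t 1) (t 2) u v
      + w 4 * wedgeOne (t 0) (t 3) u v - w 2 * wedgeOne (t 1) (t 3) u v ∧
    extDerivOne (connectionForm g θ 1 1) y u v = -wedgeOne (A 1 0) (A 0 1) u v
      - (w 0 + Ψ) * wedgeOne (t 0) (t 2) u v - w 1 * wedgeOne (t 1) (t 2) u v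
      - w 2 * wedgeOne (t 0) (t 3) u v + (w 0 - 2 * Ψ) * wedgeOne (t 1) (t 3) u v := by
  obtain ⟨w, hw⟩ := h.exists_curvMat_eq hK hV hE hy
  refine ⟨w, fun u v => ?_⟩
  obtain ⟨e1, e2, e3, e4⟩ := hw u v
  obtain ⟨a1, a2, a3, a4, a5, a6, a7, a8, -, -, -, -⟩ := h.conn_eq hK hV hy
  simp only [curvMat, Matrix.add_apply, Matrix.sub_apply, Matrix.mul_apply, Matrix.of_apply,
    connMat, Fin.sum_univ_four, a1, a2, a3, a4, a5, a6, a7, a8,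
    zero_apply] at e1 e2 e3 e4
  intro Ψ t A
  simp only [wedgeOne, A, t] at e1 e2 e3 e4 ⊢
  refine ⟨?_, ?_, ?_, ?_⟩
  · linear_combination e1
  · linear_combination e2
  · linear_combination e3
  · linear_combination e4

/-- The trace of the connection form is a potential of a multiple of `ρ`. -/
theorem extDerivOne_traceConn (h : IsAdaptedCoframe V g K θ) (hK : IsParaKahlerOn V g K)
    (hV : IsOpen V) (hE : IsEinsteinOn V g) (hy : y ∈ V) (u v : E4) :
    extDerivOne (traceConn g θ) y u v = scalarCurv g y / 4 * (u ⬝ᵥ kahlerForm g K y *ᵥ v) := by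
  have hg := hK.isMetricOn hV
  obtain ⟨w, hw⟩ := h.exists_extDerivOne_connectionForm hK hV hE hy
  obtain ⟨e1, -, -, e4⟩ := hw u v
  have e : extDerivOne (traceConn g θ) y u v = extDerivOne (connectionForm g θ 0 0) y u v
      + extDerivOne (connectionForm g θ 1 1) y u v :=
    extDerivOne_add (h.differentiableAt_connectionForm hg hy 0 0)
      (h.differentiableAt_connectionForm hg hy 1 1) u v
  have hk : u ⬝ᵥ kahlerForm g K y *ᵥ v =
      wedgeOne (coframeForm θ 0 y) (coframeForm θ 2 y) u v
        + wedgeOne (coframeForm θ 1 y) (coframeForm θ 3 y) u v := by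
    rw [h.kahlerForm_eq hy, Matrix.mul_assoc, ← Matrix.mulVec_mulVec, ← Matrix.mulVec_mulVec,
      Matrix.dotProduct_mulVec u, Matrix.vecMul_transpose]
    simp only [wedgeOne, coframeForm_apply]
    generalize θ y *ᵥ u = a
    generalize θ y *ᵥ v = b
    simp [signMat, nullForm, dotProduct, Matrix.mulVec, Fin.sum_univ_four, Matrix.mul_apply]
    ring
  rw [e, e1, e4, hk, h.psiTwo_eq hK hV hE hy]
  simp only [wedgeOne]
  ring

/-- The scalar curvature of a para-Kähler–Einstein metric is locally constant: `d(s ρ) = 0`,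
`dρ = 0` and `ρ` is non-degenerate. -/
theorem fderiv_scalarCurv (h : IsAdaptedCoframe V g K θ) (hK : IsParaKahlerOn V g K)
    (hV : IsOpen V) (hE : IsEinsteinOn V g) (hy : y ∈ V) : fderiv ℝ (scalarCurv g) y = 0 := by
  have hg := hK.isMetricOn hV
  have hT : ContDiffOn ℝ ∞ (traceConn g θ) V :=
    (h.smooth_connectionForm hg 0 0).add (h.smooth_connectionForm hg 1 1)
  have hTy : ContDiffAt ℝ ∞ (traceConn g θ) y := hT.contDiffAt (hV.mem_nhds hy)
  have hs : DifferentiableAt ℝ (scalarCurv g) y :=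
    (hg.smooth_scalarCurv.contDiffAt (hV.mem_nhds hy)).differentiableAt (by simp)
  have hρs : ∀ i j, ContDiffOn ℝ ∞ (fun z => kahlerForm g K z i j) V :=
    contDiffOn_matrix_mul (fun i j => hK.smooth_K j i) hK.smooth_metric
  have hρ : ∀ i j, DifferentiableAt ℝ (fun z => kahlerForm g K z i j) y := fun i j =>
    ((hρs i j).contDiffAt (hV.mem_nhds hy)).differentiableAt (by simp)
  have hd : DifferentiableAt ℝ (fderiv ℝ (traceConn g θ)) y :=
    (hTy.fderiv_right (m := ∞) (by simp)).differentiableAt (by simp)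
  have hsym : ∀ a b c, fderiv ℝ (fderiv ℝ (traceConn g θ)) y a b c =
      fderiv ℝ (fderiv ℝ (traceConn g θ)) y b a c := by
    intro a b c
    rw [(hTy.isSymmSndFDerivAt (by
      rw [minSmoothness_of_isRCLikeNormedField]; exact WithTop.coe_le_coe.2 le_top)).eq a b]
  have key : ∀ a v w, fderiv ℝ (fderiv ℝ (traceConn g θ)) y a v w
      - fderiv ℝ (fderiv ℝ (traceConn g θ)) y a w v =
      1 / 4 * (fderiv ℝ (scalarCurv g) y a * (v ⬝ᵥ kahlerForm g K y *ᵥ w)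
        + scalarCurv g y * (v ⬝ᵥ dirD (kahlerForm g K) y a *ᵥ w)) := by
    intro a v w
    have h1 : (fun z => extDerivOne (traceConn g θ) z v w) =ᶠ[nhds y]
        fun z => scalarCurv g z / 4 * (v ⬝ᵥ kahlerForm g K z *ᵥ w) := by
      filter_upwards [hV.mem_nhds hy] with z hz using h.extDerivOne_traceConn hK hV hE hz v w
    have h2 := DFunLike.congr_fun (h1.fderiv_eq (𝕜 := ℝ)) a
    have h3 : HasFDerivAt (fun z => v ⬝ᵥ kahlerForm g K z *ᵥ w)
        (∑ i, v i • ∑ j, w j • fderiv ℝ (fun z => kahlerForm g K z i j) y) y := by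
      have h9 : ∀ i, HasFDerivAt (fun z => ∑ j, kahlerForm g K z i j * w j)
          (∑ j, w j • fderiv ℝ (fun z => kahlerForm g K z i j) y) y := fun i =>
        HasFDerivAt.fun_sum fun j _ => (hρ i j).hasFDerivAt.mul_const (w j)
      exact HasFDerivAt.fun_sum fun i _ => (h9 i).const_mul (v i)
    have h4 : HasFDerivAt (fun z => extDerivOne (traceConn g θ) z v w)
        ((((fderiv ℝ (fderiv ℝ (traceConn g θ)) y).flip v).flip w)
          - ((fderiv ℝ (fderiv ℝ (traceConn g θ)) y).flip w).flip v) y := by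
      have : ∀ v w, HasFDerivAt (fun z => fderiv ℝ (traceConn g θ) z v w)
          (((fderiv ℝ (fderiv ℝ (traceConn g θ)) y).flip v).flip w) y := by
        intro v w
        have h5 := (hd.hasFDerivAt.clm_apply (hasFDerivAt_const v y)).clm_apply
          (hasFDerivAt_const w y)
        refine h5.congr_fderiv ?_
        ext x; simp
      exact (this v w).sub (this w v)
    have h6 := ((hs.hasFDerivAt.mul_const (1 / 4 : ℝ)).mul h3).fderiv
    have h7 : ((fun z => scalarCurv g z * (1 / 4 : ℝ)) * fun z => v ⬝ᵥ kahlerForm g K z *ᵥ w) =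
        fun z => scalarCurv g z / 4 * (v ⬝ᵥ kahlerForm g K z *ᵥ w) := by
      funext z; simp only [Pi.mul_apply]; ring
    rw [h7] at h6
    simp only [h4.fderiv, h6] at h2
    simp only [sub_apply, ContinuousLinearMap.flip_apply,
      add_apply, smul_apply, smul_eq_mul,
      sum_apply] at h2
    rw [h2]
    have h8 : v ⬝ᵥ dirD (kahlerForm g K) y a *ᵥ w =
        ∑ i, v i * ∑ j, w j * fderiv ℝ (fun z => kahlerForm g K z i j) y a := by
      simp only [dotProduct, Matrix.mulVec, dirD_apply]
      exact Finset.sum_congr rfl fun i _ => congrArg _ (Finset.sum_congr rfl fun j _ => mul_comm _ _)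
    rw [h8]
    ring
  have cyc : ∀ a v w, fderiv ℝ (scalarCurv g) y a * (v ⬝ᵥ kahlerForm g K y *ᵥ w)
      + fderiv ℝ (scalarCurv g) y v * (w ⬝ᵥ kahlerForm g K y *ᵥ a)
      + fderiv ℝ (scalarCurv g) y w * (a ⬝ᵥ kahlerForm g K y *ᵥ v) = 0 := by
    intro a v w
    linear_combination 4 * (hsym a v w + hsym v w a + hsym w a v) - 4 * (key a v w + key v w a
      + key w a v) - scalarCurv g y * hK.dirD_kahlerForm_cyclic hy a v w
  have hf : ∀ a b, frameVec θ a y ⬝ᵥ kahlerForm g K y *ᵥ frameVec θ b y =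
      (signMat * nullForm) a b := by
    intro a b
    rw [h.kahlerForm_eq hy, Matrix.mul_assoc, ← Matrix.mulVec_mulVec, ← Matrix.mulVec_mulVec,
      Matrix.dotProduct_mulVec, Matrix.vecMul_transpose, h.mulVec_frameVec hy,
      h.mulVec_frameVec hy]
    simp
  have c1 := cyc (frameVec θ 0 y) (frameVec θ 1 y) (frameVec θ 3 y)
  have c2 := cyc (frameVec θ 1 y) (frameVec θ 0 y) (frameVec θ 2 y)
  have c3 := cyc (frameVec θ 2 y) (frameVec θ 1 y) (frameVec θ 3 y)
  have c4 := cyc (frameVec θ 3 y) (frameVec θ 0 y) (frameVec θ 2 y)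
  simp only [hf] at c1 c2 c3 c4
  simp [signMat, nullForm, Matrix.mul_apply, Fin.sum_univ_four] at c1 c2 c3 c4
  ext u
  rw [h.eq_sum_frameVec hy u]
  simp [Fin.sum_univ_four, c1, c2, c3, c4]

/-- Locally, an adapted coframe of a para-Kähler–Einstein metric and the corresponding block of the
connection matrix satisfy the structure equations with a constant `Ψ₂'`. -/
theorem exists_isParaKahlerEinsteinFrame (h : IsAdaptedCoframe V g K θ)
    (hK : IsParaKahlerOn V g K) (hV : IsOpen V) (hE : IsEinsteinOn V g) (hy : y ∈ V) :
    ∃ B, IsOpen B ∧ y ∈ B ∧ B ⊆ V ∧ (∀ z ∈ B, psiTwo g θ z = psiTwo g θ y) ∧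
      IsParaKahlerEinsteinFrame B (coframeForm θ)
        (fun a b => connectionForm g θ (Fin.castLE (by omega) a) (Fin.castLE (by omega) b))
        (psiTwo g θ y) := by
  have hg := hK.isMetricOn hV
  obtain ⟨ε, hε, hB⟩ := Metric.isOpen_iff.1 hV y hy
  have hs : ∀ z ∈ Metric.ball y ε, scalarCurv g z = scalarCurv g y := fun z hz =>
    (convex_ball y ε).is_const_of_fderivWithin_eq_zero (𝕜 := ℝ) (f := scalarCurv g)
      ((hg.smooth_scalarCurv.differentiableOn (by simp)).mono hB)
      (fun x hx => by
        rw [fderivWithin_of_isOpen Metric.isOpen_ball hx]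
        exact h.fderiv_scalarCurv hK hV hE (hB hx)) hz (Metric.mem_ball_self hε)
  have hp : ∀ z ∈ Metric.ball y ε, psiTwo g θ z = psiTwo g θ y := fun z hz => by
    rw [h.psiTwo_eq hK hV hE (hB hz), h.psiTwo_eq hK hV hE hy, hs z hz]
  refine ⟨Metric.ball y ε, Metric.isOpen_ball, Metric.mem_ball_self hε, hB, hp, ?_⟩
  refine ⟨fun a => (h.smooth_coframeForm a).mono hB,
    fun a b => (h.smooth_connectionForm hg _ _).mono hB,
    fun q hq u v => (h.extDerivOne_coframe hK hV (hB hq) u v).1,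
    fun q hq u v => (h.extDerivOne_coframe hK hV (hB hq) u v).2.1,
    fun q hq u v => (h.extDerivOne_coframe hK hV (hB hq) u v).2.2.1,
    fun q hq u v => (h.extDerivOne_coframe hK hV (hB hq) u v).2.2.2, fun q hq => ?_⟩
  obtain ⟨w, hw⟩ := h.exists_extDerivOne_connectionForm hK hV hE (hB hq)
  simp only [hp q hq] at hw
  exact ⟨w, hw⟩

end IsAdaptedCoframe

end SecondStructure

/-! ### Horizontal lifts of the pencil of self-dual null planes -/

noncomputable section Lift

variable {V : Set E4} {g K θ : E4 → Mat4} {y : E4}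

/-- The first of the two vectors spanning the plane `Ker {s θ¹ + t θ⁴, s θ² - t θ³}`. -/
def pencilVecFst (θ : E4 → Mat4) (y : E4) (s t : ℝ) : E4 :=
  -t • frameVec θ 0 y + s • frameVec θ 3 y

/-- The second of the two vectors spanning the plane `Ker {s θ¹ + t θ⁴, s θ² - t θ³}`. -/
def pencilVecSnd (θ : E4 → Mat4) (y : E4) (s t : ℝ) : E4 :=
  t • frameVec θ 1 y + s • frameVec θ 2 y

theorem mem_pencilPlane {s t : ℝ} {v : E4} : v ∈ pencilPlane θ y s t ↔
    s * coframeForm θ 0 y v + t * coframeForm θ 3 y v = 0 ∧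
      s * coframeForm θ 1 y v - t * coframeForm θ 2 y v = 0 := by
  simp [pencilPlane, sub_eq_zero]

namespace IsAdaptedCoframe

theorem coframeForm_pencil (h : IsAdaptedCoframe V g K θ) (hy : y ∈ V) (s t a b : ℝ) :
    let X := a • pencilVecFst θ y s t + b • pencilVecSnd θ y s t
    coframeForm θ 0 y X = -(t * a) ∧ coframeForm θ 1 y X = t * b ∧ coframeForm θ 2 y X = s * b ∧
      coframeForm θ 3 y X = s * a := by
  simp [pencilVecFst, pencilVecSnd, h.coframeForm_frameVec hy]
  refine ⟨?_, ?_, ?_, ?_⟩ <;> ring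

theorem mem_pencilPlane_iff_exists (h : IsAdaptedCoframe V g K θ) (hy : y ∈ V) {s t : ℝ}
    (hst : s ^ 2 + t ^ 2 ≠ 0) {v : E4} : v ∈ pencilPlane θ y s t ↔
      ∃ a b : ℝ, v = a • pencilVecFst θ y s t + b • pencilVecSnd θ y s t := by
  rw [mem_pencilPlane]
  constructor
  · rintro ⟨h1, h2⟩
    refine ⟨(s * coframeForm θ 3 y v - t * coframeForm θ 0 y v) / (s ^ 2 + t ^ 2),
      (s * coframeForm θ 2 y v + t * coframeForm θ 1 y v) / (s ^ 2 + t ^ 2), ?_⟩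
    conv_lhs => rw [h.eq_sum_frameVec hy v]
    simp only [Fin.sum_univ_four, pencilVecFst, pencilVecSnd, smul_add, smul_smul]
    have e0 : coframeForm θ 0 y v =
        (s * coframeForm θ 3 y v - t * coframeForm θ 0 y v) / (s ^ 2 + t ^ 2) * -t := by
      field_simp; linear_combination s * h1
    have e1 : coframeForm θ 1 y v =
        (s * coframeForm θ 2 y v + t * coframeForm θ 1 y v) / (s ^ 2 + t ^ 2) * t := by
      field_simp; linear_combination s * h2
    have e2 : coframeForm θ 2 y v =
        (s * coframeForm θ 2 y v + t * coframeForm θ 1 y v) / (s ^ 2 + t ^ 2) * s := by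
      field_simp; linear_combination -t * h2
    have e3 : coframeForm θ 3 y v =
        (s * coframeForm θ 3 y v - t * coframeForm θ 0 y v) / (s ^ 2 + t ^ 2) * s := by
      field_simp; linear_combination t * h1
    rw [← e0, ← e1, ← e2, ← e3]
    abel
  · rintro ⟨a, b, rfl⟩
    obtain ⟨e0, e1, e2, e3⟩ := h.coframeForm_pencil hy s t a b
    simp only [e0, e1, e2, e3]
    constructor <;> ring

/-- The derivative of the components in the coframe `θ` of a vector field along the projection. -/
theorem hasFDerivAt_coframe_comp (h : IsAdaptedCoframe V g K θ) (hV : IsOpen V) {q : E4 × ℝ}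
    (hq : q.1 ∈ V) {X : E4 × ℝ → E4} (hX : DifferentiableAt ℝ X q) (a : Fin 4) :
    ∃ L : E4 × ℝ →L[ℝ] ℝ, HasFDerivAt (fun p => coframeForm θ a p.1 (X p)) L q ∧
      ∀ w, L w = (dirD θ q.1 w.1 *ᵥ X q) a + coframeForm θ a q.1 (fderiv ℝ X q w) := by
  have h1 : HasFDerivAt (fun p : E4 × ℝ => coframeForm θ a p.1)
      ((fderiv ℝ (coframeForm θ a) q.1).comp (ContinuousLinearMap.fst ℝ E4 ℝ)) q :=
    (h.differentiableAt_coframeForm hV hq a).hasFDerivAt.comp q hasFDerivAt_fst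
  refine ⟨_, h1.clm_apply hX.hasFDerivAt, fun w => ?_⟩
  simp [h.fderiv_coframeForm hV hq, add_comm]

/-- The horizontal lift of a family of planes of the pencil with homogeneous coordinates
`[s(r) : t(r)]`: the plane is parallel along `w` if the derivative of `[s : t]` in the direction of the
fibre compensates the action of the trace of the connection. -/
theorem mem_horizontalLift (h : IsAdaptedCoframe V g K θ) (hK : IsParaKahlerOn V g K)
    (hV : IsOpen V) {s t : ℝ → ℝ} (hs : ContDiff ℝ ∞ s) (ht : ContDiff ℝ ∞ t)
    (hst : ∀ r, s r ^ 2 + t r ^ 2 ≠ 0) {q : E4 × ℝ} (hq : q.1 ∈ V) (w : E4 × ℝ) :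
    w ∈ horizontalLift (christoffel g) (fun q => pencilPlane θ q.1 (s q.2) (t q.2)) q ↔
      w.1 ∈ pencilPlane θ q.1 (s q.2) (t q.2) ∧
        (s q.2 * deriv t q.2 - t q.2 * deriv s q.2) * w.2
          + s q.2 * t q.2 * traceConn g θ q.1 w.1 = 0 := by
  have hg := hK.isMetricOn hV
  set N : E4 × ℝ → Submodule ℝ E4 := fun q => pencilPlane θ q.1 (s q.2) (t q.2) with hN
  -- the covariant derivative of a section `a Y + b Z` of the pencil, modulo the pencil
  have key : ∀ X, IsLocalSection N q X → ∀ a b : ℝ,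
      X q = a • pencilVecFst θ q.1 (s q.2) (t q.2) + b • pencilVecSnd θ q.1 (s q.2) (t q.2) →
      ∀ w : E4 × ℝ, let Z := fderiv ℝ X q w + fun k => ∑ i, ∑ j, christoffel g q.1 k i j * w.1 i * X q j
      let m := (s q.2 * deriv t q.2 - t q.2 * deriv s q.2) * w.2
          + s q.2 * t q.2 * traceConn g θ q.1 w.1
      s q.2 * coframeForm θ 0 q.1 Z + t q.2 * coframeForm θ 3 q.1 Z = -(a * m) ∧
        s q.2 * coframeForm θ 1 q.1 Z - t q.2 * coframeForm θ 2 q.1 Z = b * m := by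
    intro X hX a b hab w Z m
    obtain ⟨O, hO, hqO, hXO, hXN⟩ := hX
    have hXd : DifferentiableAt ℝ X q := (hXO.contDiffAt (hO.mem_nhds hqO)).differentiableAt (by simp)
    have hZ : Z = fderiv ℝ X q w + chrMat g q.1 w.1 *ᵥ X q := by
      simp only [Z]
      congr 1
      ext k
      simp only [Matrix.mulVec, dotProduct, chrMat, Matrix.of_apply, Finset.sum_mul]
      rw [Finset.sum_comm]
      exact Finset.sum_congr rfl fun _ _ => Finset.sum_congr rfl fun _ _ => by ring
    obtain ⟨e0, e1, e2, e3⟩ := h.coframeForm_pencil hq (s q.2) (t q.2) a b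
    rw [← hab] at e0 e1 e2 e3
    choose L hL hLw using h.hasFDerivAt_coframe_comp hV hq hXd
    have hθZ : ∀ c, coframeForm θ c q.1 Z = L c w + ∑ d, connectionForm g θ c d q.1 w.1 *
        coframeForm θ d q.1 (X q) := by
      intro c
      rw [hLw, hZ, map_add, coframeForm_apply θ c q.1 (chrMat g q.1 w.1 *ᵥ X q),
        h.dirD_coframe hV hq, Matrix.mulVec_mulVec, Matrix.sub_mulVec, ← Matrix.mulVec_mulVec]
      simp only [Pi.sub_apply, coframeForm_apply]
      have : ((connMat g θ q.1 w.1) *ᵥ (θ q.1 *ᵥ X q)) c =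
          ∑ d, connectionForm g θ c d q.1 w.1 * (θ q.1 *ᵥ X q) d := rfl
      rw [← this, Matrix.mulVec_mulVec (X q) (connMat g θ q.1 w.1) (θ q.1)]
      ring
    have hsd : HasFDerivAt (fun p : E4 × ℝ => s p.2) (deriv s q.2 • ContinuousLinearMap.snd ℝ E4 ℝ) q :=
      HasDerivAt.comp_hasFDerivAt q ((hs.differentiable (by simp)) q.2).hasDerivAt hasFDerivAt_snd
    have htd : HasFDerivAt (fun p : E4 × ℝ => t p.2) (deriv t q.2 • ContinuousLinearMap.snd ℝ E4 ℝ) q :=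
      HasDerivAt.comp_hasFDerivAt q ((ht.differentiable (by simp)) q.2).hasDerivAt hasFDerivAt_snd
    have hz : ∀ {f : E4 × ℝ → ℝ} {L : E4 × ℝ →L[ℝ] ℝ}, HasFDerivAt f L q → (∀ p ∈ O, f p = 0) →
        L w = 0 := by
      intro f L hf h0
      have : f =ᶠ[nhds q] fun _ => 0 := by
        filter_upwards [hO.mem_nhds hqO] with p hp using h0 p hp
      rw [← hf.fderiv, this.fderiv_eq]
      simp
    have d1 := hz ((hsd.fun_mul (hL 0)).fun_add (htd.fun_mul (hL 3)))
      fun p hp => (mem_pencilPlane.1 (hXN p hp)).1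
    have d2 := hz ((hsd.fun_mul (hL 1)).fun_sub (htd.fun_mul (hL 2)))
      fun p hp => (mem_pencilPlane.1 (hXN p hp)).2
    simp only [add_apply, sub_apply,
      smul_apply, smul_eq_mul, ContinuousLinearMap.coe_snd', e0, e1, e2, e3]
      at d1 d2
    obtain ⟨a1, a2, a3, a4, a5, a6, a7, a8, a9, a10, a11, a12⟩ := h.conn_eq hK hV hq
    simp only [hθZ, Fin.sum_univ_four, e0, e1, e2, e3, a1, a2, a3, a4, a5, a6, a7, a8, a9, a10, a11,
      a12, zero_apply, neg_apply, m, traceConn,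
      add_apply]
    constructor
    · linear_combination d1
    · linear_combination d2
  constructor
  · rintro ⟨h1, h2⟩
    refine ⟨h1, ?_⟩
    have hX : IsLocalSection N q fun p => pencilVecFst θ p.1 (s p.2) (t p.2) := by
      refine ⟨V ×ˢ Set.univ, hV.prod isOpen_univ, ⟨hq, trivial⟩, ?_, fun p hp => ?_⟩
      · have hf : ∀ c, ContDiffOn ℝ ∞ (fun p : E4 × ℝ => frameVec θ c p.1) (V ×ˢ Set.univ) :=
          fun c => (h.smooth_frameVec c).comp contDiffOn_fst fun p hp => hp.1
        exact ((ht.comp contDiff_snd).contDiffOn.neg.smul (hf 0)).add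
          ((hs.comp contDiff_snd).contDiffOn.smul (hf 3))
      · exact (h.mem_pencilPlane_iff_exists hp.1 (hst _)).2 ⟨1, 0, by simp⟩
    have h3 := (mem_pencilPlane.1 (h2 _ hX)).1
    rw [(key _ hX 1 0 (by simp) w).1] at h3
    linarith
  · rintro ⟨h1, h2⟩
    refine ⟨h1, fun X hX => ?_⟩
    obtain ⟨a, b, hab⟩ := (h.mem_pencilPlane_iff_exists hq (hst _)).1
      hX.eventually_mem.self_of_nhds
    refine mem_pencilPlane.2 ?_
    rw [(key X hX a b hab w).1, (key X hX a b hab w).2, h2]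
    simp

end IsAdaptedCoframe

end Lift

/-! ### The twistor distribution in a chart -/

noncomputable section TwistorCharts

/-- The homogeneous coordinate `s` of the point with affine coordinate `r` of the projective line:
`r = t / s`, or `r = s / t` in the chart at infinity. -/
def fibreFst (b : Bool) (r : ℝ) : ℝ := if b then r else 1

/-- The homogeneous coordinate `t` of the point with affine coordinate `r` of the projective
line. -/
def fibreSnd (b : Bool) (r : ℝ) : ℝ := if b then 1 else r

/-- The sign in `dr = ± r (Γ¹₁ + Γ²₂)`, for horizontal vectors. -/
def fibreSign (b : Bool) : ℝ := if b then 1 else -1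

/-- The coordinate `μ` as a function of the affine coordinate `r`. -/
def fibreMu (b : Bool) (r : ℝ) : ℝ := if b then r⁻¹ else r

theorem contDiff_fibreFst (b : Bool) : ContDiff ℝ ∞ (fibreFst b) := by
  cases b
  · exact contDiff_const
  · exact contDiff_id

theorem contDiff_fibreSnd (b : Bool) : ContDiff ℝ ∞ (fibreSnd b) := by
  cases b
  · exact contDiff_id
  · exact contDiff_const

theorem fibre_sq_ne_zero (b : Bool) (r : ℝ) : fibreFst b r ^ 2 + fibreSnd b r ^ 2 ≠ 0 := by
  cases b <;> simp [fibreFst, fibreSnd] <;> positivity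

theorem extDerivOne_comp_snd_smul {β : E4 → E4 →L[ℝ] ℝ} {f : ℝ → ℝ} {q : E4 × ℝ}
    (hf : DifferentiableAt ℝ f q.2) (hβ : DifferentiableAt ℝ β q.1) (u v : E4 × ℝ) :
    extDerivOne (fun p : E4 × ℝ => f p.2 • (β p.1).comp (ContinuousLinearMap.fst ℝ E4 ℝ)) q u v =
      f q.2 * extDerivOne β q.1 u.1 v.1
        + deriv f q.2 * (u.2 * β q.1 v.1 - v.2 * β q.1 u.1) := by
  have h1 : HasFDerivAt (fun p : E4 × ℝ => f p.2) (deriv f q.2 • ContinuousLinearMap.snd ℝ E4 ℝ) q :=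
    HasDerivAt.comp_hasFDerivAt q hf.hasDerivAt hasFDerivAt_snd
  have h2 : DifferentiableAt ℝ
      (fun p : E4 × ℝ => (β p.1).comp (ContinuousLinearMap.fst ℝ E4 ℝ)) q :=
    (hβ.comp q differentiableAt_fst).clm_comp (differentiableAt_const _)
  rw [extDerivOne_smul h1.differentiableAt h2, extDerivOne_comp_fst hβ, h1.fderiv]
  simp [wedgeOne]
  ring

/-- A symmetric bilinear form on a five-dimensional space has signature (3,2) if it is the
corresponding combination of squares of linear forms without common zeros. -/
theorem hasSignatureThreeTwo_of_forms {F : Type*} [NormedAddCommGroup F] [NormedSpace ℝ F]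
    [FiniteDimensional ℝ F] (hn : Module.finrank ℝ F = 5) {b : F → F → ℝ} (l : Fin 5 → F →L[ℝ] ℝ)
    (hl : ∀ v, (∀ i, l i v = 0) → v = 0)
    (hb : ∀ u v, b u v = l 0 u * l 0 v + l 1 u * l 1 v + l 2 u * l 2 v
      - l 3 u * l 3 v - l 4 u * l 4 v) : HasSignatureThreeTwo b := by
  let L : F →ₗ[ℝ] (Fin 5 → ℝ) := LinearMap.pi fun i => (l i).toLinearMap
  have hL : Function.Injective L := by
    rw [injective_iff_map_eq_zero]
    exact fun v hv => hl v fun i => congrFun hv i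
  let e : F ≃ₗ[ℝ] (Fin 5 → ℝ) := LinearEquiv.ofInjectiveOfFinrankEq L hL (by simp [hn])
  refine ⟨Module.Basis.ofEquivFun e, fun u v => ?_⟩
  have he : ∀ u i, (Module.Basis.ofEquivFun e).repr u i = l i u := fun u i => rfl
  simp only [he, hb]

namespace TwistorChart

variable {M : Type*} [TopologicalSpace M] [ChartedSpace E4 M] {g : BilinField M} {K : EndoField M}

theorem isParaKahlerOn (c : TwistorChart g K) (hgK : IsPKE g K) :
    IsParaKahlerOn c.V (coordMetric g c.φ) (coordEndo K c.φ) :=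
  (hgK c.φ c.mem_atlas).1.mono c.V_subset

theorem isEinsteinOn (c : TwistorChart g K) (hgK : IsPKE g K) :
    IsEinsteinOn c.V (coordMetric g c.φ) := fun y hy => (hgK c.φ c.mem_atlas).2 y (c.V_subset hy)

theorem isOpen_domain (c : TwistorChart g K) : IsOpen c.domain := c.isOpen_V.prod isOpen_univ

theorem plane_eq (c : TwistorChart g K) (q : E4 × ℝ) : c.plane q =
    pencilPlane c.θ q.1 (fibreFst c.atInfinity q.2) (fibreSnd c.atInfinity q.2) := by
  cases hb : c.atInfinity <;> simp [plane, fibreFst, fibreSnd, hb]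

/-- The twistor distribution in both kinds of charts; since `d(1/μ) = -dμ/μ²`, only the sign of the
last equation depends on the chart. -/
theorem mem_twistorDistribution (c : TwistorChart g K) (hgK : IsPKE g K) {q : E4 × ℝ}
    (hq : q ∈ c.domain) (w : E4 × ℝ) : w ∈ c.twistorDistribution q ↔
      w.1 ∈ pencilPlane c.θ q.1 (fibreFst c.atInfinity q.2) (fibreSnd c.atInfinity q.2) ∧
        w.2 = fibreSign c.atInfinity * q.2 * c.traceForm q w := by
  have hp : c.plane = fun q =>
      pencilPlane c.θ q.1 (fibreFst c.atInfinity q.2) (fibreSnd c.atInfinity q.2) :=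
    funext c.plane_eq
  rw [twistorDistribution, hp, c.adapted.mem_horizontalLift (c.isParaKahlerOn hgK) c.isOpen_V
    (contDiff_fibreFst _) (contDiff_fibreSnd _) (fibre_sq_ne_zero _) hq.1]
  refine and_congr_right fun _ => ?_
  have ht : c.traceForm q w = traceConn (coordMetric g c.φ) c.θ q.1 w.1 := rfl
  rw [ht]
  cases c.atInfinity
  · have e1 : deriv (fibreFst false) q.2 = 0 := by
      have : fibreFst false = fun _ => 1 := by funext; simp [fibreFst]
      rw [this, deriv_const]
    have e2 : deriv (fibreSnd false) q.2 = 1 := by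
      have : fibreSnd false = fun r => r := by funext; simp [fibreSnd]
      rw [this, deriv_id'']
    rw [e1, e2]
    simp only [fibreFst, fibreSnd, fibreSign, Bool.false_eq_true, if_false]
    constructor <;> intro h <;> linarith
  · have e1 : deriv (fibreSnd true) q.2 = 0 := by
      have : fibreSnd true = fun _ => 1 := by funext; simp [fibreSnd]
      rw [this, deriv_const]
    have e2 : deriv (fibreFst true) q.2 = 1 := by
      have : fibreFst true = fun r => r := by funext; simp [fibreFst]
      rw [this, deriv_id'']
    rw [e1, e2]
    simp only [fibreFst, fibreSnd, fibreSign, if_true]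
    constructor <;> intro h <;> linarith

theorem contDiffOn_traceForm (c : TwistorChart g K) (hgK : IsPKE g K) :
    ContDiffOn ℝ ∞ c.traceForm c.domain := by
  have hg := (c.isParaKahlerOn hgK).isMetricOn c.isOpen_V
  have h1 : ContDiffOn ℝ ∞ (traceConn (coordMetric g c.φ) c.θ) c.V :=
    (c.adapted.smooth_connectionForm hg 0 0).add (c.adapted.smooth_connectionForm hg 1 1)
  exact (h1.comp contDiffOn_fst fun q hq => hq.1).clm_comp contDiffOn_const

theorem isSmoothDistribution (c : TwistorChart g K) (hgK : IsPKE g K) :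
    IsSmoothDistribution 2 c.twistorDistribution c.domain := by
  have hT := c.contDiffOn_traceForm hgK
  have hfst : ContDiffOn ℝ ∞ (fun p : E4 × ℝ => fibreFst c.atInfinity p.2) c.domain :=
    ((contDiff_fibreFst _).comp contDiff_snd).contDiffOn
  have hsnd : ContDiffOn ℝ ∞ (fun p : E4 × ℝ => fibreSnd c.atInfinity p.2) c.domain :=
    ((contDiff_fibreSnd _).comp contDiff_snd).contDiffOn
  have hf : ∀ a, ContDiffOn ℝ ∞ (fun p : E4 × ℝ => frameVec c.θ a p.1) c.domain := fun a =>
    (c.adapted.smooth_frameVec a).comp contDiffOn_fst fun p hp => hp.1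
  let Y : Fin 2 → E4 × ℝ → E4 := fun i p =>
    ![pencilVecFst c.θ p.1 (fibreFst c.atInfinity p.2) (fibreSnd c.atInfinity p.2),
      pencilVecSnd c.θ p.1 (fibreFst c.atInfinity p.2) (fibreSnd c.atInfinity p.2)] i
  have hY : ∀ i, ContDiffOn ℝ ∞ (Y i) c.domain := by
    intro i
    fin_cases i
    · exact (hsnd.neg.smul (hf 0)).add (hfst.smul (hf 3))
    · exact (hsnd.smul (hf 1)).add (hfst.smul (hf 2))
  let X : Fin 2 → E4 × ℝ → E4 × ℝ := fun i p =>
    (Y i p, fibreSign c.atInfinity * p.2 * c.traceForm p (Y i p, 0))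
  have htr : ∀ p (w w' : E4 × ℝ), w.1 = w'.1 → c.traceForm p w = c.traceForm p w' := by
    intro p w w' h
    simp [traceForm, h]
  refine isSmoothDistribution_of_frame c.isOpen_domain X (fun i => ?_) (fun q hq => ?_)
    (fun q hq => ?_)
  · exact (hY i).prodMk ((contDiffOn_const.mul contDiffOn_snd).mul
      (hT.clm_apply ((hY i).prodMk contDiffOn_const)))
  · rw [Fintype.linearIndependent_iff]
    intro a ha
    have h1 := congrArg Prod.fst ha
    simp only [Fin.sum_univ_two, X, Y, Prod.fst_add, Prod.smul_fst, Matrix.cons_val_zero,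
      Matrix.cons_val_one, Prod.fst_zero] at h1
    obtain ⟨e0, e1, e2, e3⟩ := c.adapted.coframeForm_pencil hq.1 (fibreFst c.atInfinity q.2)
      (fibreSnd c.atInfinity q.2) (a 0) (a 1)
    rw [h1] at e0 e1 e2 e3
    simp only [map_zero] at e0 e1 e2 e3
    have hst := fibre_sq_ne_zero c.atInfinity q.2
    have f0 : a 0 = 0 := by
      refine (mul_eq_zero.1 ?_).resolve_left hst
      linear_combination -fibreFst c.atInfinity q.2 * e3 + fibreSnd c.atInfinity q.2 * e0
    have f1 : a 1 = 0 := by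
      refine (mul_eq_zero.1 ?_).resolve_left hst
      linear_combination -fibreFst c.atInfinity q.2 * e2 - fibreSnd c.atInfinity q.2 * e1
    intro i
    fin_cases i
    · exact f0
    · exact f1
  · ext w
    rw [c.mem_twistorDistribution hgK hq, c.adapted.mem_pencilPlane_iff_exists hq.1
      (fibre_sq_ne_zero _ _), Submodule.mem_span_range_iff_exists_fun]
    have hlin : ∀ a b : ℝ, c.traceForm q (a • Y 0 q + b • Y 1 q, 0) =
        a * c.traceForm q (Y 0 q, 0) + b * c.traceForm q (Y 1 q, 0) := by
      intro a b
      rw [← smul_eq_mul, ← smul_eq_mul, ← map_smul, ← map_smul, ← map_add]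
      exact htr _ _ _ (by simp)
    constructor
    · rintro ⟨⟨a, b, h1⟩, h2⟩
      refine ⟨![a, b], ?_⟩
      rw [htr q w (a • Y 0 q + b • Y 1 q, 0) h1, hlin] at h2
      refine Prod.ext ?_ ?_
      · rw [h1]; simp [X, Y]
      · rw [h2]; simp [X]; ring
    · rintro ⟨a, rfl⟩
      refine ⟨⟨a 0, a 1, by simp [X, Y]⟩, ?_⟩
      rw [htr q _ (a 0 • Y 0 q + a 1 • Y 1 q, 0) (by simp [X]), hlin]
      simp [X]
      ring

theorem mem_twistorDistribution_iff (c : TwistorChart g K) (hgK : IsPKE g K)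
    (hc : c.atInfinity = false) {q : E4 × ℝ} (hq : q ∈ c.domain) (w : E4 × ℝ) :
    w ∈ c.twistorDistribution q ↔
      (c.thetaForm 0 q + q.2 • c.thetaForm 3 q) w = 0 ∧
        (c.thetaForm 1 q - q.2 • c.thetaForm 2 q) w = 0 ∧
        (TwistorChart.dFibre + q.2 • c.traceForm q) w = 0 := by
  rw [c.mem_twistorDistribution hgK hq, mem_pencilPlane, and_assoc, hc]
  simp only [fibreFst, fibreSnd, fibreSign, Bool.false_eq_true, if_false, one_mul, thetaForm,
    dFibre, add_apply, sub_apply,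
    smul_apply, smul_eq_mul, ContinuousLinearMap.comp_apply,
    ContinuousLinearMap.coe_fst', ContinuousLinearMap.coe_snd']
  refine and_congr_right fun _ => and_congr_right fun _ => ?_
  constructor <;> intro h <;> linarith

/-- Along the hypersurfaces `ℋ` and `ℋ̄`, the exterior derivatives of the three forms defining the
twistor distribution vanish on it, so that brackets of its sections stay in it. -/
theorem derivedSystem_eq (c : TwistorChart g K) (hgK : IsPKE g K) {q : E4 × ℝ}
    (hq : q ∈ c.domain) (h0 : q.2 = 0) :
    derivedSystem c.twistorDistribution q = c.twistorDistribution q := by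
  refine le_antisymm (fun v hv => ?_) (le_derivedSystem (c.isSmoothDistribution hgK) hq)
  have hK := c.isParaKahlerOn hgK
  have hg := hK.isMetricOn c.isOpen_V
  have hθ : ∀ a, DifferentiableAt ℝ (coframeForm c.θ a) q.1 := fun a =>
    c.adapted.differentiableAt_coframeForm c.isOpen_V hq.1 a
  have hT : DifferentiableAt ℝ (traceConn (coordMetric g c.φ) c.θ) q.1 :=
    (c.adapted.differentiableAt_connectionForm hg hq.1 0 0).add
      (c.adapted.differentiableAt_connectionForm hg hq.1 1 1)
  have hlift : ∀ {β : E4 → E4 →L[ℝ] ℝ} {f : ℝ → ℝ}, DifferentiableAt ℝ β q.1 → ContDiff ℝ ∞ f →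
      DifferentiableAt ℝ (fun p : E4 × ℝ => f p.2 •
        (β p.1).comp (ContinuousLinearMap.fst ℝ E4 ℝ)) q := by
    intro β f hβ hf
    exact ((hf.differentiable (by simp)).differentiableAt.comp q differentiableAt_snd).smul
      ((hβ.comp q differentiableAt_fst).clm_comp (differentiableAt_const _))
  have hs := contDiff_fibreFst c.atInfinity
  have ht := contDiff_fibreSnd c.atInfinity
  have hsd := (hs.differentiable (by simp)) q.2
  have htd := (ht.differentiable (by simp)) q.2
  have hmem : ∀ᶠ p in nhds q, ∀ w, w ∈ c.twistorDistribution p ↔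
      w.1 ∈ pencilPlane c.θ p.1 (fibreFst c.atInfinity p.2) (fibreSnd c.atInfinity p.2) ∧
        w.2 = fibreSign c.atInfinity * p.2 * c.traceForm p w := by
    filter_upwards [c.isOpen_domain.mem_nhds hq] with p hp w
      using c.mem_twistorDistribution hgK hp w
  have hD : ∀ u, u ∈ c.twistorDistribution q → u.2 = 0 := fun u hu => by
    rw [((c.mem_twistorDistribution hgK hq u).1 hu).2, h0]; ring
  have hP : ∀ u, u ∈ c.twistorDistribution q → _ := fun u hu =>
    mem_pencilPlane.1 ((c.mem_twistorDistribution hgK hq u).1 hu).1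
  have k1 := derivedSystem_le_ker (D := c.twistorDistribution) (q := q)
    (β := fun p : E4 × ℝ =>
      fibreFst c.atInfinity p.2 • (coframeForm c.θ 0 p.1).comp (ContinuousLinearMap.fst ℝ E4 ℝ)
      + fibreSnd c.atInfinity p.2 • (coframeForm c.θ 3 p.1).comp (ContinuousLinearMap.fst ℝ E4 ℝ))
    ((hlift (hθ 0) hs).add (hlift (hθ 3) ht))
    (by
      filter_upwards [hmem] with p hp w hw
      simpa using (mem_pencilPlane.1 ((hp w).1 hw).1).1)
    (fun u hu v hv => by
      rw [extDerivOne_add (hlift (hθ 0) hs) (hlift (hθ 3) ht), extDerivOne_comp_snd_smul hsd (hθ 0),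
        extDerivOne_comp_snd_smul htd (hθ 3), hD u hu, hD v hv,
        (c.adapted.extDerivOne_coframe hK c.isOpen_V hq.1 u.1 v.1).1,
        (c.adapted.extDerivOne_coframe hK c.isOpen_V hq.1 u.1 v.1).2.2.2]
      obtain ⟨a1, a2⟩ := hP u hu
      obtain ⟨b1, b2⟩ := hP v hv
      rw [h0] at a1 a2 b1 b2 ⊢
      cases hb : c.atInfinity
      · simp [hb, fibreFst, fibreSnd] at a1 a2 b1 b2
        simp [fibreFst, fibreSnd, wedgeOne, a1, a2, b1, b2]
      · simp [hb, fibreFst, fibreSnd] at a1 a2 b1 b2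
        simp [fibreFst, fibreSnd, wedgeOne, a1, a2, b1, b2]) v hv
  have k2 := derivedSystem_le_ker (D := c.twistorDistribution) (q := q)
    (β := fun p : E4 × ℝ =>
      fibreFst c.atInfinity p.2 • (coframeForm c.θ 1 p.1).comp (ContinuousLinearMap.fst ℝ E4 ℝ)
      - fibreSnd c.atInfinity p.2 • (coframeForm c.θ 2 p.1).comp (ContinuousLinearMap.fst ℝ E4 ℝ))
    ((hlift (hθ 1) hs).sub (hlift (hθ 2) ht))
    (by
      filter_upwards [hmem] with p hp w hw
      simpa using (mem_pencilPlane.1 ((hp w).1 hw).1).2)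
    (fun u hu v hv => by
      rw [extDerivOne_sub (hlift (hθ 1) hs) (hlift (hθ 2) ht), extDerivOne_comp_snd_smul hsd (hθ 1),
        extDerivOne_comp_snd_smul htd (hθ 2), hD u hu, hD v hv,
        (c.adapted.extDerivOne_coframe hK c.isOpen_V hq.1 u.1 v.1).2.1,
        (c.adapted.extDerivOne_coframe hK c.isOpen_V hq.1 u.1 v.1).2.2.1]
      obtain ⟨a1, a2⟩ := hP u hu
      obtain ⟨b1, b2⟩ := hP v hv
      rw [h0] at a1 a2 b1 b2 ⊢
      cases hb : c.atInfinity
      · simp [hb, fibreFst, fibreSnd] at a1 a2 b1 b2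
        simp [fibreFst, fibreSnd, wedgeOne, a1, a2, b1, b2]
      · simp [hb, fibreFst, fibreSnd] at a1 a2 b1 b2
        simp [fibreFst, fibreSnd, wedgeOne, a1, a2, b1, b2]) v hv
  have hm : ContDiff ℝ ∞ fun r : ℝ => fibreSign c.atInfinity * r := contDiff_const.mul contDiff_id
  have hmd := (hm.differentiable (by simp)) q.2
  have k3 := derivedSystem_le_ker (D := c.twistorDistribution) (q := q)
    (β := fun p : E4 × ℝ => dFibre - (fibreSign c.atInfinity * p.2) •
      (traceConn (coordMetric g c.φ) c.θ p.1).comp (ContinuousLinearMap.fst ℝ E4 ℝ))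
    ((differentiableAt_const dFibre).sub (hlift hT hm))
    (by
      filter_upwards [hmem] with p hp w hw
      exact sub_eq_zero.2 ((hp w).1 hw).2)
    (fun u hu v hv => by
      rw [extDerivOne_sub (differentiableAt_const _) (hlift hT hm),
        extDerivOne_comp_snd_smul hmd hT, hD u hu, hD v hv, h0]
      simp [extDerivOne]) v hv
  refine (c.mem_twistorDistribution hgK hq v).2 ⟨mem_pencilPlane.2 ⟨?_, ?_⟩, sub_eq_zero.1 k3⟩
  · simpa using k1
  · simpa using k2

theorem psi_ne_zero (c : TwistorChart g K) (hgK : IsPKE g K) (hs : HasNonzeroScalarCurvature g)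
    {q : E4 × ℝ} (hq : q ∈ c.domain) : c.psi q ≠ 0 := by
  have h := c.adapted.psiTwo_eq (c.isParaKahlerOn hgK) c.isOpen_V (c.isEinsteinOn hgK) hq.1
  rw [psi, h]
  have := hs c.φ c.mem_atlas q.1 (c.V_subset hq.1)
  simpa [neg_div] using this

/-- After the rescaling by `μ`, the twistor distribution is, near each point of `𝒩₊*`, the kernel
of `θ¹ + θ⁴`, `θ² - θ³` and of the trace of the connection form of a para-Kähler–Einstein frame. -/
theorem exists_frame (c : TwistorChart g K) (hgK : IsPKE g K) {q₀ : E4 × ℝ}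
    (hq₀ : q₀ ∈ c.punctured) : ∃ O, IsOpen O ∧ q₀ ∈ O ∧ O ⊆ c.punctured ∧
      (∀ q ∈ O, c.psi q = c.psi q₀) ∧
      ∃ (θ : Fin 4 → E4 × ℝ → E4 × ℝ →L[ℝ] ℝ) (A : Fin 2 → Fin 2 → E4 × ℝ → E4 × ℝ →L[ℝ] ℝ),
        IsParaKahlerEinsteinFrame O θ A (c.psi q₀) ∧
        ∀ q ∈ O, θ 0 q = (fibreMu c.atInfinity q.2)⁻¹ • c.thetaForm 0 q ∧
          θ 1 q = c.thetaForm 1 q ∧ θ 2 q = fibreMu c.atInfinity q.2 • c.thetaForm 2 q ∧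
          θ 3 q = c.thetaForm 3 q ∧
          A 0 0 q + A 1 1 q = (-fibreSign c.atInfinity / q.2) • dFibre + c.traceForm q := by
  obtain ⟨B, hB, hqB, hBV, hψ, hf⟩ := c.adapted.exists_isParaKahlerEinsteinFrame
    (c.isParaKahlerOn hgK) c.isOpen_V (c.isEinsteinOn hgK) hq₀.1.1
  have hO : IsOpen {q : E4 × ℝ | q.1 ∈ B ∧ q.2 ≠ 0} :=
    (hB.preimage continuous_fst).inter (isOpen_ne.preimage continuous_snd)
  have hμ : ContDiffOn ℝ ∞ (fun q : E4 × ℝ => fibreMu c.atInfinity q.2)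
      {q : E4 × ℝ | q.1 ∈ B ∧ q.2 ≠ 0} := by
    cases c.atInfinity
    · exact contDiffOn_snd
    · exact contDiffOn_snd.inv fun q hq => hq.2
  have hμ0 : ∀ q ∈ {q : E4 × ℝ | q.1 ∈ B ∧ q.2 ≠ 0}, fibreMu c.atInfinity q.2 ≠ 0 := by
    intro q hq
    cases c.atInfinity
    · exact hq.2
    · exact inv_ne_zero hq.2
  refine ⟨_, hO, ⟨hqB, hq₀.2⟩, fun q hq => ⟨⟨hBV hq.1, trivial⟩, hq.2⟩, fun q hq => hψ _ hq.1,
    _, _, (hf.comp_fst hB fun q hq => hq.1).rescale hO hμ hμ0, fun q hq =>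
      ⟨rfl, rfl, rfl, rfl, ?_⟩⟩
  have hd : (fibreMu c.atInfinity q.2)⁻¹ •
      fderiv ℝ (fun q : E4 × ℝ => fibreMu c.atInfinity q.2) q =
        (-fibreSign c.atInfinity / q.2) • dFibre := by
    cases c.atInfinity
    · have : (fun q : E4 × ℝ => fibreMu false q.2) = Prod.snd := by funext; simp [fibreMu]
      rw [this, fderiv_snd]
      simp [fibreMu, fibreSign, dFibre]
    · have h1 : HasFDerivAt (fun q : E4 × ℝ => fibreMu true q.2)
          ((-(q.2 ^ 2)⁻¹) • ContinuousLinearMap.snd ℝ E4 ℝ) q := by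
        have h2 : (fun q : E4 × ℝ => fibreMu true q.2) = fun q => (q.2)⁻¹ := by
          funext; simp [fibreMu]
        rw [h2]
        exact HasDerivAt.comp_hasFDerivAt q (hasDerivAt_inv hq.2) hasFDerivAt_snd
      rw [h1.fderiv, smul_smul]
      congr 1
      have := hq.2
      simp only [fibreMu, fibreSign, if_true]
      field_simp
  rw [← hd, traceForm, ContinuousLinearMap.add_comp]
  exact (congrArg₂ (· + ·) (add_comm _ _) rfl).trans (add_assoc _ _ _)

theorem finrank_prod_eq_five : Module.finrank ℝ (E4 × ℝ) = 5 := by simp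

theorem eq_zero_of_forms (c : TwistorChart g K) {q : E4 × ℝ} (hq : q ∈ c.punctured)
    {m : ℝ} (hm : m ≠ 0) {v : E4 × ℝ} (hv : ∀ a, c.thetaForm a q v = 0)
    (ht : (m • dFibre + c.traceForm q) v = 0) : v = 0 := by
  have h1 : v.1 = 0 := by
    rw [c.adapted.eq_sum_frameVec hq.1.1 v.1]
    exact Finset.sum_eq_zero fun a _ => by
      have : coframeForm c.θ a q.1 v.1 = 0 := hv a
      rw [this, zero_smul]
  have h2 : v.2 = 0 := by
    simpa [traceForm, h1, dFibre, hm] using ht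
  exact Prod.ext h1 h2

/-- The rescaled coframe is a coframe of the five-dimensional space, and it describes the twistor
distribution at `q`. -/
theorem frame_conditions (c : TwistorChart g K) (hgK : IsPKE g K) {q : E4 × ℝ}
    (hq : q ∈ c.punctured) {θ : Fin 4 → E4 × ℝ →L[ℝ] ℝ} {T : E4 × ℝ →L[ℝ] ℝ}
    (e0 : θ 0 = (fibreMu c.atInfinity q.2)⁻¹ • c.thetaForm 0 q) (e1 : θ 1 = c.thetaForm 1 q)
    (e2 : θ 2 = fibreMu c.atInfinity q.2 • c.thetaForm 2 q) (e3 : θ 3 = c.thetaForm 3 q)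
    (eT : T = (-fibreSign c.atInfinity / q.2) • dFibre + c.traceForm q) :
    (∀ v, (∀ a, θ a v = 0) → T v = 0 → v = 0) ∧
      ∀ v, v ∈ c.twistorDistribution q ↔
        ((θ 0 + θ 3) v = 0 ∧ (θ 1 - θ 2) v = 0 ∧ T v = 0) := by
  have hr := hq.2
  have hμ : fibreMu c.atInfinity q.2 ≠ 0 := by
    cases c.atInfinity
    · exact hr
    · exact inv_ne_zero hr
  have hε : -fibreSign c.atInfinity / q.2 ≠ 0 := by
    refine div_ne_zero ?_ hr
    cases c.atInfinity <;> simp [fibreSign]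
  constructor
  · intro v hv hT
    refine c.eq_zero_of_forms hq hε (fun a => ?_) (eT ▸ hT)
    have h0 := hv 0
    have h2 := hv 2
    rw [e0, smul_apply, smul_eq_mul, mul_eq_zero] at h0
    rw [e2, smul_apply, smul_eq_mul, mul_eq_zero] at h2
    fin_cases a
    · exact h0.resolve_left (inv_ne_zero hμ)
    · exact e1 ▸ hv 1
    · exact h2.resolve_left hμ
    · exact e3 ▸ hv 3
  · intro v
    have ht : ∀ a, c.thetaForm a q v = coframeForm c.θ a q.1 v.1 := fun a => rfl
    rw [c.mem_twistorDistribution hgK hq.1, mem_pencilPlane, and_assoc, e0, e1, e2, e3, eT]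
    simp only [add_apply, sub_apply,
      smul_apply, smul_eq_mul, ht, dFibre, ContinuousLinearMap.coe_snd']
    generalize coframeForm c.θ 0 q.1 v.1 = x0
    generalize coframeForm c.θ 1 q.1 v.1 = x1
    generalize coframeForm c.θ 2 q.1 v.1 = x2
    generalize coframeForm c.θ 3 q.1 v.1 = x3
    cases c.atInfinity
    · simp only [fibreMu, fibreFst, fibreSnd, fibreSign, Bool.false_eq_true, if_false, one_mul]
      refine and_congr ?_ (and_congr_right fun _ => ?_)
      · field_simp
        rw [mul_zero]
      · field_simp
        constructor <;> intro h <;> linarith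
    · simp only [fibreMu, fibreFst, fibreSnd, fibreSign, if_true, one_mul, inv_inv]
      refine and_congr_right fun _ => and_congr ?_ ?_
      · field_simp
        rw [mul_zero]
      · field_simp
        constructor <;> intro h <;> linarith

/-- The (2,3,5)-condition is local, so it may be checked in the frames of `exists_frame`. -/
theorem is235On (c : TwistorChart g K) (hgK : IsPKE g K) (hs : HasNonzeroScalarCurvature g) :
    Is235On c.twistorDistribution c.punctured := by
  have key : ∀ q ∈ c.punctured, ∃ O, q ∈ O ∧ Is235On c.twistorDistribution O := by
    intro q₀ hq₀
    obtain ⟨O, hO, hqO, hOp, -, θ, A, hf, he⟩ := c.exists_frame hgK hq₀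
    refine ⟨O, hqO, hf.is235On finrank_prod_eq_five hO (c.psi_ne_zero hgK hs hq₀.1)
      (fun q hq => ?_) (fun q hq => ?_)⟩
    · obtain ⟨e0, e1, e2, e3, eT⟩ := he q hq
      exact (c.frame_conditions hgK (hOp hq) (θ := fun a => θ a q) e0 e1 e2 e3 eT).1
    · obtain ⟨e0, e1, e2, e3, eT⟩ := he q hq
      exact (c.frame_conditions hgK (hOp hq) (θ := fun a => θ a q) e0 e1 e2 e3 eT).2
  refine ⟨fun q hq => c.isSmoothDistribution hgK q hq.1, fun q hq => ?_, fun q hq => ?_⟩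
  · obtain ⟨O, hqO, h⟩ := key q hq
    exact h.2.1 q hqO
  · obtain ⟨O, hqO, h⟩ := key q hq
    exact h.2.2 q hqO

/-- The Cartan gauge of the rescaled frame determines the conformal structure, by
`nurowskiForm_gauge`. -/
theorem representsConformalStructure (c : TwistorChart g K) (hgK : IsPKE g K)
    (hs : HasNonzeroScalarCurvature g) (hc : c.atInfinity = false) :
    RepresentsConformalStructure c.twistorDistribution c.punctured c.metricH := by
  intro q₀ hq₀
  obtain ⟨O, hO, hqO, hOp, hψ, θ, A, hf, he⟩ := c.exists_frame hgK hq₀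
  have hΨ := c.psi_ne_zero hgK hs hq₀.1
  refine ⟨O, hO, hqO, hOp, _, _, hf.isCartanGauge finrank_prod_eq_five hO hΨ
      (fun q hq => ?_) (fun q hq => ?_),
    -- in the gauge of the rescaled frame, `h` is this multiple of the associated bilinear form
    fun q => 1 / (16 * q.2 ^ 2), ?_, fun q hq => ⟨?_, ?_⟩⟩
  · obtain ⟨e0, e1, e2, e3, eT⟩ := he q hq
    exact (c.frame_conditions hgK (hOp hq) (θ := fun a => θ a q) e0 e1 e2 e3 eT).1
  · obtain ⟨e0, e1, e2, e3, eT⟩ := he q hq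
    exact (c.frame_conditions hgK (hOp hq) (θ := fun a => θ a q) e0 e1 e2 e3 eT).2
  · refine contDiffOn_const.div (contDiffOn_const.mul (contDiffOn_snd.pow 2)) fun q hq => ?_
    have := (hOp hq).2
    positivity
  · have := (hOp hq).2
    positivity
  · intro u v
    have hr := (hOp hq).2
    obtain ⟨e0, e1, e2, e3, eT⟩ := he q hq
    rw [IsParaKahlerEinsteinFrame.nurowskiForm_gauge hΨ, e0, e1, e2, e3, eT, metricH, hψ q hq, hc]
    simp only [fibreMu, fibreSign, Bool.false_eq_true, if_false, neg_neg, symProd,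
      add_apply, smul_apply, smul_eq_mul]
    field_simp
    ring

theorem hasSignatureThreeTwo (c : TwistorChart g K) (hgK : IsPKE g K)
    (hs : HasNonzeroScalarCurvature g) {q : E4 × ℝ} (hq : q ∈ c.punctured) :
    HasSignatureThreeTwo (c.metricH q) := by
  have hΨ := c.psi_ne_zero hgK hs hq.1
  have hr := hq.2
  -- the sign of `Ψ₂'` decides which of the null combinations are positive
  obtain ⟨k, σ, hk, hσ, hkσ⟩ : ∃ k σ : ℝ, k ≠ 0 ∧ σ ^ 2 = 1 ∧
      1 / (6 * q.2 ^ 2 * c.psi q) = 4 * (σ * k ^ 2) := by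
    set a := 1 / (6 * q.2 ^ 2 * c.psi q) with ha
    have ha0 : a ≠ 0 := by rw [ha]; positivity
    rcases lt_or_gt_of_ne ha0 with h | h
    · refine ⟨√(-a / 4), -1, (Real.sqrt_pos.2 (by linarith)).ne', by norm_num, ?_⟩
      rw [Real.sq_sqrt (by linarith)]; ring
    · refine ⟨√(a / 4), 1, (Real.sqrt_pos.2 (by linarith)).ne', by norm_num, ?_⟩
      rw [Real.sq_sqrt (by linarith)]; ring
  obtain ⟨m, hm, hm2⟩ : ∃ m : ℝ, m ≠ 0 ∧ 1 / (54 * q.2 ^ 2 * c.psi q ^ 2) = m ^ 2 := by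
    have : 0 < 1 / (54 * q.2 ^ 2 * c.psi q ^ 2) := by positivity
    exact ⟨_, (Real.sqrt_pos.2 this).ne', (Real.sq_sqrt this.le).symm⟩
  let l : Fin 5 → E4 × ℝ →L[ℝ] ℝ :=
    ![k • (c.thetaForm 0 q + σ • c.thetaForm 2 q), k • (c.thetaForm 1 q + σ • c.thetaForm 3 q),
      m • ((1 / q.2) • dFibre + c.traceForm q), k • (c.thetaForm 0 q - σ • c.thetaForm 2 q),
      k • (c.thetaForm 1 q - σ • c.thetaForm 3 q)]
  refine hasSignatureThreeTwo_of_forms finrank_prod_eq_five l (fun v hv => ?_) fun u v => ?_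
  · have h0 := hv 0
    have h1 := hv 1
    have h2 := hv 2
    have h3 := hv 3
    have h4 := hv 4
    simp only [l, Matrix.cons_val, smul_apply, add_apply,
      sub_apply, smul_eq_mul, mul_eq_zero, hk, hm, false_or] at h0 h1 h2 h3 h4
    have hσ0 : σ ≠ 0 := fun h => by simp [h] at hσ
    refine c.eq_zero_of_forms hq (one_div_ne_zero hr) (fun a => ?_) (by simpa using h2)
    fin_cases a
    · change c.thetaForm 0 q v = 0
      linarith
    · change c.thetaForm 1 q v = 0
      linarith
    · change c.thetaForm 2 q v = 0
      refine (mul_eq_zero.1 ?_).resolve_left hσ0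
      linarith
    · change c.thetaForm 3 q v = 0
      refine (mul_eq_zero.1 ?_).resolve_left hσ0
      linarith
  · rw [metricH, hkσ, hm2]
    simp only [l, Matrix.cons_val, smul_apply, add_apply,
      sub_apply, smul_eq_mul, symProd]
    ring

end TwistorChart

end TwistorCharts

/-! ### Charts and coordinate expressions -/

noncomputable section ChartCalculus

variable {M : Type*} [TopologicalSpace M] [ChartedSpace E4 M]
  {g : BilinField M} {K : EndoField M} {φ φ' : OpenPartialHomeomorph M E4} {y : E4}

theorem mdifferentiable_of_mem_maximalAtlas
    (hφ : φ ∈ IsManifold.maximalAtlas 𝓘(ℝ, E4) ∞ M) :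
    φ.MDifferentiable 𝓘(ℝ, E4) 𝓘(ℝ, E4) :=
  ⟨(contMDiffOn_of_mem_maximalAtlas hφ).mdifferentiableOn (by simp),
    (contMDiffOn_symm_of_mem_maximalAtlas hφ).mdifferentiableOn (by simp)⟩

/-- The differential of a chart, as a linear equivalence inverse to `chartInvD`. -/
theorem exists_chartEquiv (hφ : φ ∈ IsManifold.maximalAtlas 𝓘(ℝ, E4) ∞ M) (hy : y ∈ φ.target) :
    ∃ e : TangentSpace 𝓘(ℝ, E4) (φ.symm y) ≃ₗ[ℝ] E4, (∀ v, e (chartInvD φ y v) = v) ∧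
      (∀ X, chartInvD φ y (e X) = X) ∧
      ∀ X, e X = (show E4 from mfderiv 𝓘(ℝ, E4) 𝓘(ℝ, E4) φ (φ.symm y) X) := by
  have hm := mdifferentiable_of_mem_maximalAtlas hφ
  have h1 := hm.comp_symm_deriv hy
  have h2 := hm.symm_comp_deriv (φ.map_target hy)
  rw [φ.right_inv hy] at h2
  let f : TangentSpace 𝓘(ℝ, E4) (φ.symm y) →ₗ[ℝ] E4 :=
    (show TangentSpace 𝓘(ℝ, E4) (φ.symm y) →L[ℝ] E4 from
      mfderiv 𝓘(ℝ, E4) 𝓘(ℝ, E4) φ (φ.symm y)).toLinearMap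
  have k1 : ∀ v, f (chartInvD φ y v) = v := fun v => DFunLike.congr_fun h1 v
  have k2 : ∀ X, chartInvD φ y (f X) = X := fun X => DFunLike.congr_fun h2 X
  exact ⟨LinearEquiv.ofLinearMap f (chartInvD φ y).toLinearMap (LinearMap.ext k1) (LinearMap.ext k2),
    k1, k2, fun _ => rfl⟩

theorem metric_chartInvD (g : BilinField M) (φ : OpenPartialHomeomorph M E4) (y u v : E4) :
    g (φ.symm y) (chartInvD φ y u) (chartInvD φ y v) = u ⬝ᵥ coordMetric g φ y *ᵥ v := by
  conv_lhs => rw [pi_eq_sum_univ' u, pi_eq_sum_univ' v]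
  simp only [map_sum, map_smul, sum_apply, smul_apply,
    smul_eq_mul, dotProduct, Matrix.mulVec, coordMetric, Matrix.of_apply, Finset.mul_sum]
  rw [Finset.sum_comm]
  exact Finset.sum_congr rfl fun _ _ => Finset.sum_congr rfl fun _ _ => by ring

theorem endo_chartInvD (hφ : φ ∈ IsManifold.maximalAtlas 𝓘(ℝ, E4) ∞ M) (hy : y ∈ φ.target)
    (v : E4) :
    K (φ.symm y) (chartInvD φ y v) = chartInvD φ y (coordEndo K φ y *ᵥ v) := by
  obtain ⟨e, h1, h2, h3⟩ := exists_chartEquiv hφ hy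
  have h4 : coordEndo K φ y *ᵥ v = e (K (φ.symm y) (chartInvD φ y v)) := by
    conv_rhs => rw [pi_eq_sum_univ' v]
    ext i
    simp only [map_sum, map_smul, Matrix.mulVec, dotProduct, coordEndo, Matrix.of_apply, ← h3,
      Finset.sum_apply, Pi.smul_apply, smul_eq_mul]
    exact Finset.sum_congr rfl fun _ _ => mul_comm _ _
  rw [h4, h2]

namespace TwistorChart

/-- The components of a tangent vector in an adapted coframe. -/
theorem exists_frameEquiv (c : TwistorChart g K) (hy : y ∈ c.V) :
    ∃ e : TangentSpace 𝓘(ℝ, E4) (c.φ.symm y) ≃ₗ[ℝ] E4,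
      (∀ v, e (chartInvD c.φ y v) = c.θ y *ᵥ v) ∧
      (∀ X Y, g (c.φ.symm y) X Y = e X ⬝ᵥ nullForm *ᵥ e Y) ∧
      ∀ X, e (K (c.φ.symm y) X) = signMat *ᵥ e X := by
  obtain ⟨e, h1, h2, -⟩ := exists_chartEquiv c.mem_atlas (c.V_subset hy)
  have hinv : ∀ v, (c.θ y)⁻¹ *ᵥ (c.θ y *ᵥ v) = v := fun v => by
    rw [Matrix.mulVec_mulVec, c.adapted.inv_mul hy, Matrix.one_mulVec]
  have hinv' : ∀ v, c.θ y *ᵥ ((c.θ y)⁻¹ *ᵥ v) = v := fun v => by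
    rw [Matrix.mulVec_mulVec, c.adapted.mul_inv hy, Matrix.one_mulVec]
  let m : E4 ≃ₗ[ℝ] E4 := LinearEquiv.ofLinearMap (Matrix.toLin' (c.θ y)) (Matrix.toLin' (c.θ y)⁻¹)
    (LinearMap.ext hinv') (LinearMap.ext hinv)
  have hm : ∀ X, (e.trans m) X = c.θ y *ᵥ e X := fun X => rfl
  refine ⟨e.trans m, fun v => by rw [hm, h1], fun X Y => ?_, fun X => ?_⟩
  · rw [hm, hm, ← c.adapted.dotProduct_metric hy, ← metric_chartInvD, h2, h2]
  · rw [hm, hm]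
    conv_lhs => rw [← h2 X, endo_chartInvD c.mem_atlas (c.V_subset hy), h1]
    rw [Matrix.mulVec_mulVec, c.adapted.paracomplex y hy, ← Matrix.mulVec_mulVec]
    rfl

end TwistorChart

end ChartCalculus

/-! ### Self-dual null planes -/

noncomputable section NullPlanes

theorem finrank_pencilPlane {V : Set E4} {g K θ : E4 → Mat4} {y : E4}
    (h : IsAdaptedCoframe V g K θ) (hy : y ∈ V) {s t : ℝ} (hst : s ^ 2 + t ^ 2 ≠ 0) :
    Module.finrank ℝ (pencilPlane θ y s t) = 2 := by
  have hli : LinearIndependent ℝ ![pencilVecFst θ y s t, pencilVecSnd θ y s t] := by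
    rw [LinearIndependent.pair_iff]
    intro a b hab
    obtain ⟨e0, e1, e2, e3⟩ := h.coframeForm_pencil hy s t a b
    rw [hab] at e0 e1 e2 e3
    simp only [map_zero] at e0 e1 e2 e3
    constructor
    · refine (mul_eq_zero.1 ?_).resolve_left hst
      linear_combination -s * e3 + t * e0
    · refine (mul_eq_zero.1 ?_).resolve_left hst
      linear_combination -s * e2 - t * e1
  have hspan : pencilPlane θ y s t =
      Submodule.span ℝ (Set.range ![pencilVecFst θ y s t, pencilVecSnd θ y s t]) := by
    ext v
    rw [h.mem_pencilPlane_iff_exists hy hst, Submodule.mem_span_range_iff_exists_fun]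
    constructor
    · rintro ⟨a, b, rfl⟩
      exact ⟨![a, b], by simp⟩
    · rintro ⟨a, rfl⟩
      exact ⟨a 0, a 1, by simp⟩
  rw [hspan, finrank_span_eq_card hli, Fintype.card_fin]

theorem pencilPlane_smul (θ : E4 → Mat4) (y : E4) {k : ℝ} (hk : k ≠ 0) (s t : ℝ) :
    pencilPlane θ y (k * s) (k * t) = pencilPlane θ y s t := by
  ext v
  rw [mem_pencilPlane, mem_pencilPlane]
  simp only [mul_assoc, ← mul_add, ← mul_sub, mul_eq_zero, hk, false_or]

/-- A plane whose Plücker coordinates satisfy the self-duality relations belongs to the pencil: the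
Plücker quadric cuts the corresponding projective plane in a conic, which is parametrized by
`[s : t]`. -/
theorem exists_pencil_of_selfDual (N : Submodule ℝ E4) (hN : Module.finrank ℝ N = 2)
    (hsd : ∀ x ∈ N, ∀ y ∈ N, ∀ z w : E4,
      (x ⬝ᵥ nullForm *ᵥ z) * (y ⬝ᵥ nullForm *ᵥ w) - (x ⬝ᵥ nullForm *ᵥ w) * (y ⬝ᵥ nullForm *ᵥ z) =
      -(((signMat *ᵥ x) ⬝ᵥ nullForm *ᵥ y) * ((signMat *ᵥ z) ⬝ᵥ nullForm *ᵥ w)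
        - ((signMat *ᵥ x) ⬝ᵥ nullForm *ᵥ z) * ((signMat *ᵥ y) ⬝ᵥ nullForm *ᵥ w)
        + ((signMat *ᵥ x) ⬝ᵥ nullForm *ᵥ w) * ((signMat *ᵥ y) ⬝ᵥ nullForm *ᵥ z))) :
    ∃ s t : ℝ, s ^ 2 + t ^ 2 ≠ 0 ∧ ∀ x ∈ N, s * x 0 + t * x 3 = 0 ∧ s * x 1 - t * x 2 = 0 := by
  let b := Module.finBasisOfFinrankEq ℝ N hN
  set X : E4 := (b 0 : E4) with hX
  set Y : E4 := (b 1 : E4) with hY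
  have hspan : ∀ x ∈ N, ∃ c d : ℝ, x = c • X + d • Y := by
    intro x hx
    have h := congrArg Subtype.val (b.sum_repr ⟨x, hx⟩)
    simp only [Fin.sum_univ_two, Submodule.coe_add, Submodule.coe_smul] at h
    exact ⟨_, _, h.symm⟩
  have hli : ∀ c d : ℝ, c • X + d • Y = 0 → c = 0 ∧ d = 0 := by
    intro c d hcd
    have h := Fintype.linearIndependent_iff.1 b.linearIndependent ![c, d] (by
      refine Subtype.ext ?_
      simpa [Fin.sum_univ_two] using hcd)
    exact ⟨h 0, h 1⟩
  have hsd' := hsd X (b 0).2 Y (b 1).2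
  have q02 := hsd' (Pi.single 0 1) (Pi.single 2 1)
  have q03 := hsd' (Pi.single 0 1) (Pi.single 3 1)
  have q12 := hsd' (Pi.single 1 1) (Pi.single 2 1)
  simp [signMat, nullForm, dotProduct, Matrix.mulVec, Fin.sum_univ_four, Matrix.diagonal_apply]
    at q02 q03 q12
  clear_value X Y
  have p02 : X 0 * Y 2 - X 2 * Y 0 = X 1 * Y 3 - X 3 * Y 1 := by linarith
  have p03 : X 0 * Y 3 - X 3 * Y 0 = 0 := by linarith
  have p12 : X 1 * Y 2 - X 2 * Y 1 = 0 := by linarith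
  have red : ∀ s t : ℝ, (s * X 0 + t * X 3 = 0 ∧ s * X 1 - t * X 2 = 0) →
      (s * Y 0 + t * Y 3 = 0 ∧ s * Y 1 - t * Y 2 = 0) →
      ∀ x ∈ N, s * x 0 + t * x 3 = 0 ∧ s * x 1 - t * x 2 = 0 := by
    rintro s t ⟨h1, h2⟩ ⟨h3, h4⟩ x hx
    obtain ⟨c, d, rfl⟩ := hspan x hx
    simp only [Pi.add_apply, Pi.smul_apply, smul_eq_mul]
    constructor
    · linear_combination c * h1 + d * h3
    · linear_combination c * h2 + d * h4
  -- `p_ij` are the Plücker coordinates; `p23 = 0` is the point `[0 : 1]` of the conic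
  by_cases p23 : X 2 * Y 3 - X 3 * Y 2 = 0
  · -- the Plücker relation, which reads `p02 ^ 2 = p01 * p23` here
    have z02 : X 0 * Y 2 - X 2 * Y 0 = 0 := by
      have : (X 0 * Y 2 - X 2 * Y 0) ^ 2 = 0 := by
        linear_combination (X 0 * Y 2 - X 2 * Y 0) * p02 + (X 0 * Y 1 - X 1 * Y 0) * p23
          + (X 1 * Y 2 - X 2 * Y 1) * p03
      exact pow_eq_zero_iff two_ne_zero |>.1 this
    have p01 : X 0 * Y 1 - X 1 * Y 0 ≠ 0 := by
      intro p01
      have hz : ∀ i, X i = 0 := fun i => by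
        have h := (hli (Y i) (-X i) (by
          ext j
          simp only [Pi.add_apply, Pi.smul_apply, smul_eq_mul, Pi.zero_apply]
          fin_cases i <;> fin_cases j <;> simp <;> linarith)).2
        linarith
      have := (hli 1 0 (by ext j; simp [hz j])).1
      norm_num at this
    refine ⟨0, 1, by norm_num, red 0 1 ?_ ?_⟩
    · have h2 : X 2 = 0 := by
        refine (mul_eq_zero.1 ?_).resolve_left p01
        linear_combination X 1 * z02 - X 0 * p12
      have h3 : X 3 = 0 := by
        refine (mul_eq_zero.1 ?_).resolve_left p01
        linear_combination X 1 * p03 - X 0 * (z02 - p02)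
      simp [h2, h3]
    · have h2 : Y 2 = 0 := by
        refine (mul_eq_zero.1 ?_).resolve_left p01
        linear_combination Y 1 * z02 - Y 0 * p12
      have h3 : Y 3 = 0 := by
        refine (mul_eq_zero.1 ?_).resolve_left p01
        linear_combination Y 1 * p03 - Y 0 * (z02 - p02)
      simp [h2, h3]
  · refine ⟨X 2 * Y 3 - X 3 * Y 2, X 0 * Y 2 - X 2 * Y 0, ?_, red _ _ ⟨?_, ?_⟩ ⟨?_, ?_⟩⟩
    · have := sq_nonneg (X 0 * Y 2 - X 2 * Y 0)
      positivity
    · linear_combination X 2 * p03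
    · rw [p02]; linear_combination -X 3 * p12
    · linear_combination Y 2 * p03
    · rw [p02]; linear_combination -Y 3 * p12

namespace TwistorChart

variable {M : Type*} [TopologicalSpace M] [ChartedSpace E4 M]
  {g : BilinField M} {K : EndoField M} {y : E4}

/-- The plane in `T_p M`, `p = φ⁻¹(y)`, with homogeneous coordinates `[s : t]`. -/
def pencil (c : TwistorChart g K) (y : E4) (s t : ℝ) :
    Submodule ℝ (TangentSpace 𝓘(ℝ, E4) (c.φ.symm y)) :=
  (pencilPlane c.θ y s t).map (chartInvD c.φ y).toLinearMap

theorem point_eq (c : TwistorChart g K) (q : E4 × ℝ) : c.point q =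
    ⟨c.φ.symm q.1, c.pencil q.1 (fibreFst c.atInfinity q.2) (fibreSnd c.atInfinity q.2)⟩ := by
  rw [point, plane_eq]
  rfl

theorem mem_pencil (c : TwistorChart g K) (hy : y ∈ c.V)
    (e : TangentSpace 𝓘(ℝ, E4) (c.φ.symm y) ≃ₗ[ℝ] E4)
    (he : ∀ v, e (chartInvD c.φ y v) = c.θ y *ᵥ v) {s t : ℝ}
    (X : TangentSpace 𝓘(ℝ, E4) (c.φ.symm y)) :
    X ∈ c.pencil y s t ↔ s * e X 0 + t * e X 3 = 0 ∧ s * e X 1 - t * e X 2 = 0 := by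
  have hinv' : ∀ v, c.θ y *ᵥ ((c.θ y)⁻¹ *ᵥ v) = v := fun v => by
    rw [Matrix.mulVec_mulVec, c.adapted.mul_inv hy, Matrix.one_mulVec]
  have hX : chartInvD c.φ y ((c.θ y)⁻¹ *ᵥ e X) = X := e.injective (by rw [he, hinv'])
  constructor
  · rintro ⟨v, hv, rfl⟩
    have := mem_pencilPlane.1 hv
    simp only [coframeForm_apply] at this
    exact (he v).symm ▸ this
  · intro h
    refine ⟨(c.θ y)⁻¹ *ᵥ e X, mem_pencilPlane.2 ?_, hX⟩
    simpa only [coframeForm_apply, hinv'] using h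

theorem finrank_pencil (c : TwistorChart g K) (hy : y ∈ c.V) {s t : ℝ}
    (hst : s ^ 2 + t ^ 2 ≠ 0) : Module.finrank ℝ (c.pencil y s t) = 2 := by
  obtain ⟨e, h1, -, -⟩ := exists_chartEquiv c.mem_atlas (c.V_subset hy)
  have hinj : Function.Injective (chartInvD c.φ y).toLinearMap := fun u v huv => by
    rw [← h1 u, ← h1 v]
    exact congrArg e huv
  rw [← finrank_pencilPlane c.adapted hy hst]
  exact (Submodule.equivMapOfInjective _ hinj (pencilPlane c.θ y s t)).finrank_eq.symm

/-- The self-dual null planes at a point are the planes of the pencil. -/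
theorem isSelfDualNullPlane_iff (c : TwistorChart g K) (hy : y ∈ c.V)
    (N : Submodule ℝ (TangentSpace 𝓘(ℝ, E4) (c.φ.symm y))) :
    IsSelfDualNullPlane g K (c.φ.symm y) N ↔
      ∃ s t : ℝ, s ^ 2 + t ^ 2 ≠ 0 ∧ N = c.pencil y s t := by
  obtain ⟨e, he, hg, hK⟩ := c.exists_frameEquiv hy
  have hfin : FiniteDimensional ℝ (TangentSpace 𝓘(ℝ, E4) (c.φ.symm y)) :=
    Module.Finite.equiv e.symm
  constructor
  · rintro ⟨h1, -, h3⟩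
    obtain ⟨s, t, hst, h⟩ := exists_pencil_of_selfDual (N.map e.toLinearMap)
      ((e.finrank_map_eq N).trans h1) (by
        rintro _ ⟨X, hX, rfl⟩ _ ⟨Y, hY, rfl⟩ z w
        have := h3 X hX Y hY (e.symm z) (e.symm w)
        simp only [volumeForm, hg, hK, LinearEquiv.apply_symm_apply] at this
        exact this)
    refine ⟨s, t, hst, Submodule.eq_of_le_of_finrank_eq (fun X hX => ?_) ?_⟩
    · exact (c.mem_pencil hy e he X).2 (h _ ⟨X, hX, rfl⟩)
    · rw [h1, c.finrank_pencil hy hst]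
  · rintro ⟨s, t, hst, rfl⟩
    have hpar : ∀ X ∈ c.pencil y s t, ∃ a b : ℝ,
        e X 0 = -(t * a) ∧ e X 1 = t * b ∧ e X 2 = s * b ∧ e X 3 = s * a := by
      rintro _ ⟨v, hv, rfl⟩
      obtain ⟨a, b, rfl⟩ := (c.adapted.mem_pencilPlane_iff_exists hy hst).1 hv
      have := c.adapted.coframeForm_pencil hy s t a b
      simp only [coframeForm_apply] at this
      exact ⟨a, b, (he _).symm ▸ this⟩
    refine ⟨c.finrank_pencil hy hst, fun X hX => ?_, fun X hX Y hY Z W => ?_⟩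
    · obtain ⟨a, b, e0, e1, e2, e3⟩ := hpar X hX
      rw [hg]
      simp [nullForm, dotProduct, Matrix.mulVec, Fin.sum_univ_four, e0, e1, e2, e3]
      ring
    · obtain ⟨a, b, e0, e1, e2, e3⟩ := hpar X hX
      obtain ⟨a', b', f0, f1, f2, f3⟩ := hpar Y hY
      simp only [volumeForm, hg, hK]
      simp [signMat, nullForm, dotProduct, Matrix.mulVec, Fin.sum_univ_four, Matrix.diagonal_apply,
        e0, e1, e2, e3, f0, f1, f2, f3]
      ring

/-- The vector of the plane `[s : t]` which distinguishes it from all other planes of the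
pencil. -/
theorem exists_mem_pencil (c : TwistorChart g K) (hy : y ∈ c.V)
    (e : TangentSpace 𝓘(ℝ, E4) (c.φ.symm y) ≃ₗ[ℝ] E4)
    (he : ∀ v, e (chartInvD c.φ y v) = c.θ y *ᵥ v) (s t : ℝ) :
    ∃ X ∈ c.pencil y s t, e X 0 = 0 ∧ e X 1 = t ∧ e X 2 = s ∧ e X 3 = 0 :=
  ⟨e.symm ![0, t, s, 0], (c.mem_pencil hy e he _).2 (by simp; ring), by simp⟩

theorem pencil_eq_imp (c : TwistorChart g K) (hy : y ∈ c.V) {s t s' t' : ℝ}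
    (h : c.pencil y s t = c.pencil y s' t') : s' * t = t' * s := by
  obtain ⟨e, he, -, -⟩ := c.exists_frameEquiv hy
  obtain ⟨X, hX, -, h1, h2, -⟩ := c.exists_mem_pencil hy e he s t
  rw [h, c.mem_pencil hy e he, h1, h2] at hX
  linarith [hX.2]

theorem pencil_smul (c : TwistorChart g K) (y : E4) {k : ℝ} (hk : k ≠ 0) (s t : ℝ) :
    c.pencil y (k * s) (k * t) = c.pencil y s t := by
  rw [pencil, pencil, pencilPlane_smul _ _ hk]

theorem pencil_eq_planeH_iff (c : TwistorChart g K) (hy : y ∈ c.V) {s t : ℝ}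
    (hst : s ^ 2 + t ^ 2 ≠ 0) : c.pencil y s t = planeH K (c.φ.symm y) ↔ s = 0 := by
  obtain ⟨e, he, -, hK⟩ := c.exists_frameEquiv hy
  have hH : ∀ X, X ∈ planeH K (c.φ.symm y) ↔ e X 2 = 0 ∧ e X 3 = 0 := by
    intro X
    have h1 : X ∈ planeH K (c.φ.symm y) ↔ K (c.φ.symm y) X = X := sub_eq_zero
    rw [h1, ← e.injective.eq_iff, hK, funext_iff]
    simp only [signMat, Matrix.mulVec_diagonal, Fin.forall_fin_succ]
    simp
    constructor
    · rintro ⟨h2, h3⟩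
      constructor <;> linarith
    · rintro ⟨h2, h3⟩
      simp [h2, h3]
  constructor
  · intro h
    obtain ⟨X, hX, -, -, h2, -⟩ := c.exists_mem_pencil hy e he s t
    rw [h, hH, h2] at hX
    exact hX.1
  · rintro rfl
    have ht : t ≠ 0 := by rintro rfl; simp at hst
    ext X
    rw [c.mem_pencil hy e he, hH]
    simp [ht, and_comm]

theorem pencil_eq_planeHbar_iff (c : TwistorChart g K) (hy : y ∈ c.V) {s t : ℝ}
    (hst : s ^ 2 + t ^ 2 ≠ 0) : c.pencil y s t = planeHbar K (c.φ.symm y) ↔ t = 0 := by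
  obtain ⟨e, he, -, hK⟩ := c.exists_frameEquiv hy
  have hH : ∀ X, X ∈ planeHbar K (c.φ.symm y) ↔ e X 0 = 0 ∧ e X 1 = 0 := by
    intro X
    have h1 : X ∈ planeHbar K (c.φ.symm y) ↔ K (c.φ.symm y) X = -X := add_eq_zero_iff_eq_neg
    rw [h1, ← e.injective.eq_iff, hK, map_neg, funext_iff]
    simp only [signMat, Matrix.mulVec_diagonal, Fin.forall_fin_succ]
    simp
    constructor
    · rintro ⟨h2, h3⟩
      constructor <;> linarith
    · rintro ⟨h2, h3⟩
      simp [h2, h3]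
  constructor
  · intro h
    obtain ⟨X, hX, -, h1, -, -⟩ := c.exists_mem_pencil hy e he s t
    rw [h, hH, h1] at hX
    exact hX.2
  · rintro rfl
    have hs : s ≠ 0 := by rintro rfl; simp at hst
    ext X
    rw [c.mem_pencil hy e he, hH]
    simp [hs]

/-- The affine coordinate vanishes exactly at the points of `ℋ` and `ℋ̄`. -/
theorem snd_ne_zero_iff (c : TwistorChart g K) {q : E4 × ℝ} (hq : q ∈ c.domain) :
    q.2 ≠ 0 ↔ (c.point q).2 ≠ planeH K (c.point q).1 ∧
      (c.point q).2 ≠ planeHbar K (c.point q).1 := by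
  rw [point_eq]
  change _ ↔ c.pencil _ _ _ ≠ _ ∧ c.pencil _ _ _ ≠ _
  rw [ne_eq, ne_eq, ne_eq, c.pencil_eq_planeH_iff hq.1 (fibre_sq_ne_zero _ _),
    c.pencil_eq_planeHbar_iff hq.1 (fibre_sq_ne_zero _ _)]
  cases c.atInfinity <;> simp [fibreFst, fibreSnd]

theorem injOn_point (c : TwistorChart g K) : Set.InjOn c.point c.domain := by
  rintro ⟨y, r⟩ ⟨hy, -⟩ ⟨y', r'⟩ ⟨hy', -⟩ h
  rw [point_eq, point_eq] at h
  have h1 : y = y' := c.φ.symm.injOn (c.V_subset hy) (c.V_subset hy') (congrArg Sigma.fst h)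
  subst h1
  have h2 := c.pencil_eq_imp hy (eq_of_heq (Sigma.mk.inj h).2)
  have h3 : r = r' := by
    cases hb : c.atInfinity <;> simp [hb, fibreFst, fibreSnd] at h2
    · exact h2
    · exact h2.symm
  rw [h3]

theorem image_point (c : TwistorChart g K) : c.point '' c.domain =
    {z ∈ selfDualBundle g K | z.1 ∈ c.φ.symm '' c.V ∧
      z.2 ≠ if c.atInfinity then planeHbar K z.1 else planeH K z.1} := by
  ext z
  constructor
  · rintro ⟨q, hq, rfl⟩
    refine ⟨?_, ⟨q.1, hq.1, rfl⟩, ?_⟩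
    · rw [point_eq]
      exact (c.isSelfDualNullPlane_iff hq.1 _).2 ⟨_, _, fibre_sq_ne_zero _ _, rfl⟩
    · rw [point_eq]
      cases hb : c.atInfinity
      · change c.pencil _ _ _ ≠ planeH K _
        rw [ne_eq, c.pencil_eq_planeH_iff hq.1 (fibre_sq_ne_zero _ _)]
        simp [fibreFst]
      · change c.pencil _ _ _ ≠ planeHbar K _
        rw [ne_eq, c.pencil_eq_planeHbar_iff hq.1 (fibre_sq_ne_zero _ _)]
        simp [fibreSnd]
  · obtain ⟨p, N⟩ := z
    rintro ⟨hz, ⟨y, hy, rfl⟩, hN⟩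
    obtain ⟨s, t, hst, rfl⟩ := (c.isSelfDualNullPlane_iff hy N).1 hz
    simp only at hN
    cases hb : c.atInfinity
    · simp only [hb, Bool.false_eq_true, if_false] at hN
      rw [ne_eq, c.pencil_eq_planeH_iff hy hst] at hN
      refine ⟨(y, t / s), ⟨hy, trivial⟩, ?_⟩
      rw [point_eq, hb]
      simp only [fibreFst, fibreSnd, Bool.false_eq_true, if_false]
      rw [← c.pencil_smul y hN 1, mul_one, mul_div_cancel₀ _ hN]
    · simp only [hb, if_true] at hN
      rw [ne_eq, c.pencil_eq_planeHbar_iff hy hst] at hN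
      refine ⟨(y, s / t), ⟨hy, trivial⟩, ?_⟩
      rw [point_eq, hb]
      simp only [fibreFst, fibreSnd, if_true]
      rw [← c.pencil_smul y hN _ 1, mul_one, mul_div_cancel₀ _ hN]

end TwistorChart

end NullPlanes

/-! ### Existence of adapted coframes -/

noncomputable section Existence

theorem eigenPlane_mulVec {K : E4 → Mat4} {y : E4} (hK : K y * K y = 1) {ε : ℝ} (hε : ε * ε = 1)
    {v : E4} (hv : v ∈ eigenPlane ε K y) : K y *ᵥ v = ε • v := by
  obtain ⟨w, rfl⟩ := hv
  rw [Matrix.toLin'_apply, Matrix.mulVec_mulVec, ← Matrix.smul_mulVec, mul_add, hK, smul_add,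
    smul_smul, hε, mul_smul_comm, mul_one, one_smul, add_comm]

/-- A para-complex structure with eigenplanes of rank two can be diagonalized at a point. -/
theorem exists_diagonalization {K : E4 → Mat4} {y : E4} (hK : K y * K y = 1)
    (h1 : Module.finrank ℝ (eigenPlane 1 K y) = 2)
    (h2 : Module.finrank ℝ (eigenPlane (-1) K y) = 2) :
    ∃ R : Mat4, R.det ≠ 0 ∧ R * K y = signMat * R := by
  let b := Module.finBasisOfFinrankEq ℝ _ h1
  let b' := Module.finBasisOfFinrankEq ℝ _ h2
  let e : Fin 4 → E4 := ![b 0, b 1, b' 0, b' 1]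
  have hb : ∀ i, K y *ᵥ (b i : E4) = (b i : E4) := fun i => by
    rw [eigenPlane_mulVec hK (by norm_num) (b i).2, one_smul]
  have hb' : ∀ i, K y *ᵥ (b' i : E4) = -(b' i : E4) := fun i => by
    rw [eigenPlane_mulVec hK (by norm_num) (b' i).2, neg_one_smul]
  have hli : LinearIndependent ℝ e := by
    rw [Fintype.linearIndependent_iff]
    intro a ha
    simp only [Fin.sum_univ_four, e, Matrix.cons_val] at ha
    have ha' := congrArg (fun v => K y *ᵥ v) ha
    simp only [Matrix.mulVec_add, Matrix.mulVec_smul, hb, hb', Matrix.mulVec_zero] at ha'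
    have s1 : a 0 • (b 0 : E4) + a 1 • (b 1 : E4) = 0 := by
      have : (2 : ℝ) • (a 0 • (b 0 : E4) + a 1 • (b 1 : E4)) = 0 := by
        calc _ = (a 0 • (b 0 : E4) + a 1 • (b 1 : E4) + a 2 • (b' 0 : E4) + a 3 • (b' 1 : E4))
              + (a 0 • (b 0 : E4) + a 1 • (b 1 : E4) + a 2 • -(b' 0 : E4) + a 3 • -(b' 1 : E4)) := by
              module
          _ = 0 := by rw [ha, ha', add_zero]
      exact (smul_eq_zero.1 this).resolve_left two_ne_zero
    have s2 : a 2 • (b' 0 : E4) + a 3 • (b' 1 : E4) = 0 := by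
      rw [add_assoc, ← add_assoc, s1, zero_add] at ha
      exact ha
    have t1 := Fintype.linearIndependent_iff.1 b.linearIndependent ![a 0, a 1]
      (Subtype.ext (by simpa [Fin.sum_univ_two] using s1))
    have t2 := Fintype.linearIndependent_iff.1 b'.linearIndependent ![a 2, a 3]
      (Subtype.ext (by simpa [Fin.sum_univ_two] using s2))
    intro i
    fin_cases i
    · exact t1 0
    · exact t1 1
    · exact t2 0
    · exact t2 1
  set F : Mat4 := Matrix.of fun i c => e c i with hF
  have hdet : F.det ≠ 0 := by
    have h3 : LinearIndependent ℝ F.col := hli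
    exact ((Matrix.isUnit_iff_isUnit_det _).1
      (Matrix.linearIndependent_cols_iff_isUnit.1 h3)).ne_zero
  have hKF : K y * F = F * signMat := by
    ext i c
    have h4 : (K y * F) i c = (K y *ᵥ e c) i := rfl
    rw [h4, signMat, Matrix.mul_diagonal]
    fin_cases c <;> simp [e, hb, hb', hF]
  have hu := Ne.isUnit hdet
  refine ⟨F⁻¹, ?_, ?_⟩
  · rw [Matrix.det_nonsing_inv]
    exact hu.ringInverse.ne_zero
  · calc F⁻¹ * K y = F⁻¹ * (K y * F) * F⁻¹ := by
          rw [Matrix.mul_assoc, Matrix.mul_assoc, Matrix.mul_nonsing_inv _ hu, Matrix.mul_one]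
      _ = signMat * F⁻¹ := by
          rw [hKF, ← Matrix.mul_assoc, Matrix.nonsing_inv_mul _ hu, Matrix.one_mul]

/-- A symmetric matrix `S` with `D S D = -S`, for `D = diag(1, 1, -1, -1)`, is the matrix, in some
coframe, of `2 θ¹θ³ + 2 θ²θ⁴`. -/
theorem exists_normalForm {S : Mat4} (hS : Sᵀ = S) (hD : signMat * S * signMat = -S) :
    let L : Mat4 := !![S 2 0, S 2 1, 0, 0; S 3 0, S 3 1, 0, 0; 0, 0, 1, 0; 0, 0, 0, 1]
    Lᵀ * nullForm * L = S ∧ L * signMat = signMat * L := by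
  intro L
  have hs : ∀ i j, S j i = S i j := fun i j => congrFun (congrFun hS i) j
  have hz : ∀ i j, (![1, 1, -1, -1] : Fin 4 → ℝ) i * S i j * (![1, 1, -1, -1] : Fin 4 → ℝ) j =
      -S i j := by
    intro i j
    have := congrFun (congrFun hD i) j
    simpa only [signMat, Matrix.mul_diagonal, Matrix.diagonal_mul, Matrix.neg_apply] using this
  have z00 : S 0 0 = 0 := by have := hz 0 0; simp at this; linarith
  have z01 : S 0 1 = 0 := by have := hz 0 1; simp at this; linarith
  have z11 : S 1 1 = 0 := by have := hz 1 1; simp at this; linarith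
  have z22 : S 2 2 = 0 := by have := hz 2 2; simp at this; linarith
  have z23 : S 2 3 = 0 := by have := hz 2 3; simp at this; linarith
  have z33 : S 3 3 = 0 := by have := hz 3 3; simp at this; linarith
  constructor
  · ext i j
    fin_cases i <;> fin_cases j <;>
      simp [L, nullForm, Matrix.mul_apply, Fin.sum_univ_four, z00, z01, z11, z22, z23, z33,
        hs 0 1, hs 2 3, hs 0 2, hs 0 3, hs 1 2, hs 1 3]
  · ext i j
    simp only [signMat, Matrix.mul_diagonal, Matrix.diagonal_mul]
    fin_cases i <;> fin_cases j <;> simp [L]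

/-- A diagonalization of `K` at a point extends to a coframe of eigenforms of `K`; half of it is
then replaced by the forms dual, with respect to `g`, to the other half. -/
theorem IsParaKahlerOn.exists_isAdaptedCoframe {U : Set E4} {g K : E4 → Mat4}
    (h : IsParaKahlerOn U g K) (hU : IsOpen U) {y : E4} (hy : y ∈ U) :
    ∃ V θ, IsOpen V ∧ y ∈ V ∧ V ⊆ U ∧ IsAdaptedCoframe V g K θ := by
  obtain ⟨R₀, hR₀, hR₀K⟩ := exists_diagonalization (h.paracomplex y hy) (h.rank_plus y hy)
    (h.rank_minus y hy)
  have hDD : signMat * signMat = 1 := by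
    rw [signMat, Matrix.diagonal_mul_diagonal, ← Matrix.diagonal_one]
    congr 1
    ext i
    fin_cases i <;> simp
  have hDt : signMatᵀ = signMat := by rw [signMat, Matrix.diagonal_transpose]
  -- the projection of `R₀` to the coframes of eigenforms
  let R : E4 → Mat4 := fun z => (1 / 2 : ℝ) • (R₀ + signMat * R₀ * K z)
  have hRy : R y = R₀ := by
    simp only [R]
    rw [Matrix.mul_assoc, hR₀K, ← Matrix.mul_assoc, hDD, Matrix.one_mul, ← two_smul ℝ, smul_smul]
    norm_num
  have hRK : ∀ z ∈ U, R z * K z = signMat * R z := by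
    intro z hz
    simp only [R, Matrix.smul_mul, Matrix.mul_smul, Matrix.add_mul, Matrix.mul_add]
    rw [Matrix.mul_assoc (signMat * R₀), h.paracomplex z hz, Matrix.mul_one,
      ← Matrix.mul_assoc signMat (signMat * R₀), ← Matrix.mul_assoc signMat signMat, hDD,
      Matrix.one_mul, add_comm]
  have hRs : ∀ i j, ContDiffOn ℝ ∞ (fun z => R z i j) U := by
    intro i j
    have := contDiffOn_matrix_mul (A := fun _ => signMat * R₀) (fun _ _ => contDiffOn_const)
      h.smooth_K i j
    exact ContDiffOn.const_smul (1 / 2 : ℝ) (contDiffOn_const.add this)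
  have hdets : ContDiffOn ℝ ∞ (fun z => (R z).det) U := contDiffOn_matrix_det hRs
  let V : Set E4 := U ∩ (fun z => (R z).det) ⁻¹' {0}ᶜ
  have hVU : V ⊆ U := Set.inter_subset_left
  have hV : IsOpen V := hdets.continuousOn.isOpen_inter_preimage hU isOpen_compl_singleton
  have hyV : y ∈ V := ⟨hy, by simpa [hRy] using hR₀⟩
  have hu : ∀ z ∈ V, IsUnit (R z).det := fun z hz => Ne.isUnit hz.2
  have hRi : ∀ i j, ContDiffOn ℝ ∞ (fun z => (R z)⁻¹ i j) V :=
    contDiffOn_matrix_inv (fun i j => (hRs i j).mono hVU) fun z hz => hz.2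
  -- the matrix of the metric in the coframe `R`
  let S : E4 → Mat4 := fun z => ((R z)⁻¹)ᵀ * g z * (R z)⁻¹
  have hSs : ∀ i j, ContDiffOn ℝ ∞ (fun z => S z i j) V :=
    contDiffOn_matrix_mul (contDiffOn_matrix_mul (A := fun z => ((R z)⁻¹)ᵀ) (fun i j => hRi j i)
      fun i j => (h.smooth_metric i j).mono hVU) hRi
  have hSt : ∀ z ∈ V, (S z)ᵀ = S z := by
    intro z hz
    simp only [S, Matrix.transpose_mul, Matrix.transpose_transpose, Matrix.mul_assoc]
    rw [show (g z)ᵀ = g z from h.symm z hz.1]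
  have hSg : ∀ z ∈ V, (R z)ᵀ * S z * R z = g z := by
    intro z hz
    have h1 : (R z)ᵀ * ((R z)⁻¹)ᵀ = 1 := by
      rw [← Matrix.transpose_mul, Matrix.nonsing_inv_mul _ (hu z hz), Matrix.transpose_one]
    calc (R z)ᵀ * S z * R z = ((R z)ᵀ * ((R z)⁻¹)ᵀ) * g z * ((R z)⁻¹ * R z) := by
          simp only [S, Matrix.mul_assoc]
      _ = g z := by rw [h1, Matrix.nonsing_inv_mul _ (hu z hz), Matrix.one_mul, Matrix.mul_one]
  have hSD : ∀ z ∈ V, signMat * S z * signMat = -S z := by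
    intro z hz
    have h1 : (R z)⁻¹ * signMat = K z * (R z)⁻¹ := by
      calc (R z)⁻¹ * signMat = (R z)⁻¹ * (signMat * R z) * (R z)⁻¹ := by
            rw [Matrix.mul_assoc, Matrix.mul_assoc, Matrix.mul_nonsing_inv _ (hu z hz),
              Matrix.mul_one]
        _ = K z * (R z)⁻¹ := by
            rw [← hRK z hz.1, ← Matrix.mul_assoc, Matrix.nonsing_inv_mul _ (hu z hz), Matrix.one_mul]
    have h2 : signMat * ((R z)⁻¹)ᵀ = ((R z)⁻¹)ᵀ * (K z)ᵀ := by
      rw [← Matrix.transpose_mul, ← h1, Matrix.transpose_mul, hDt]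
    calc signMat * S z * signMat = (signMat * ((R z)⁻¹)ᵀ) * g z * ((R z)⁻¹ * signMat) := by
          simp only [S, Matrix.mul_assoc]
      _ = ((R z)⁻¹)ᵀ * ((K z)ᵀ * g z * K z) * (R z)⁻¹ := by
          rw [h1, h2]; simp only [Matrix.mul_assoc]
      _ = -S z := by
          rw [h.compatible z hz.1]
          simp only [S, Matrix.mul_neg, Matrix.neg_mul]
  -- the first two members of `R` give way to the metric duals of the last two frame vectors
  let L : E4 → Mat4 := fun z =>
    !![S z 2 0, S z 2 1, 0, 0; S z 3 0, S z 3 1, 0, 0; 0, 0, 1, 0; 0, 0, 0, 1]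
  have hLs : ∀ i j, ContDiffOn ℝ ∞ (fun z => L z i j) V := by
    intro i j
    fin_cases i <;> fin_cases j <;> simp [L] <;> first | exact contDiffOn_const | exact hSs _ _
  have hmet : ∀ z ∈ V, g z = (L z * R z)ᵀ * nullForm * (L z * R z) := by
    intro z hz
    rw [← hSg z hz, ← (exists_normalForm (hSt z hz) (hSD z hz)).1]
    simp only [L, Matrix.transpose_mul, Matrix.mul_assoc]
  refine ⟨V, fun z => L z * R z, hV, hyV, hVU, contDiffOn_matrix_mul hLs
    fun i j => (hRs i j).mono hVU, fun z hz hdet => h.nondegenerate z hz.1 ?_, hmet,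
    fun z hz => ?_⟩
  · rw [hmet z hz, Matrix.det_mul, hdet, mul_zero]
  · change _ = signMat * (L z * R z)
    rw [Matrix.mul_assoc, hRK z hz.1, ← Matrix.mul_assoc, ← Matrix.mul_assoc,
      (exists_normalForm (hSt z hz) (hSD z hz)).2]

/-- The twistor charts cover the bundle of self-dual null planes. -/
theorem TwistorChart.exists_point_eq {M : Type*} [TopologicalSpace M] [ChartedSpace E4 M]
    [IsManifold 𝓘(ℝ, E4) ∞ M] {g : BilinField M} {K : EndoField M} (hgK : IsPKE g K)
    {z : TangentSubspace M} (hz : z ∈ selfDualBundle g K) :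
    ∃ c : TwistorChart g K, ∃ q ∈ c.domain, c.point q = z := by
  obtain ⟨p, N⟩ := z
  have hφ : chartAt E4 p ∈ IsManifold.maximalAtlas 𝓘(ℝ, E4) ∞ M :=
    IsManifold.chart_mem_maximalAtlas p
  have hp : p ∈ (chartAt E4 p).source := mem_chart_source E4 p
  generalize chartAt E4 p = φ at hφ hp
  obtain ⟨y, hy, rfl⟩ : ∃ y ∈ φ.target, φ.symm y = p :=
    ⟨φ p, φ.map_source hp, φ.left_inv hp⟩
  obtain ⟨V, θ, hV, hyV, hVU, hθ⟩ := (hgK φ hφ).1.exists_isAdaptedCoframe φ.open_target hy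
  let c : Bool → TwistorChart g K := fun b => ⟨φ, hφ, V, hV, hVU, θ, hθ, b⟩
  obtain ⟨s, t, hst, hN⟩ := ((c false).isSelfDualNullPlane_iff hyV N).1 hz
  have hmem : (⟨φ.symm y, N⟩ : TangentSubspace M) ∈ (c (decide (s = 0))).point ''
      (c (decide (s = 0))).domain := by
    rw [image_point]
    refine ⟨hz, ⟨y, hyV, rfl⟩, ?_⟩
    by_cases hs : s = 0
    · have ht : t ≠ 0 := by rintro rfl; simp [hs] at hst
      have := ((c false).pencil_eq_planeHbar_iff hyV hst).not.2 ht
      simpa [c, hs, hN] using this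
    · have := ((c false).pencil_eq_planeH_iff hyV hst).not.2 hs
      simpa [c, hs, hN] using this
  obtain ⟨q, hq, h⟩ := hmem
  exact ⟨_, q, hq, h⟩

end Existence

/-! ### Changes of coordinates and of adapted coframes -/

noncomputable section Changes

/-- The exterior derivative commutes with pull-backs. -/
theorem extDerivOne_pullback {F G : Type*} [NormedAddCommGroup F] [NormedSpace ℝ F]
    [NormedAddCommGroup G] [NormedSpace ℝ G] {β : G → G →L[ℝ] ℝ} {ψ : F → G} {y : F}
    (hψ : ContDiffAt ℝ ∞ ψ y) (hβ : DifferentiableAt ℝ β (ψ y)) (u v : F) :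
    extDerivOne (fun z => (β (ψ z)).comp (fderiv ℝ ψ z)) y u v =
      extDerivOne β (ψ y) (fderiv ℝ ψ y u) (fderiv ℝ ψ y v) := by
  have hd : DifferentiableAt ℝ (fderiv ℝ ψ) y :=
    (hψ.fderiv_right (m := ∞) (by simp)).differentiableAt (by simp)
  have h1 : HasFDerivAt (fun z => β (ψ z)) ((fderiv ℝ β (ψ y)).comp (fderiv ℝ ψ y)) y :=
    hβ.hasFDerivAt.comp y (hψ.differentiableAt (by simp)).hasFDerivAt
  have h2 := h1.clm_comp hd.hasFDerivAt
  have hs := (hψ.isSymmSndFDerivAt (by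
    rw [minSmoothness_of_isRCLikeNormedField]; exact WithTop.coe_le_coe.2 le_top)).eq u v
  simp only [extDerivOne, h2.fderiv]
  simp [hs]

/-- The matrix of the change of coframe `θ' = T θ`. -/
def transMat (θ θ' : E4 → Mat4) (y : E4) : Mat4 := θ' y * (θ y)⁻¹

/-- The determinant of the upper diagonal block of the change of coframe `θ' = T θ`. -/
def transDet (θ θ' : E4 → Mat4) (y : E4) : ℝ :=
  transMat θ θ' y 0 0 * transMat θ θ' y 1 1 - transMat θ θ' y 0 1 * transMat θ θ' y 1 0

namespace IsAdaptedCoframe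

variable {V V' : Set E4} {g g' K K' θ θ' : E4 → Mat4} {y : E4}

theorem transMat_mul (h : IsAdaptedCoframe V g K θ) (hy : y ∈ V) :
    transMat θ θ' y * θ y = θ' y := by
  rw [transMat, Matrix.mul_assoc, h.inv_mul hy, Matrix.mul_one]

/-- A change of adapted coframe is given by a matrix `diag (A, A⁻ᵀ)`. -/
theorem transMat_block (h : IsAdaptedCoframe V g K θ) (h' : IsAdaptedCoframe V g K θ')
    (hy : y ∈ V) :
    let T := transMat θ θ' y
    let δ := transDet θ θ' y
    δ ≠ 0 ∧ (T 0 2 = 0 ∧ T 0 3 = 0 ∧ T 1 2 = 0 ∧ T 1 3 = 0 ∧ T 2 0 = 0 ∧ T 2 1 = 0 ∧ T 3 0 = 0 ∧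
      T 3 1 = 0) ∧ δ * T 2 2 = T 1 1 ∧ δ * T 2 3 = -T 1 0 ∧ δ * T 3 2 = -T 0 1 ∧
      δ * T 3 3 = T 0 0 := by
  intro T δ
  have hT : T * θ y = θ' y := h.transMat_mul hy
  have hTi : θ' y * (θ y)⁻¹ = T := rfl
  have hK : T * signMat = signMat * T := by
    have h1 : T * signMat * θ y = signMat * T * θ y := by
      rw [Matrix.mul_assoc, signMat, ← h.paracomplex y hy, ← Matrix.mul_assoc, hT,
        h'.paracomplex y hy, ← hT, Matrix.mul_assoc]
    calc T * signMat = T * signMat * θ y * (θ y)⁻¹ := by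
          rw [Matrix.mul_assoc _ (θ y), h.mul_inv hy, Matrix.mul_one]
      _ = signMat * T := by
          rw [h1, Matrix.mul_assoc _ (θ y), h.mul_inv hy, Matrix.mul_one]
  have hm : Tᵀ * nullForm * T = nullForm := by
    have h1 : ((θ y)⁻¹)ᵀ * (θ y)ᵀ = 1 := by
      rw [← Matrix.transpose_mul, h.mul_inv hy, Matrix.transpose_one]
    calc Tᵀ * nullForm * T = ((θ y)⁻¹)ᵀ * ((θ' y)ᵀ * nullForm * θ' y) * (θ y)⁻¹ := by
          rw [← hTi, Matrix.transpose_mul]; simp only [Matrix.mul_assoc]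
      _ = (((θ y)⁻¹)ᵀ * (θ y)ᵀ) * nullForm * (θ y * (θ y)⁻¹) := by
          rw [← h'.metric y hy, h.metric y hy]; simp only [Matrix.mul_assoc]
      _ = nullForm := by rw [h1, h.mul_inv hy, Matrix.one_mul, Matrix.mul_one]
  have hz : ∀ i j, T i j * (![1, 1, -1, -1] : Fin 4 → ℝ) j =
      (![1, 1, -1, -1] : Fin 4 → ℝ) i * T i j := by
    intro i j
    have := congrFun (congrFun hK i) j
    simpa only [signMat, Matrix.mul_diagonal, Matrix.diagonal_mul] using this
  have z02 : T 0 2 = 0 := by have := hz 0 2; simp at this; linarith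
  have z03 : T 0 3 = 0 := by have := hz 0 3; simp at this; linarith
  have z12 : T 1 2 = 0 := by have := hz 1 2; simp at this; linarith
  have z13 : T 1 3 = 0 := by have := hz 1 3; simp at this; linarith
  have z20 : T 2 0 = 0 := by have := hz 2 0; simp at this; linarith
  have z21 : T 2 1 = 0 := by have := hz 2 1; simp at this; linarith
  have z30 : T 3 0 = 0 := by have := hz 3 0; simp at this; linarith
  have z31 : T 3 1 = 0 := by have := hz 3 1; simp at this; linarith
  have m : ∀ i j, T 2 i * T 0 j + T 3 i * T 1 j + T 0 i * T 2 j + T 1 i * T 3 j =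
      nullForm i j := by
    intro i j
    have := congrFun (congrFun hm i) j
    simpa [Matrix.mul_apply, Fin.sum_univ_four, nullForm] using this
  have m02 := m 0 2
  have m03 := m 0 3
  have m12 := m 1 2
  have m13 := m 1 3
  simp [z02, z03, z12, z13, z20, z21, z30, z31, nullForm] at m02 m03 m12 m13
  have hδ : δ = T 0 0 * T 1 1 - T 0 1 * T 1 0 := rfl
  refine ⟨fun h0 => ?_, ⟨z02, z03, z12, z13, z20, z21, z30, z31⟩, ?_, ?_, ?_, ?_⟩
  · have : δ * (T 2 2 * T 3 3 - T 2 3 * T 3 2) = 1 := by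
      rw [hδ]
      linear_combination m02 * (T 0 1 * T 2 3 + T 1 1 * T 3 3) + m13
        - m03 * (T 0 1 * T 2 2 + T 1 1 * T 3 2)
    rw [h0, zero_mul] at this
    exact zero_ne_one this
  · rw [hδ]; linear_combination T 1 1 * m02 - T 1 0 * m12
  · rw [hδ]; linear_combination T 1 1 * m03 - T 1 0 * m13
  · rw [hδ]; linear_combination T 0 0 * m12 - T 0 1 * m02
  · rw [hδ]; linear_combination T 0 0 * m13 - T 0 1 * m03

theorem smooth_transDet (h : IsAdaptedCoframe V g K θ) (h' : IsAdaptedCoframe V g K θ') :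
    ContDiffOn ℝ ∞ (transDet θ θ') V := by
  have hT := contDiffOn_matrix_mul h'.smooth h.smooth_inv
  exact ((hT 0 0).mul (hT 1 1)).sub ((hT 0 1).mul (hT 1 0))

/-- A change of adapted coframe acts on the pencil by `[s : t] ↦ [s : δ t]`. -/
theorem pencilPlane_trans (h : IsAdaptedCoframe V g K θ) (h' : IsAdaptedCoframe V g K θ')
    (hy : y ∈ V) (s t : ℝ) :
    pencilPlane θ y s t = pencilPlane θ' y s (transDet θ θ' y * t) := by
  obtain ⟨hδ, ⟨z02, z03, z12, z13, z20, z21, z30, z31⟩, e1, e2, e3, e4⟩ := h.transMat_block h' hy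
  have hd : transDet θ θ' y = transMat θ θ' y 0 0 * transMat θ θ' y 1 1
    - transMat θ θ' y 0 1 * transMat θ θ' y 1 0 := rfl
  ext v
  have hc : ∀ a, coframeForm θ' a y v = ∑ b, transMat θ θ' y a b * coframeForm θ b y v := by
    intro a
    simp only [coframeForm_apply]
    rw [← h.transMat_mul (θ' := θ') hy, ← Matrix.mulVec_mulVec]
    rfl
  rw [mem_pencilPlane, mem_pencilPlane]
  simp only [hc, Fin.sum_univ_four, z02, z03, z12, z13, z20, z21, z30, z31]
  set x0 := coframeForm θ 0 y v
  set x1 := coframeForm θ 1 y v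
  set x2 := coframeForm θ 2 y v
  set x3 := coframeForm θ 3 y v
  set T := transMat θ θ' y
  constructor
  · rintro ⟨h1, h2⟩
    constructor
    · linear_combination T 0 0 * h1 + T 0 1 * h2 + t * x2 * e3 + t * x3 * e4
    · linear_combination T 1 0 * h1 + T 1 1 * h2 - t * x2 * e1 - t * x3 * e2
  · rintro ⟨h1, h2⟩
    constructor
    -- multiplication by the adjugate of the upper block inverts the change of coframe
    · refine (mul_eq_zero.1 ?_).resolve_left hδ
      linear_combination (s * x0 + t * x3) * hd + T 1 1 * (h1 - t * x2 * e3 - t * x3 * e4)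
        - T 0 1 * (h2 + t * x2 * e1 + t * x3 * e2)
    · refine (mul_eq_zero.1 ?_).resolve_left hδ
      linear_combination (s * x1 - t * x2) * hd + T 0 0 * (h2 + t * x2 * e1 + t * x3 * e2)
        - T 1 0 * (h1 - t * x2 * e3 - t * x3 * e4)

/-- The trace of the connection form changes by the logarithmic derivative of the determinant. -/
theorem traceConn_trans (h : IsAdaptedCoframe V g K θ) (h' : IsAdaptedCoframe V g K θ')
    (hK : IsParaKahlerOn V g K) (hV : IsOpen V) (hy : y ∈ V) (u : E4) :
    transDet θ θ' y * traceConn g θ' y u =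
      transDet θ θ' y * traceConn g θ y u - fderiv ℝ (transDet θ θ') y u := by
  have hTs := contDiffOn_matrix_mul h'.smooth h.smooth_inv
  have hTd : ∀ i j, DifferentiableAt ℝ (fun z => transMat θ θ' z i j) y := fun i j =>
    ((hTs i j).contDiffAt (hV.mem_nhds hy)).differentiableAt (by simp)
  have hθ := h.differentiableAt hV hy
  have key : dirD (transMat θ θ') y u =
      transMat θ θ' y * connMat g θ y u - connMat g θ' y u * transMat θ θ' y := by
    have h1 := h'.dirD_coframe hV hy u
    rw [dirD_congr hV (fun z hz => (h.transMat_mul (θ' := θ') hz).symm) hy, dirD_mul hTd hθ,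
      h.dirD_coframe hV hy, ← h.transMat_mul (θ' := θ') hy] at h1
    have h2 : dirD (transMat θ θ') y u * θ y =
        (transMat θ θ' y * connMat g θ y u - connMat g θ' y u * transMat θ θ' y) * θ y := by
      rw [eq_sub_of_add_eq h1]
      noncomm_ring
    calc _ = dirD (transMat θ θ') y u * θ y * (θ y)⁻¹ := by
          rw [Matrix.mul_assoc, h.mul_inv hy, Matrix.mul_one]
      _ = _ := by rw [h2, Matrix.mul_assoc, h.mul_inv hy, Matrix.mul_one]
  obtain ⟨-, ⟨z02, z03, z12, z13, z20, z21, z30, z31⟩, -⟩ := h.transMat_block h' hy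
  obtain ⟨a1, a2, a3, a4, a5, a6, a7, a8, -⟩ := h.conn_eq hK hV hy
  have k : ∀ i j, fderiv ℝ (fun z => transMat θ θ' z i j) y u = _ := fun i j =>
    congrFun (congrFun key i) j
  have k00 := k 0 0
  have k01 := k 0 1
  have k10 := k 1 0
  have k11 := k 1 1
  simp only [Matrix.sub_apply, Matrix.mul_apply, connMat, Matrix.of_apply, Fin.sum_univ_four, z02,
    z03, z12, z13, z20, z21, z30, z31, a5, a6, a7, a8, zero_apply]
    at k00 k01 k10 k11
  have hD : HasFDerivAt (transDet θ θ') _ y :=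
    ((hTd 0 0).hasFDerivAt.fun_mul (hTd 1 1).hasFDerivAt).fun_sub
      ((hTd 0 1).hasFDerivAt.fun_mul (hTd 1 0).hasFDerivAt)
  rw [hD.fderiv]
  simp only [sub_apply, add_apply,
    smul_apply, smul_eq_mul, k00, k01, k10, k11, transDet, traceConn]
  ring

/-- The trace of the connection form is determined by the exterior derivatives of the coframe. -/
theorem traceConn_frameVec (h : IsAdaptedCoframe V g K θ) (hK : IsParaKahlerOn V g K)
    (hV : IsOpen V) (hy : y ∈ V) :
    let d := fun a b c => extDerivOne (coframeForm θ a) y (frameVec θ b y) (frameVec θ c y)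
    let T := fun c => traceConn g θ y (frameVec θ c y)
    T 0 = d 2 0 2 + d 3 0 3 ∧ T 1 = d 2 1 2 + d 3 1 3 ∧ T 2 = -d 0 2 0 - d 1 2 1 ∧
      T 3 = -d 0 3 0 - d 1 3 1 := by
  have e := fun u v => h.extDerivOne_coframe hK hV hy u v
  simp only [(e _ _).1, (e _ _).2.1, (e _ _).2.2.1, (e _ _).2.2.2, wedgeOne,
    h.coframeForm_frameVec hy, traceConn, add_apply]
  simp

/-- The trace of the connection form is natural under changes of coordinates. -/
theorem traceConn_pullback (h : IsAdaptedCoframe V g K θ) (h' : IsAdaptedCoframe V' g' K' θ')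
    (hK : IsParaKahlerOn V g K) (hK' : IsParaKahlerOn V' g' K') (hV : IsOpen V) (hV' : IsOpen V')
    {ψ : E4 → E4} (hψ : ContDiffOn ℝ ∞ ψ V) (hmaps : ∀ z ∈ V, ψ z ∈ V')
    (hθ : ∀ z ∈ V, ∀ v, θ z *ᵥ v = θ' (ψ z) *ᵥ fderiv ℝ ψ z v) (hy : y ∈ V) (u : E4) :
    traceConn g θ y u = traceConn g' θ' (ψ y) (fderiv ℝ ψ y u) := by
  have hψy : ContDiffAt ℝ ∞ ψ y := hψ.contDiffAt (hV.mem_nhds hy)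
  have hf : ∀ c, fderiv ℝ ψ y (frameVec θ c y) = frameVec θ' c (ψ y) := by
    intro c
    have h1 : θ' (ψ y) *ᵥ fderiv ℝ ψ y (frameVec θ c y) = θ' (ψ y) *ᵥ frameVec θ' c (ψ y) := by
      rw [← hθ y hy, h.mulVec_frameVec hy, h'.mulVec_frameVec (hmaps y hy)]
    have h2 := congrArg (fun v => (θ' (ψ y))⁻¹ *ᵥ v) h1
    simpa only [Matrix.mulVec_mulVec, h'.inv_mul (hmaps y hy), Matrix.one_mulVec] using h2
  have hd : ∀ a b c, extDerivOne (coframeForm θ a) y (frameVec θ b y) (frameVec θ c y) =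
      extDerivOne (coframeForm θ' a) (ψ y) (frameVec θ' b (ψ y)) (frameVec θ' c (ψ y)) := by
    intro a b c
    rw [← hf, ← hf, ← extDerivOne_pullback hψy
      (h'.differentiableAt_coframeForm hV' (hmaps y hy) a)]
    refine extDerivOne_congr hV (fun z hz => ?_) hy _ _
    ext1 v
    rw [ContinuousLinearMap.comp_apply, coframeForm_apply, coframeForm_apply, hθ z hz]
  obtain ⟨t0, t1, t2, t3⟩ := h.traceConn_frameVec hK hV hy
  obtain ⟨s0, s1, s2, s3⟩ := h'.traceConn_frameVec hK' hV' (hmaps y hy)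
  simp only [hd] at t0 t1 t2 t3
  have key : ∀ c, traceConn g θ y (frameVec θ c y) =
      traceConn g' θ' (ψ y) (frameVec θ' c (ψ y)) := by
    intro c
    fin_cases c
    · exact t0.trans s0.symm
    · exact t1.trans s1.symm
    · exact t2.trans s2.symm
    · exact t3.trans s3.symm
  rw [h.eq_sum_frameVec hy u]
  simp only [map_sum, map_smul, hf, key]

end IsAdaptedCoframe

end Changes

/-! ### Changes of twistor charts -/

noncomputable section TwistorChanges

variable {M : Type*} [TopologicalSpace M] [ChartedSpace E4 M] {g : BilinField M} {K : EndoField M}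

theorem contDiffOn_chart_change {φ φ' : OpenPartialHomeomorph M E4}
    (hφ : φ ∈ IsManifold.maximalAtlas 𝓘(ℝ, E4) ∞ M)
    (hφ' : φ' ∈ IsManifold.maximalAtlas 𝓘(ℝ, E4) ∞ M) :
    ContDiffOn ℝ ∞ (fun y => φ' (φ.symm y)) (φ.symm ≫ₕ φ').source := by
  have h := StructureGroupoid.compatible_of_mem_maximalAtlas hφ hφ'
  rw [contDiffGroupoid, mem_groupoid_of_pregroupoid] at h
  simpa [contDiffPregroupoid, Function.comp_def] using h.1

theorem chartInvD_change {φ φ' : OpenPartialHomeomorph M E4}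
    (hφ : φ ∈ IsManifold.maximalAtlas 𝓘(ℝ, E4) ∞ M)
    (hφ' : φ' ∈ IsManifold.maximalAtlas 𝓘(ℝ, E4) ∞ M) {y : E4} (hy : y ∈ (φ.symm ≫ₕ φ').source)
    (v : E4) : (show E4 from chartInvD φ y v) =
      (show E4 from chartInvD φ' (φ' (φ.symm y)) (fderiv ℝ (fun y => φ' (φ.symm y)) y v)) := by
  have hO : IsOpen (φ.symm ≫ₕ φ').source := (φ.symm ≫ₕ φ').open_source
  have hd : DifferentiableAt ℝ (fun y => φ' (φ.symm y)) y :=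
    ((contDiffOn_chart_change hφ hφ').contDiffAt (hO.mem_nhds hy)).differentiableAt (by simp)
  have hm' : MDifferentiableAt 𝓘(ℝ, E4) 𝓘(ℝ, E4) φ'.symm (φ' (φ.symm y)) :=
    (mdifferentiable_of_mem_maximalAtlas hφ').mdifferentiableAt_symm (φ'.map_source hy.2)
  have h1 : φ.symm =ᶠ[nhds y] φ'.symm ∘ fun y => φ' (φ.symm y) := by
    filter_upwards [hO.mem_nhds hy] with z hz
    exact (φ'.left_inv hz.2).symm
  have h2 := h1.mfderiv_eq (I := 𝓘(ℝ, E4)) (I' := 𝓘(ℝ, E4))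
  have h3 := mfderiv_comp y hm' hd.mdifferentiableAt
  rw [mfderiv_eq_fderiv] at h3
  exact DFunLike.congr_fun (h2.trans h3) v

theorem mk_eq_mk {p p' : M} (h : p = p') {N : Submodule ℝ (TangentSpace 𝓘(ℝ, E4) p)}
    {N' : Submodule ℝ (TangentSpace 𝓘(ℝ, E4) p')}
    (hN : ∀ X : E4, (show TangentSpace 𝓘(ℝ, E4) p from X) ∈ N ↔
      (show TangentSpace 𝓘(ℝ, E4) p' from X) ∈ N') :
    (⟨p, N⟩ : TangentSubspace M) = ⟨p', N'⟩ := by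
  subst h
  congr 1
  ext X
  exact hN X

namespace TwistorChart

/-- The change of coordinates on `M` between two twistor charts. -/
def baseChange (c c' : TwistorChart g K) (y : E4) : E4 := c'.φ (c.φ.symm y)

/-- The domain of the change of coordinates. -/
def overlap (c c' : TwistorChart g K) : Set E4 :=
  c.V ∩ ((c.φ.symm ≫ₕ c'.φ).source ∩ c.baseChange c' ⁻¹' c'.V)

/-- The coframe of the second chart, in the coordinates of the first. -/
def coframeChange (c c' : TwistorChart g K) (y : E4) : Mat4 :=
  c'.θ (c.baseChange c' y) * LinearMap.toMatrix' (fderiv ℝ (c.baseChange c') y).toLinearMap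

variable (c c' : TwistorChart g K) {y : E4}

theorem isOpen_overlap : IsOpen (c.overlap c') :=
  c.isOpen_V.inter ((c.φ.symm ≫ₕ c'.φ).isOpen_inter_preimage c'.isOpen_V)

theorem contDiffOn_baseChange : ContDiffOn ℝ ∞ (c.baseChange c') (c.overlap c') :=
  (contDiffOn_chart_change c.mem_atlas c'.mem_atlas).mono fun _ hy => hy.2.1

theorem symm_baseChange (hy : y ∈ c.overlap c') :
    c'.φ.symm (c.baseChange c' y) = c.φ.symm y := c'.φ.left_inv hy.2.1.2

theorem chartInvD_baseChange (hy : y ∈ c.overlap c') (v : E4) :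
    (show E4 from chartInvD c.φ y v) =
      (show E4 from chartInvD c'.φ (c.baseChange c' y) (fderiv ℝ (c.baseChange c') y v)) :=
  chartInvD_change c.mem_atlas c'.mem_atlas hy.2.1 v

theorem coframeChange_mulVec (y v : E4) : c.coframeChange c' y *ᵥ v =
    c'.θ (c.baseChange c' y) *ᵥ fderiv ℝ (c.baseChange c') y v := by
  rw [coframeChange, ← Matrix.mulVec_mulVec]
  congr 1
  exact LinearMap.toMatrix'_mulVec _ _

theorem metric_baseChange (hy : y ∈ c.overlap c') (u v : E4) :
    u ⬝ᵥ coordMetric g c.φ y *ᵥ v = fderiv ℝ (c.baseChange c') y u ⬝ᵥ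
      coordMetric g c'.φ (c.baseChange c' y) *ᵥ fderiv ℝ (c.baseChange c') y v := by
  rw [← metric_chartInvD, ← metric_chartInvD]
  have key : ∀ {p p' : M}, p = p' → ∀ X Y : E4,
      g p (show TangentSpace 𝓘(ℝ, E4) p from X) (show TangentSpace 𝓘(ℝ, E4) p from Y) =
      g p' (show TangentSpace 𝓘(ℝ, E4) p' from X) (show TangentSpace 𝓘(ℝ, E4) p' from Y) := by
    rintro p _ rfl X Y
    rfl
  have h1 := key (c.symm_baseChange c' hy).symm (chartInvD c.φ y u) (chartInvD c.φ y v)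
  have e1 := c.chartInvD_baseChange c' hy u
  have e2 := c.chartInvD_baseChange c' hy v
  refine h1.trans ?_
  exact congrArg₂ (fun X Y : E4 =>
    g (c'.φ.symm (c.baseChange c' y))
      (show TangentSpace 𝓘(ℝ, E4) (c'.φ.symm (c.baseChange c' y)) from X)
      (show TangentSpace 𝓘(ℝ, E4) (c'.φ.symm (c.baseChange c' y)) from Y)) e1 e2

theorem endo_baseChange (hy : y ∈ c.overlap c') (v : E4) :
    fderiv ℝ (c.baseChange c') y (coordEndo K c.φ y *ᵥ v) =
      coordEndo K c'.φ (c.baseChange c' y) *ᵥ fderiv ℝ (c.baseChange c') y v := by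
  have hy' : c.baseChange c' y ∈ c'.φ.target := c'.V_subset hy.2.2
  obtain ⟨e, he, -, -⟩ := exists_chartEquiv c'.mem_atlas hy'
  have key : ∀ {p p' : M}, p = p' → ∀ X : E4,
      (show E4 from K p (show TangentSpace 𝓘(ℝ, E4) p from X)) =
      (show E4 from K p' (show TangentSpace 𝓘(ℝ, E4) p' from X)) := by
    rintro p _ rfl X
    rfl
  have h1 := key (c.symm_baseChange c' hy).symm (chartInvD c.φ y v)
  rw [endo_chartInvD c.mem_atlas (c.V_subset hy.1)] at h1
  have h2 := (c.chartInvD_baseChange c' hy _).symm.trans h1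
  have h3 : (show E4 from chartInvD c'.φ (c.baseChange c' y) (fderiv ℝ (c.baseChange c') y
      (coordEndo K c.φ y *ᵥ v))) = (show E4 from chartInvD c'.φ (c.baseChange c' y)
      (coordEndo K c'.φ (c.baseChange c' y) *ᵥ fderiv ℝ (c.baseChange c') y v)) := by
    refine h2.trans ?_
    have e1 := c.chartInvD_baseChange c' hy v
    have h4 := congrArg (fun X : E4 => (show E4 from K (c'.φ.symm (c.baseChange c' y))
      (show TangentSpace 𝓘(ℝ, E4) (c'.φ.symm (c.baseChange c' y)) from X))) e1
    exact h4.trans (endo_chartInvD c'.mem_atlas hy' _)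
  have h5 := congrArg (fun X : E4 => e (show TangentSpace 𝓘(ℝ, E4) _ from X)) h3
  exact (he _).symm.trans (h5.trans (he _))

/-- The coframe of one chart, transported to the other, is adapted there. -/
theorem isAdaptedCoframe_coframeChange (hgK : IsPKE g K) : IsAdaptedCoframe (c.overlap c')
    (coordMetric g c.φ) (coordEndo K c.φ) (c.coframeChange c') := by
  have hO := c.isOpen_overlap c'
  have hψ := c.contDiffOn_baseChange c'
  have hK := c.isParaKahlerOn hgK
  have hmet : ∀ y ∈ c.overlap c', coordMetric g c.φ y =
      (c.coframeChange c' y)ᵀ * nullForm * c.coframeChange c' y := by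
    intro y hy
    have h1 : ∀ u v : E4, u ⬝ᵥ coordMetric g c.φ y *ᵥ v =
        u ⬝ᵥ ((c.coframeChange c' y)ᵀ * nullForm * c.coframeChange c' y) *ᵥ v := by
      intro u v
      rw [c.metric_baseChange c' hy, c'.adapted.dotProduct_metric hy.2.2, ← coframeChange_mulVec,
        ← coframeChange_mulVec, Matrix.mul_assoc, ← Matrix.mulVec_mulVec, ← Matrix.mulVec_mulVec,
        Matrix.dotProduct_mulVec u, Matrix.vecMul_transpose]
    ext i j
    simpa using h1 (Pi.single i 1) (Pi.single j 1)
  refine ⟨?_, fun y hy hdet => hK.nondegenerate y hy.1 ?_, hmet, fun y hy => ?_⟩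
  · refine contDiffOn_matrix_mul (fun i j => (c'.adapted.smooth i j).comp hψ fun y hy => hy.2.2)
      fun i j => ?_
    have h1 := (hψ.fderiv_of_isOpen hO (m := ∞) (by simp)).clm_apply
      (contDiffOn_const (c := (Pi.single j 1 : E4)))
    have h2 := contDiffOn_pi.1 h1 i
    refine h2.congr fun y hy => ?_
    simp [LinearMap.toMatrix'_apply]
  · rw [hmet y hy, Matrix.det_mul, hdet, mul_zero]
  · refine Matrix.ext_of_mulVec_single fun j => ?_
    rw [← Matrix.mulVec_mulVec, coframeChange_mulVec, c.endo_baseChange c' hy,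
      Matrix.mulVec_mulVec, c'.adapted.paracomplex _ hy.2.2, ← Matrix.mulVec_mulVec,
      ← coframeChange_mulVec, Matrix.mulVec_mulVec]

/-- The factor relating the two fibre coordinates: `μ' = δ μ`. -/
def fibreFactor (y : E4) : ℝ := transDet c.θ (c.coframeChange c') y

theorem isAdaptedCoframe_overlap : IsAdaptedCoframe (c.overlap c') (coordMetric g c.φ)
    (coordEndo K c.φ) c.θ :=
  ⟨fun i j => (c.adapted.smooth i j).mono Set.inter_subset_left, fun y hy => c.adapted.coframe y hy.1,
    fun y hy => c.adapted.metric y hy.1, fun y hy => c.adapted.paracomplex y hy.1⟩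

theorem fibreFactor_ne_zero (hgK : IsPKE g K) (hy : y ∈ c.overlap c') :
    c.fibreFactor c' y ≠ 0 :=
  ((c.isAdaptedCoframe_overlap c').transMat_block (c.isAdaptedCoframe_coframeChange c' hgK) hy).1

theorem contDiffOn_fibreFactor (hgK : IsPKE g K) :
    ContDiffOn ℝ ∞ (c.fibreFactor c') (c.overlap c') :=
  (c.isAdaptedCoframe_overlap c').smooth_transDet (c.isAdaptedCoframe_coframeChange c' hgK)

theorem mem_pencilPlane_baseChange (hgK : IsPKE g K) (hy : y ∈ c.overlap c') (s t : ℝ) (v : E4) :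
    v ∈ pencilPlane c.θ y s t ↔ fderiv ℝ (c.baseChange c') y v ∈
      pencilPlane c'.θ (c.baseChange c' y) s (c.fibreFactor c' y * t) := by
  rw [(c.isAdaptedCoframe_overlap c').pencilPlane_trans
    (c.isAdaptedCoframe_coframeChange c' hgK) hy, mem_pencilPlane, mem_pencilPlane]
  simp only [coframeForm_apply, coframeChange_mulVec]
  rfl

theorem exists_fderiv_baseChange_eq (hgK : IsPKE g K) (hy : y ∈ c.overlap c') (w : E4) :
    ∃ v, fderiv ℝ (c.baseChange c') y v = w := by
  have h := c.isAdaptedCoframe_coframeChange c' hgK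
  refine ⟨(c.coframeChange c' y)⁻¹ *ᵥ (c'.θ (c.baseChange c' y) *ᵥ w), ?_⟩
  have h1 : c'.θ (c.baseChange c' y) *ᵥ fderiv ℝ (c.baseChange c') y
      ((c.coframeChange c' y)⁻¹ *ᵥ (c'.θ (c.baseChange c' y) *ᵥ w)) =
      c'.θ (c.baseChange c' y) *ᵥ w := by
    rw [← coframeChange_mulVec, Matrix.mulVec_mulVec, h.mul_inv hy, Matrix.one_mulVec]
  have h2 := congrArg (fun v => (c'.θ (c.baseChange c' y))⁻¹ *ᵥ v) h1
  simpa only [Matrix.mulVec_mulVec _ (c'.θ (c.baseChange c' y))⁻¹ (c'.θ (c.baseChange c' y)),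
    c'.adapted.inv_mul hy.2.2, Matrix.one_mulVec] using h2

theorem pencil_baseChange (hgK : IsPKE g K) (hy : y ∈ c.overlap c') (s t : ℝ) :
    (⟨c.φ.symm y, c.pencil y s t⟩ : TangentSubspace M) =
      ⟨c'.φ.symm (c.baseChange c' y),
        c'.pencil (c.baseChange c' y) s (c.fibreFactor c' y * t)⟩ := by
  refine mk_eq_mk (c.symm_baseChange c' hy).symm fun X => ?_
  constructor
  · rintro ⟨v, hv, hX⟩
    exact ⟨fderiv ℝ (c.baseChange c') y v, (c.mem_pencilPlane_baseChange c' hgK hy s t v).1 hv,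
      (c.chartInvD_baseChange c' hy v).symm.trans hX⟩
  · rintro ⟨w, hw, hX⟩
    obtain ⟨v, rfl⟩ := c.exists_fderiv_baseChange_eq c' hgK hy w
    exact ⟨v, (c.mem_pencilPlane_baseChange c' hgK hy s t v).2 hw,
      (c.chartInvD_baseChange c' hy v).trans hX⟩

/-- The change of the trace of the connection form between two charts is minus the logarithmic
derivative of the change of fibre coordinate, so `dμ + μ (Γ¹₁ + Γ²₂)` is rescaled. -/
theorem traceConn_baseChange (hgK : IsPKE g K) (hy : y ∈ c.overlap c') (u : E4) :
    c.fibreFactor c' y * traceConn (coordMetric g c'.φ) c'.θ (c.baseChange c' y)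
        (fderiv ℝ (c.baseChange c') y u) =
      c.fibreFactor c' y * traceConn (coordMetric g c.φ) c.θ y u
        - fderiv ℝ (c.fibreFactor c') y u := by
  have hO := c.isOpen_overlap c'
  have h := c.isAdaptedCoframe_coframeChange c' hgK
  have hK := (c.isParaKahlerOn hgK).mono (V := c.overlap c') Set.inter_subset_left
  rw [← h.traceConn_pullback c'.adapted hK (c'.isParaKahlerOn hgK) hO c'.isOpen_V
    (c.contDiffOn_baseChange c') (fun z hz => hz.2.2) (fun z _ v => c.coframeChange_mulVec c' z v)
    hy u]
  exact (c.isAdaptedCoframe_overlap c').traceConn_trans h hK hO hy u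

/-- The change of the affine fibre coordinate, for `μ' = δ μ`; the coordinate is `μ` or `1 / μ`
according to the value of the Boolean. -/
def fibreChange (b b' : Bool) (δ r : ℝ) : ℝ :=
  match b, b' with
  | false, false => δ * r
  | false, true => (δ * r)⁻¹
  | true, false => δ * r⁻¹
  | true, true => δ⁻¹ * r

/-- Points `[s : t]` and `[s' : t']` of the projective line with `[s' : t'] = [s : δ t]` have affine
coordinates related by `fibreChange`. -/
theorem fibreChange_eq {b b' : Bool} {δ r r' : ℝ} (hδ : δ ≠ 0)
    (hrel : fibreFst b' r' * (δ * fibreSnd b r) = fibreSnd b' r' * fibreFst b r) :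
    (b = b' ∨ r ≠ 0) ∧ fibreChange b b' δ r = r' := by
  cases b <;> cases b' <;> simp only [fibreFst, fibreSnd, fibreChange,
    Bool.false_eq_true, if_false, if_true, reduceCtorEq, false_or, true_or, true_and,
    one_mul, mul_one] at hrel ⊢
  · exact hrel
  · have hr : r ≠ 0 := by
      intro h
      rw [h] at hrel
      simp at hrel
    exact ⟨hr, inv_eq_of_mul_eq_one_left hrel⟩
  · have hr : r ≠ 0 := by
      intro h
      rw [h, mul_zero] at hrel
      exact hδ hrel
    refine ⟨hr, ?_⟩
    rw [hrel]
    field_simp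
  · rw [← hrel]
    field_simp

theorem contDiffOn_fibreChange {b b' : Bool} {δ : E4 × ℝ → ℝ} {O : Set (E4 × ℝ)}
    (hδ : ContDiffOn ℝ ∞ δ O) (hδ0 : ∀ q ∈ O, δ q ≠ 0) (hr : ∀ q ∈ O, b = b' ∨ q.2 ≠ 0) :
    ContDiffOn ℝ ∞ (fun q => fibreChange b b' (δ q) q.2) O := by
  cases b <;> cases b' <;> simp only [reduceCtorEq, false_or, true_or] at hr
  · exact hδ.mul contDiffOn_snd
  · exact (hδ.mul contDiffOn_snd).inv fun q hq => mul_ne_zero (hδ0 q hq) (hr q hq)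
  · exact hδ.mul (contDiffOn_snd.inv hr)
  · exact (hδ.inv hδ0).mul contDiffOn_snd

theorem exists_fibreChange_smul {b b' : Bool} {δ r : ℝ} (hδ : δ ≠ 0) (hr : b = b' ∨ r ≠ 0) :
    ∃ k ≠ 0, fibreFst b r = k * fibreFst b' (fibreChange b b' δ r) ∧
      δ * fibreSnd b r = k * fibreSnd b' (fibreChange b b' δ r) := by
  cases b <;> cases b' <;> simp only [fibreFst, fibreSnd, fibreChange, Bool.false_eq_true, if_false,
    if_true, reduceCtorEq, false_or, true_or] at hr ⊢
  · exact ⟨1, one_ne_zero, by ring, by ring⟩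
  · exact ⟨δ * r, mul_ne_zero hδ hr, by field_simp, by ring⟩
  · exact ⟨r, hr, by ring, by field_simp⟩
  · exact ⟨δ, hδ, by field_simp, by ring⟩

/-- The derivative of the change of fibre coordinate is `dr' = P dr - (ε' r') dδ / δ`, where
`ε' r' = P (ε r)` with the same factor `P`; here `ε` and `ε'` are the values of `fibreSign`. -/
theorem hasFDerivAt_fibreChange {b b' : Bool} {δ : E4 → ℝ} {L : E4 →L[ℝ] ℝ} {q : E4 × ℝ}
    (hδ : HasFDerivAt δ L q.1) (hδ0 : δ q.1 ≠ 0) (hr : b = b' ∨ q.2 ≠ 0) :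
    ∃ (P : ℝ) (D : E4 × ℝ →L[ℝ] ℝ), P ≠ 0 ∧
      HasFDerivAt (fun p : E4 × ℝ => fibreChange b b' (δ p.1) p.2) D q ∧
      fibreSign b' * fibreChange b b' (δ q.1) q.2 = P * (fibreSign b * q.2) ∧
      ∀ w, δ q.1 * D w = δ q.1 * (P * w.2)
        - fibreSign b' * fibreChange b b' (δ q.1) q.2 * L w.1 := by
  have h1 : HasFDerivAt (fun p : E4 × ℝ => δ p.1) (L.comp (ContinuousLinearMap.fst ℝ E4 ℝ)) q :=
    hδ.comp q hasFDerivAt_fst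
  have h2 : HasFDerivAt (fun p : E4 × ℝ => p.2) (ContinuousLinearMap.snd ℝ E4 ℝ) q :=
    hasFDerivAt_snd
  have hinv : ∀ {f : E4 × ℝ → ℝ} {D : E4 × ℝ →L[ℝ] ℝ}, HasFDerivAt f D q → f q ≠ 0 →
      HasFDerivAt (fun p => (f p)⁻¹) (-(f q ^ 2)⁻¹ • D) q := fun hf h0 =>
    HasDerivAt.comp_hasFDerivAt q (hasDerivAt_inv h0) hf
  cases b <;> cases b' <;> simp only [fibreSign, fibreChange, Bool.false_eq_true, if_false,
    if_true, reduceCtorEq, false_or, true_or] at hr ⊢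
  · refine ⟨δ q.1, _, hδ0, h1.fun_mul h2, by ring, fun w => ?_⟩
    simp
    ring
  · refine ⟨-(δ q.1 * q.2 ^ 2)⁻¹, _, by
      refine neg_ne_zero.2 (inv_ne_zero (mul_ne_zero hδ0 (pow_ne_zero 2 hr))),
      hinv (h1.fun_mul h2) (mul_ne_zero hδ0 hr), by field_simp, fun w => ?_⟩
    simp
    field_simp
    ring
  · refine ⟨-(δ q.1 * (q.2 ^ 2)⁻¹), _,
      neg_ne_zero.2 (mul_ne_zero hδ0 (inv_ne_zero (pow_ne_zero 2 hr))),
      h1.fun_mul (hinv h2 hr), by field_simp, fun w => ?_⟩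
    simp
    field_simp
  · refine ⟨(δ q.1)⁻¹, _, inv_ne_zero hδ0, (hinv h1 hδ0).fun_mul h2, by ring, fun w => ?_⟩
    simp
    field_simp
    ring

/-- Changes of twistor charts are smooth and preserve the twistor distribution. -/
theorem exists_change (hgK : IsPKE g K) {q₁ q₂ : E4 × ℝ} (hq₁ : q₁ ∈ c.domain)
    (hq₂ : q₂ ∈ c'.domain) (hpt : c.point q₁ = c'.point q₂) :
    ∃ (O : Set (E4 × ℝ)) (τ : E4 × ℝ → E4 × ℝ), IsOpen O ∧ q₁ ∈ O ∧ O ⊆ c.domain ∧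
      ContDiffOn ℝ ∞ τ O ∧ τ q₁ = q₂ ∧
      ∀ q ∈ O, τ q ∈ c'.domain ∧ c'.point (τ q) = c.point q ∧
        c.twistorDistribution q =
          (c'.twistorDistribution (τ q)).comap (fderiv ℝ τ q).toLinearMap := by
  rw [point_eq, point_eq] at hpt
  have hp : c.φ.symm q₁.1 = c'.φ.symm q₂.1 := congrArg Sigma.fst hpt
  have hψ₁ : c.baseChange c' q₁.1 = q₂.1 := by
    rw [baseChange, hp, c'.φ.right_inv (c'.V_subset hq₂.1)]
  have hy₁ : q₁.1 ∈ c.overlap c' := by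
    refine ⟨hq₁.1, ⟨c.V_subset hq₁.1, ?_⟩, ?_⟩
    · change c.φ.symm q₁.1 ∈ c'.φ.source
      rw [hp]
      exact c'.φ.map_target (c'.V_subset hq₂.1)
    · change c.baseChange c' q₁.1 ∈ c'.V
      rw [hψ₁]
      exact hq₂.1
  have hδ := fun {y} hy => c.fibreFactor_ne_zero c' (y := y) hgK hy
  have hδ₁ := hδ hy₁
  -- comparison of the homogeneous fibre coordinates of the two points
  have hrel : fibreFst c'.atInfinity q₂.2 *
      (c.fibreFactor c' q₁.1 * fibreSnd c.atInfinity q₁.2) =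
      fibreSnd c'.atInfinity q₂.2 * fibreFst c.atInfinity q₁.2 := by
    rw [c.pencil_baseChange c' hgK hy₁, hψ₁] at hpt
    exact c'.pencil_eq_imp hq₂.1 (eq_of_heq (Sigma.mk.inj hpt).2)
  have hr₁ : (c.atInfinity = c'.atInfinity ∨ q₁.2 ≠ 0) ∧
      fibreChange c.atInfinity c'.atInfinity (c.fibreFactor c' q₁.1) q₁.2 = q₂.2 :=
    fibreChange_eq hδ₁ hrel
  let τ : E4 × ℝ → E4 × ℝ := fun q => (c.baseChange c' q.1,
    fibreChange c.atInfinity c'.atInfinity (c.fibreFactor c' q.1) q.2)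
  let O : Set (E4 × ℝ) := {q | q.1 ∈ c.overlap c' ∧ (c.atInfinity = c'.atInfinity ∨ q.2 ≠ 0)}
  have hO : IsOpen O := by
    refine ((c.isOpen_overlap c').preimage continuous_fst).inter ?_
    exact isOpen_const.union (isOpen_ne.preimage continuous_snd)
  have hψs : ContDiffOn ℝ ∞ (fun q : E4 × ℝ => c.baseChange c' q.1) O :=
    (c.contDiffOn_baseChange c').comp contDiffOn_fst fun q hq => hq.1
  have hδs : ContDiffOn ℝ ∞ (fun q : E4 × ℝ => c.fibreFactor c' q.1) O :=
    (c.contDiffOn_fibreFactor c' hgK).comp contDiffOn_fst fun q hq => hq.1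
  have hδ0 : ∀ q ∈ O, c.fibreFactor c' q.1 ≠ 0 := fun q hq => hδ hq.1
  refine ⟨O, τ, hO, ⟨hy₁, hr₁.1⟩, fun q hq => ⟨hq.1.1, trivial⟩, hψs.prodMk ?_,
    Prod.ext hψ₁ hr₁.2, fun q hq => ⟨⟨hq.1.2.2, trivial⟩, ?_, ?_⟩⟩
  · exact contDiffOn_fibreChange hδs hδ0 fun q hq => hq.2
  · obtain ⟨k, hk, e1, e2⟩ := exists_fibreChange_smul (hδ hq.1) hq.2
    rw [point_eq, point_eq, c.pencil_baseChange c' hgK hq.1, e1, e2, c'.pencil_smul _ hk]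
  · obtain ⟨k, hk, e1, e2⟩ := exists_fibreChange_smul (hδ hq.1) hq.2
    have hov := (c.isOpen_overlap c').mem_nhds hq.1
    have hδd : HasFDerivAt (c.fibreFactor c') (fderiv ℝ (c.fibreFactor c') q.1) q.1 :=
      (((c.contDiffOn_fibreFactor c' hgK).contDiffAt hov).differentiableAt (by simp)).hasFDerivAt
    have hψd : HasFDerivAt (c.baseChange c') (fderiv ℝ (c.baseChange c') q.1) q.1 :=
      (((c.contDiffOn_baseChange c').contDiffAt hov).differentiableAt (by simp)).hasFDerivAt
    obtain ⟨P, D, hP, hD, hPr, hDw⟩ := hasFDerivAt_fibreChange hδd (hδ hq.1) hq.2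
    have hτ : HasFDerivAt τ (((fderiv ℝ (c.baseChange c') q.1).comp
        (ContinuousLinearMap.fst ℝ E4 ℝ)).prod D) q :=
      (hψd.comp q hasFDerivAt_fst).prodMk hD
    ext w
    have hq' : τ q ∈ c'.domain := ⟨hq.1.2.2, trivial⟩
    rw [Submodule.mem_comap, hτ.fderiv, c.mem_twistorDistribution hgK ⟨hq.1.1, trivial⟩,
      c'.mem_twistorDistribution hgK hq', c.mem_pencilPlane_baseChange c' hgK hq.1, e1, e2,
      pencilPlane_smul _ _ hk]
    refine and_congr Iff.rfl ?_
    have htr := c.traceConn_baseChange c' hgK hq.1 w.1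
    change w.2 = fibreSign c.atInfinity * q.2 * traceConn (coordMetric g c.φ) c.θ q.1 w.1 ↔
      D w = fibreSign c'.atInfinity *
        fibreChange c.atInfinity c'.atInfinity (c.fibreFactor c' q.1) q.2 *
          traceConn (coordMetric g c'.φ) c'.θ (c.baseChange c' q.1)
            (fderiv ℝ (c.baseChange c') q.1 w.1)
    have hw := hDw w
    rw [hPr] at hw ⊢
    constructor
    · intro h
      refine mul_left_cancel₀ (hδ hq.1) ?_
      rw [h] at hw
      linear_combination hw - P * (fibreSign c.atInfinity * q.2) * htr
    · intro h
      refine mul_left_cancel₀ hP (mul_left_cancel₀ (hδ hq.1) ?_)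
      rw [h] at hw
      linear_combination -hw + P * (fibreSign c.atInfinity * q.2) * htr

end TwistorChart

end TwistorChanges

/-! ### The twistor distribution of a para-Kähler–Einstein metric -/

theorem mainTheorem2 {M : Type*} [TopologicalSpace M] [ChartedSpace E4 M]
    [IsManifold 𝓘(ℝ, E4) ∞ M] (g : BilinField M) (K : EndoField M) (hgK : IsPKE g K) :
    -- the twistor charts make `𝒪₊` a smooth 5-manifold and a circle bundle over `M`
    ((∀ z ∈ selfDualBundle g K, ∃ c : TwistorChart g K, ∃ q ∈ c.domain, c.point q = z) ∧
      (∀ c : TwistorChart g K, Set.InjOn c.point c.domain ∧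
        c.point '' c.domain = {z ∈ selfDualBundle g K | z.1 ∈ c.φ.symm '' c.V ∧
          z.2 ≠ if c.atInfinity then planeHbar K z.1 else planeH K z.1})) ∧
    -- `𝒟` is a smooth rank 2 distribution, given in the affine coordinate `μ` by
    -- `Ker {θ¹ + μ θ⁴, θ² - μ θ³, dμ + μ (Γ¹₁ + Γ²₂)}`
    (∀ c : TwistorChart g K, IsSmoothDistribution 2 c.twistorDistribution c.domain ∧
      (c.atInfinity = false → ∀ q ∈ c.domain, ∀ w, w ∈ c.twistorDistribution q ↔
        (c.thetaForm 0 q + q.2 • c.thetaForm 3 q) w = 0 ∧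
        (c.thetaForm 1 q - q.2 • c.thetaForm 2 q) w = 0 ∧
        (TwistorChart.dFibre + q.2 • c.traceForm q) w = 0)) ∧
    -- changes of twistor charts are smooth and preserve `𝒟`
    (∀ c₁ c₂ : TwistorChart g K, ∀ q₁ ∈ c₁.domain, ∀ q₂ ∈ c₂.domain,
      c₁.point q₁ = c₂.point q₂ →
        ∃ (O : Set (E4 × ℝ)) (τ : E4 × ℝ → E4 × ℝ), IsOpen O ∧ q₁ ∈ O ∧ O ⊆ c₁.domain ∧
          ContDiffOn ℝ ∞ τ O ∧ τ q₁ = q₂ ∧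
          ∀ q ∈ O, τ q ∈ c₂.domain ∧ c₂.point (τ q) = c₁.point q ∧
            c₁.twistorDistribution q =
              (c₂.twistorDistribution (τ q)).comap (fderiv ℝ τ q).toLinearMap) ∧
    -- the fibre coordinate vanishes exactly at the points of `ℋ` and `ℋ̄`
    (∀ c : TwistorChart g K, ∀ q ∈ c.domain,
      q.2 ≠ 0 ↔ (c.point q).2 ≠ planeH K (c.point q).1 ∧
        (c.point q).2 ≠ planeHbar K (c.point q).1) ∧
    (HasNonzeroScalarCurvature g →
      -- `𝒟` is (2,3,5) away from `ℋ` and `ℋ̄`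
      (∀ c : TwistorChart g K, Is235On c.twistorDistribution c.punctured) ∧
      -- along the hypersurfaces `ℋ` and `ℋ̄` of `𝒪₊`, `𝒟` is tangent to them and integrable
      (∀ c : TwistorChart g K, ∀ q ∈ c.domain, q.2 = 0 →
        (∀ w ∈ c.twistorDistribution q, w.2 = 0) ∧
          derivedSystem c.twistorDistribution q = c.twistorDistribution q) ∧
      -- the associated conformal structure of signature (3,2) is `[h]`
      ∀ c : TwistorChart g K, c.atInfinity = false →
        (∀ q ∈ c.punctured, c.psi q ≠ 0 ∧ HasSignatureThreeTwo (c.metricH q)) ∧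
          RepresentsConformalStructure c.twistorDistribution c.punctured c.metricH) := by
  refine ⟨⟨fun z hz => TwistorChart.exists_point_eq hgK hz,
      fun c => ⟨c.injOn_point, c.image_point⟩⟩,
    fun c => ⟨c.isSmoothDistribution hgK, fun hc q hq w => c.mem_twistorDistribution_iff hgK hc hq w⟩,
    fun c₁ c₂ q₁ hq₁ q₂ hq₂ h => c₁.exists_change c₂ hgK hq₁ hq₂ h,
    fun c q hq => c.snd_ne_zero_iff hq, fun hs => ⟨fun c => c.is235On hgK hs,
      fun c q hq h0 => ⟨fun w hw => ?_, c.derivedSystem_eq hgK hq h0⟩,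
      fun c hc => ⟨fun q hq => ⟨c.psi_ne_zero hgK hs hq.1, c.hasSignatureThreeTwo hgK hs hq⟩,
        c.representsConformalStructure hgK hs hc⟩⟩⟩
  rw [((c.mem_twistorDistribution hgK hq w).1 hw).2, h0, mul_zero, zero_mul]
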